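/- Let $\mathbf T$ be the unit circle in $\mathbb C$, $\alpha$ its normalized Haar measure, and for a function $\varphi$ on $\mathbf T$ let $\varphi'(z)=\frac{d}{dt}\big|_{t=0}\varphi(ze^{it})$. Let $Q:\mathbf T\to\mathbb R$ be a $C^1$ potential. For a probability measure $\mu$ on $\mathbf T$ put $$E_Q(\mu)=\int Q\,d\mu-\iint\log|z-w|\,\mu(dz)\mu(dw)\in(-\infty,+\infty],$$ and let $\mu_Q$ be the unique minimizer of $E_Q$ over all probability measures on $\mathbf T$. For a smooth probability measure $\mu$ (one with a $C^\infty$ density with respect to $\alpha$) put $$I_Q(\mu)=\int (H\mu-Q')^2\,d\mu-\Big(\int Q'\,d\mu\Big)^2,\qquad H\mu(e^{ix})=\mathrm{p.v.}\!\int\cot\Big(\frac{x-y}{2}\Big)\mu(de^{iy}).$$ For $u\in\mathbb R$ let $\bar\mu_u$ be the lift of $\mu$ to $[u,u+2\pi)$, that is, the image of $\mu$ under the inverse of $[u,u+2\pi)\ni x\mapsto e^{ix}$, and for probability measures $\mu,\nu$ on $\mathbf T$ let $$\mathcal W_2(\mu,\nu)=\sup\Big\{W_2(\bar\mu_u,\bar\nu_v):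 u,v\in[0,2\pi],\ \int x\,\bar\mu_u(dx)=\int x\,\bar\nu_v(dx)\Big\},$$ where $W_2$ is the usual Wasserstein distance on $\mathbb R$ and the supremum over the empty set is $+\infty$. For $\rho>0$ consider the inequalities - $LSI(\rho)$: $\;E_Q(\mu)-E_Q(\mu_Q)\le\frac{1}{4\rho}I_Q(\mu)$ for every smooth probability measure $\mu$ on $\mathbf T$; - $T(\rho)$: $\;\rho\,\mathcal W_2(\mu,\mu_Q)^2\le E_Q(\mu)-E_Q(\mu_Q)$ for every probability measure $\mu$ on $\mathbf T$. Then for every $\rho>0$, if $Q$ satisfies $LSI(\rho)$, then $Q$ satisfies $T(\rho)$. -/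

import Mathlib

open Set Filter Topology MeasureTheory
open scoped ENNReal ContDiff

noncomputable section

namespace FreeCircle

/-- The unit circle carries its Borel `σ`-algebra. -/
instance instMeasurableSpaceCircle : MeasurableSpace Circle := borel Circle

instance instBorelSpaceCircle : BorelSpace Circle := ⟨rfl⟩

/-- The normalized Haar measure `α` on the unit circle: the image of `dx / (2π)` on `[-π, π)`
under `x ↦ e^{ix}`. -/
def haar : Measure Circle :=
  Measure.map Circle.exp
    (ENNReal.ofReal (1 / (2 * Real.pi)) • volume.restrict (Ico (-Real.pi) Real.pi))

/-- A function on the circle is of class `C^n` if the `2π`-periodic function `x ↦ φ (e^{ix})` is. -/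
def IsCn (n : WithTop ℕ∞) (φ : Circle → ℝ) : Prop :=
  ContDiff ℝ n (fun x : ℝ => φ (Circle.exp x))

/-- The derivative `φ'(z) = d/dt φ (z e^{it})` at `t = 0`. -/
def circleDeriv (φ : Circle → ℝ) (z : Circle) : ℝ :=
  deriv (fun t : ℝ => φ (z * Circle.exp t)) 0

/-- A smooth probability measure on the circle: a probability measure with a `C^∞` density
with respect to the Haar measure. -/
def IsSmoothProbability (μ : Measure Circle) : Prop :=
  IsProbabilityMeasure μ ∧
    ∃ p : Circle → ℝ, IsCn ∞ p ∧ (∀ z, 0 ≤ p z) ∧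
      μ = haar.withDensity (fun z => ENNReal.ofReal (p z))

open Classical in
/-- The kernel `log (2 / |z - w|)`, with value `+∞` on the diagonal. It is nonnegative because
the circle has diameter `2`. -/
def logKernel (z w : Circle) : ℝ≥0∞ :=
  if z = w then ⊤ else ENNReal.ofReal (Real.log (2 / ‖(z : ℂ) - (w : ℂ)‖))

/-- The logarithmic energy `E_Q(μ) = ∫ Q dμ - ∬ log |z - w| μ(dz) μ(dw)` of a probability
measure, with values in `(-∞, +∞]`. Since `μ` has mass one and
`-log |z - w| = log (2 / |z - w|) - log 2`, it is written through a nonnegative kernel. -/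
def energy (Q : Circle → ℝ) (μ : Measure Circle) : EReal :=
  ((∫ z, Q z ∂μ - Real.log 2 : ℝ) : EReal) +
    ((∫⁻ z, ∫⁻ w, logKernel z w ∂μ ∂μ : ℝ≥0∞) : EReal)

/-- `μ` minimizes `E_Q` among all probability measures on the circle. -/
def IsEnergyMinimizer (Q : Circle → ℝ) (μ : Measure Circle) : Prop :=
  IsProbabilityMeasure μ ∧ ∀ ν : Measure Circle, IsProbabilityMeasure ν → energy Q μ ≤ energy Q ν

/-- The equilibrium measure `μ_Q`: the minimizer of `E_Q` (for continuous `Q` there is exactly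
one). -/
def equilibriumMeasure (Q : Circle → ℝ) : Measure Circle :=
  Classical.epsilon (IsEnergyMinimizer Q)

/-- The transform `Hμ(z) = p.v. ∫ cot ((x - y) / 2) μ(dw)` for `z = e^{ix}`, `w = e^{iy}`,
as the limit of the integrals over `|z - w| > ε` when `ε ↓ 0`. As the cotangent has period `π`,
any determination of `x - y` may be used, here the argument of `z / w`. -/
def hilbertTransform (μ : Measure Circle) (z : Circle) : ℝ :=
  limUnder (𝓝[>] (0 : ℝ)) fun ε : ℝ =>
    ∫ w in {w : Circle | ε < ‖(z : ℂ) - (w : ℂ)‖},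
      Real.cot (Complex.arg ((z / w : Circle) : ℂ) / 2) ∂μ

/-- `I_Q(μ) = ∫ (Hμ - Q')² dμ - (∫ Q' dμ)²`. -/
def fisherInfo (Q : Circle → ℝ) (μ : Measure Circle) : ℝ :=
  ∫ z, (hilbertTransform μ z - circleDeriv Q z) ^ 2 ∂μ - (∫ z, circleDeriv Q z ∂μ) ^ 2

/-- The inverse of `x ↦ e^{ix}` restricted to `[u, u + 2π)`. -/
def expInv (u : ℝ) (z : Circle) : ℝ :=
  toIcoMod Real.two_pi_pos u (Complex.arg (z : ℂ))

theorem expInv_mem (u : ℝ) (z : Circle) : expInv u z ∈ Ico u (u + 2 * Real.pi) :=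
  toIcoMod_mem_Ico _ _ _

theorem exp_expInv (u : ℝ) (z : Circle) : Circle.exp (expInv u z) = z := by
  have h := toIcoMod_add_toIcoDiv_zsmul Real.two_pi_pos u (Complex.arg (z : ℂ))
  have h2 : Circle.exp (expInv u z + toIcoDiv Real.two_pi_pos u (Complex.arg (z : ℂ)) •
      (2 * Real.pi)) = z := by
    rw [expInv, h, Circle.exp_arg]
  rw [zsmul_eq_mul, Circle.periodic_exp.int_mul _ _] at h2
  exact h2

theorem measurable_expInv (u : ℝ) : Measurable (expInv u) := by
  have h : Measurable fun z : Circle => Complex.arg (z : ℂ) :=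
    Complex.measurable_arg.comp (Continuous.measurable (by fun_prop))
  have e : expInv u = fun z : Circle =>
      Int.fract ((Complex.arg (z : ℂ) - u) / (2 * Real.pi)) * (2 * Real.pi) + u := by
    funext z
    rw [expInv, toIcoMod_eq_sub, toIcoMod_eq_fract_mul]
  rw [e]
  exact ((measurable_fract.comp ((h.sub_const u).div_const _)).mul_const _).add_const _

/-- The lift `μ̄_u` of `μ` to the interval `[u, u + 2π)` of the real line. -/
def lift (u : ℝ) (μ : Measure Circle) : Measure ℝ :=
  μ.map (expInv u)

/-- The Wasserstein distance `W_p` on the real line, as the infimum over all transport plans. -/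
def wasserstein (p : ℝ) (μ ν : Measure ℝ) : ℝ≥0∞ :=
  (⨅ (γ : Measure (ℝ × ℝ)) (_ : γ.map Prod.fst = μ) (_ : γ.map Prod.snd = ν),
    ∫⁻ q, ENNReal.ofReal (|q.1 - q.2| ^ p) ∂γ) ^ (1 / p)

/-- The pairs `(u, v)` in `[0, 2π]²` for which the lifts `μ̄_u` and `ν̄_v` have the same mean. -/
def balancedPairs (μ ν : Measure Circle) : Set (ℝ × ℝ) :=
  {s | s.1 ∈ Icc 0 (2 * Real.pi) ∧ s.2 ∈ Icc 0 (2 * Real.pi) ∧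
    ∫ x, x ∂(lift s.1 μ) = ∫ x, x ∂(lift s.2 ν)}

open Classical in
/-- The modified distance `𝒲_p(μ, ν)`: the supremum of `W_p(μ̄_u, ν̄_v)` over all `u, v ∈ [0, 2π]`
such that the two lifts have the same mean, and `+∞` if there are no such `u, v`. -/
def modifiedWasserstein (p : ℝ) (μ ν : Measure Circle) : ℝ≥0∞ :=
  if (balancedPairs μ ν).Nonempty then
    ⨆ s ∈ balancedPairs μ ν, wasserstein p (lift s.1 μ) (lift s.2 ν)
  else ⊤

/-- The free log-Sobolev inequality `LSI(ρ)` for the potential `Q`: for every smooth probability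
measure `μ`, `E_Q(μ) - E_Q(μ_Q) ≤ I_Q(μ) / (4ρ)`. -/
def LSI (Q : Circle → ℝ) (ρ : ℝ) : Prop :=
  ∀ μ : Measure Circle, IsSmoothProbability μ →
    energy Q μ - energy Q (equilibriumMeasure Q) ≤ ((1 / (4 * ρ) * fisherInfo Q μ : ℝ) : EReal)

/-- The transportation inequality `T(ρ)` for the potential `Q`: for every probability measure `μ`
on the circle, `ρ 𝒲₂(μ, μ_Q)² ≤ E_Q(μ) - E_Q(μ_Q)`. -/
def TransportationInequality (Q : Circle → ℝ) (ρ : ℝ) : Prop :=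
  ∀ μ : Measure Circle, IsProbabilityMeasure μ →
    (ρ : EReal) * ((modifiedWasserstein 2 μ (equilibriumMeasure Q) ^ 2 : ℝ≥0∞) : EReal) ≤
      energy Q μ - energy Q (equilibriumMeasure Q)

end FreeCircle

end

/-! The argument is an Otto–Villani argument without gradient flows. Let `F` denote the excess of
the energy over its minimum. Formally, the log-Sobolev inequality bounds the slope of `√F` from
below by `√ρ` wherever `F > 0`. A nonnegative function with such a slope bound must vanish at some
point within distance `√F / √ρ` of the starting point, and that distance is the transport cost.
Ekeland's principle (`exists_ekeland_point`) replaces the flow.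

The metric space is a closed subset of `L²(μ)`: random variables `Y` with prescribed mean,
oscillation at most `2π` and bounded energy of the law of `e^{iY}`. Starting from the lift `X` of
`μ`, for `ε² < ρ` Ekeland yields `Y` with `ε * dist X Y ≤ √F(X)` at which `√F` has slope at most
`ε`. Perturbing `Y` by `t φ(e^{iY})`, with `φ` Lipschitz and centred, bounds the first variation of
the energy by `2ε√F ‖φ‖` in `L²`. If `F > 0`, this and LSI give `F ≤ (ε²/ρ) F < F`, which is absurd;
so `Y` has law `μ_Q` on the circle (`LSI.exists_transport`). The mean constraint produces a Lagrange
multiplier, which matches the term `(∫ Q' dμ)²` of the Fisher information.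

LSI is assumed only for smooth measures, whereas the law of `e^{iY}` merely has finite energy.
Poisson regularization closes the gap (`LSI.realEnergy_sub_le`). An addition formula for the
cotangent and the Herglotz kernel shows that testing the Hilbert transform of the regularized
measure against `ψ` is the same as testing the first variation at the original measure against the
Poisson integral of `ψ` (`cotForm_poissonTransform`). Duality bounds the Fisher information, and
lower semicontinuity of the energy passes to the limit.

Finally, a variable with oscillation at most `2π` and atomless circle law is distributed as a lift
of that law (`exists_map_eq_lift`), and the mean determines the lift
(`lift_eq_lift_of_integral_eq`). Hence `(X, Y)` couples exactly the lifts that occur in the modified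
distance. The mixed log energy has a positive Fourier expansion, which makes the minimizer unique;
this identifies the law of `e^{iY}` once `F = 0`. -/

/-! ### Ekeland's variational principle -/

/-- A weak form of Ekeland's variational principle. -/
theorem exists_ekeland_point {X : Type*} [MetricSpace X] [CompleteSpace X] {f : X → ℝ}
    (hf : LowerSemicontinuous f) (hb : ∀ x, 0 ≤ f x) (x₀ : X) {ε : ℝ} (hε : 0 < ε) :
    ∃ y, f y + ε * dist x₀ y ≤ f x₀ ∧ ∀ z, f y ≤ f z + ε * dist y z := by
  let S : X → Set X := fun y => {z | f z + ε * dist y z ≤ f y}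
  have hcl : ∀ y, IsClosed (S y) := by
    intro y
    have h : LowerSemicontinuous fun z => f z + ε * dist y z :=
      hf.add (Continuous.lowerSemicontinuous (by fun_prop))
    exact h.isClosed_preimage (f y)
  have hself : ∀ y, y ∈ S y := fun y => by simp [S]
  have htrans : ∀ {a b c}, b ∈ S a → c ∈ S b → c ∈ S a := by
    intro a b c h1 h2
    simp only [S, mem_ofPred_eq] at *
    nlinarith [dist_triangle a b c]
  -- The sequence moves at stage `n` to a point of `S x` that minimizes `f` there up to `1 / (n +
  -- 1)`. The limit then cannot be improved inside its own set `S`.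
  have hstep : ∀ (n : ℕ) (x : X), ∃ y ∈ S x, ∀ z ∈ S x, f y ≤ f z + 1 / (n + 1 : ℝ) := by
    intro n x
    have hne : (f '' S x).Nonempty := ⟨_, mem_image_of_mem f (hself x)⟩
    have hbd : BddBelow (f '' S x) := ⟨0, by rintro _ ⟨z, -, rfl⟩; exact hb z⟩
    have hpos : (0 : ℝ) < 1 / (n + 1 : ℝ) := by positivity
    obtain ⟨_, ⟨y, hy, rfl⟩, hlt⟩ := Real.lt_sInf_add_pos hne hpos
    exact ⟨y, hy, fun z hz => by linarith [csInf_le hbd (mem_image_of_mem f hz)]⟩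
  choose g hg1 hg2 using hstep
  let u : ℕ → X := fun n => Nat.rec x₀ (fun k x => g k x) n
  have husucc : ∀ n, u (n + 1) = g n (u n) := fun n => rfl
  have hmem : ∀ n m, n ≤ m → u m ∈ S (u n) := by
    intro n m hnm
    induction m, hnm using Nat.le_induction with
    | base => exact hself _
    | succ m _ ih => exact htrans ih (by rw [husucc]; exact hg1 m _)
  have hanti : Antitone fun n => f (u n) := by
    intro n m hnm
    have := hmem n m hnm
    simp only [S, mem_ofPred_eq] at this
    nlinarith [dist_nonneg (x := u n) (y := u m)]
  have hlim := tendsto_atTop_ciInf hanti ⟨0, by rintro _ ⟨n, rfl⟩; exact hb _⟩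
  have hcau : CauchySeq u := by
    rw [Metric.cauchySeq_iff']
    intro δ hδ
    obtain ⟨N, hN⟩ := Metric.cauchySeq_iff'.1 hlim.cauchySeq (ε * δ) (by positivity)
    refine ⟨N, fun n hn => ?_⟩
    have h1 := hmem N n hn
    have h2 := hN n hn
    simp only [S, mem_ofPred_eq] at h1
    rw [Real.dist_eq, abs_lt] at h2
    rw [dist_comm]
    exact lt_of_mul_lt_mul_left (by linarith : ε * dist (u N) (u n) < ε * δ) hε.le
  obtain ⟨y, hy⟩ := cauchySeq_tendsto_of_complete hcau
  have hyS : ∀ n, y ∈ S (u n) := fun n =>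
    (hcl (u n)).mem_of_tendsto hy (eventually_atTop.2 ⟨n, fun m hm => hmem n m hm⟩)
  refine ⟨y, hyS 0, fun z => ?_⟩
  by_contra! hlt
  have hz : z ∈ S y := hlt.le
  -- By transitivity `z` lies in every `S (u n)`, so the near-minimality of `u (n + 1)` applies to
  -- it.
  have key : ∀ n : ℕ, f y ≤ f z + 1 / (n + 1 : ℝ) := by
    intro n
    have h1 := hg2 n (u n) z (htrans (hyS n) hz)
    have h2 := hyS (n + 1)
    rw [← husucc] at h1
    simp only [S, mem_ofPred_eq] at h2
    nlinarith [dist_nonneg (x := u (n + 1)) (y := y)]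
  have hle : f y ≤ f z :=
    ge_of_tendsto' (by simpa using tendsto_one_div_add_atTop_nhds_zero_nat.const_add (f z)) key
  nlinarith [dist_nonneg (x := y) (y := z)]

namespace FreeCircle

/-! ### Lower semicontinuity of the energy and existence of a minimizer -/

/-- Extended arithmetic absorbs the case distinction on the diagonal, so the kernel becomes a
composition of continuous maps into `[0, ∞]`. -/
theorem logKernel_eq (z w : Circle) :
    logKernel z w = (ENNReal.log (2 * (‖(z : ℂ) - (w : ℂ)‖ₑ)⁻¹)).toENNReal := by
  unfold logKernel
  split_ifs with h
  · simp [h]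
  · have hne : 0 < ‖(z : ℂ) - (w : ℂ)‖ := by
      rw [norm_pos_iff, sub_ne_zero]
      exact fun h' => h (Circle.ext h')
    have : (2 * (‖(z : ℂ) - (w : ℂ)‖ₑ)⁻¹) = ENNReal.ofReal (2 / ‖(z : ℂ) - (w : ℂ)‖) := by
      rw [ENNReal.ofReal_div_of_pos hne, ofReal_norm, div_eq_mul_inv]
      simp
    rw [this, ENNReal.log_ofReal_of_pos (by positivity), EReal.toENNReal_of_ne_top (by simp)]
    simp

theorem continuous_logKernel : Continuous fun p : Circle × Circle => logKernel p.1 p.2 := by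
  simp_rw [logKernel_eq]
  refine EReal.continuous_toENNReal.comp (ENNReal.continuous_log.comp ?_)
  refine (ENNReal.continuous_const_mul (by simp)).comp (continuous_inv.comp ?_)
  fun_prop

theorem measurable_logKernel : Measurable fun p : Circle × Circle => logKernel p.1 p.2 :=
  continuous_logKernel.measurable

theorem norm_sub_le_two (z w : Circle) : ‖(z : ℂ) - (w : ℂ)‖ ≤ 2 := by
  calc ‖(z : ℂ) - (w : ℂ)‖ ≤ ‖(z : ℂ)‖ + ‖(w : ℂ)‖ := norm_sub_le _ _
    _ = 2 := by rw [Circle.norm_coe, Circle.norm_coe]; norm_num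

theorem logKernel_comm (z w : Circle) : logKernel z w = logKernel w z := by
  rw [logKernel_eq, logKernel_eq, enorm_sub_rev]

/-- The logarithmic energy `∬ log (2 / |z - w|) μ(dz) μ(dw)`. -/
noncomputable def logEnergy (μ : Measure Circle) : ℝ≥0∞ :=
  ∫⁻ p, logKernel p.1 p.2 ∂(μ.prod μ)

theorem energy_eq (Q : Circle → ℝ) (μ : Measure Circle) [SFinite μ] :
    energy Q μ = ((∫ z, Q z ∂μ - Real.log 2 : ℝ) : EReal) + (logEnergy μ : EReal) := by
  rw [energy, logEnergy, lintegral_prod _ measurable_logKernel.aemeasurable]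

/-- The truncations `min (K x) n` are bounded and continuous, so their integrals are weakly
continuous. By monotone convergence the integral of `K` is their supremum. -/
theorem lowerSemicontinuous_lintegral_of_continuous {X : Type*} [TopologicalSpace X]
    [MeasurableSpace X] [OpensMeasurableSpace X] {K : X → ℝ≥0∞} (hK : Continuous K) :
    LowerSemicontinuous fun μ : ProbabilityMeasure X => ∫⁻ x, K x ∂(μ : Measure X) := by
  have hK' : ∀ n : ℕ, Continuous fun x => (min (K x) n).toNNReal := by
    intro n
    refine continuous_iff_continuousAt.2 fun x => ?_
    have : min (K x) n ≠ ⊤ := ne_top_of_le_ne_top (by simp) (min_le_right _ _)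
    exact (ENNReal.tendsto_toNNReal this).comp (hK.min continuous_const).continuousAt
  let g : ℕ → BoundedContinuousFunction X NNReal := fun n =>
    BoundedContinuousFunction.mkOfBound ⟨_, hK' n⟩ (n + n) (by
      intro x y
      have hb : ∀ x, ((min (K x) n).toNNReal : ℝ) ≤ n := by
        intro x
        have : (min (K x) n).toNNReal ≤ (n : NNReal) := by
          rw [← ENNReal.toNNReal_natCast n]
          exact ENNReal.toNNReal_mono (by simp) (min_le_right _ _)
        exact_mod_cast this
      rw [NNReal.dist_eq]
      have h1 := hb x
      have h2 := hb y
      have h3 := (min (K x) n).toNNReal.coe_nonneg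
      have h4 := (min (K y) n).toNNReal.coe_nonneg
      simp only [ContinuousMap.coe_mk]
      rw [abs_le]
      constructor <;> linarith)
  have hg : ∀ n x, (g n x : ℝ≥0∞) = min (K x) n := by
    intro n x
    exact ENNReal.coe_toNNReal (ne_top_of_le_ne_top (by simp) (min_le_right _ _))
  have hsup : ∀ μ : ProbabilityMeasure X, ∫⁻ x, K x ∂(μ : Measure X) =
      ⨆ n, ∫⁻ x, (g n x : ℝ≥0∞) ∂(μ : Measure X) := by
    intro μ
    rw [← lintegral_iSup]
    · refine lintegral_congr fun x => ?_
      simp_rw [hg]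
      rw [← inf_iSup_eq, ENNReal.iSup_natCast, inf_top_eq]
    · intro n
      exact (g n).continuous.measurable.coe_nnreal_ennreal
    · intro n m hnm x
      simp only [hg]
      exact min_le_min le_rfl (by exact_mod_cast hnm)
  simp_rw [hsup]
  refine lowerSemicontinuous_iSup fun n => Continuous.lowerSemicontinuous ?_
  rw [continuous_iff_continuousAt]
  intro μ
  exact (ProbabilityMeasure.tendsto_iff_forall_lintegral_tendsto.1 tendsto_id) (g n)

theorem lowerSemicontinuous_logEnergy :
    LowerSemicontinuous fun μ : ProbabilityMeasure Circle => logEnergy (μ : Measure Circle) := by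
  have h := lowerSemicontinuous_lintegral_of_continuous continuous_logKernel
  have hc : Continuous fun μ : ProbabilityMeasure Circle => μ.prod μ :=
    ProbabilityMeasure.continuous_prod.comp (by fun_prop : Continuous fun μ : ProbabilityMeasure Circle => (μ, μ))
  exact h.comp hc

theorem continuous_integral {f : Circle → ℝ} (hf : Continuous f) :
    Continuous fun μ : ProbabilityMeasure Circle => ∫ z, f z ∂(μ : Measure Circle) := by
  rw [continuous_iff_continuousAt]
  intro μ
  exact (ProbabilityMeasure.tendsto_iff_forall_integral_tendsto.1 tendsto_id)
    (BoundedContinuousFunction.mkOfCompact ⟨f, hf⟩)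

theorem lowerSemicontinuous_energy {Q : Circle → ℝ} (hQ : Continuous Q) :
    LowerSemicontinuous fun μ : ProbabilityMeasure Circle => energy Q (μ : Measure Circle) := by
  simp_rw [energy_eq]
  refine LowerSemicontinuous.add' (Continuous.lowerSemicontinuous ?_) ?_ ?_
  · exact continuous_coe_real_ereal.comp ((continuous_integral hQ).sub continuous_const)
  · exact continuous_coe_ennreal_ereal.comp_lowerSemicontinuous lowerSemicontinuous_logEnergy
      (fun a b h => by exact_mod_cast h)
  · intro μ
    exact EReal.continuousAt_add (Or.inl (EReal.coe_ne_top _)) (Or.inl (EReal.coe_ne_bot _))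

theorem exists_isEnergyMinimizer {Q : Circle → ℝ} (hQ : Continuous Q) :
    ∃ μ, IsEnergyMinimizer Q μ := by
  have : Nonempty (ProbabilityMeasure Circle) := ⟨⟨Measure.dirac 1, inferInstance⟩⟩
  obtain ⟨μ, -, hμ⟩ := (lowerSemicontinuous_energy hQ).lowerSemicontinuousOn univ
    |>.exists_isMinOn univ_nonempty isCompact_univ
  exact ⟨μ, inferInstance, fun ν hν => hμ (mem_univ (⟨ν, hν⟩ : ProbabilityMeasure Circle))⟩

theorem isEnergyMinimizer_equilibriumMeasure {Q : Circle → ℝ} (hQ : Continuous Q) :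
    IsEnergyMinimizer Q (equilibriumMeasure Q) :=
  Classical.epsilon_spec (exists_isEnergyMinimizer hQ)

/-! ### Haar measure on the circle -/

theorem haar_eq_map : haar = Measure.map Circle.exp
    (ENNReal.ofReal (1 / (2 * Real.pi)) • volume.restrict (Ico (-Real.pi) Real.pi)) := rfl

theorem measurable_circleExp : Measurable (Circle.exp : ℝ → Circle) :=
  Circle.exp.continuous.measurable

instance isProbabilityMeasure_haar : IsProbabilityMeasure haar := by
  refine ⟨?_⟩
  rw [haar_eq_map, Measure.map_apply measurable_circleExp MeasurableSet.univ]
  simp only [preimage_univ, Measure.smul_apply, Measure.restrict_apply MeasurableSet.univ,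
    univ_inter, Real.volume_Ico, smul_eq_mul]
  rw [← ENNReal.ofReal_mul (by positivity)]
  rw [show 1 / (2 * Real.pi) * (Real.pi - -Real.pi) = 1 by field_simp; norm_num]
  simp

theorem integral_haar {E : Type*} [NormedAddCommGroup E] [NormedSpace ℝ E] {f : Circle → E}
    (hf : StronglyMeasurable f) :
    ∫ z, f z ∂haar = (1 / (2 * Real.pi)) • ∫ x in (-Real.pi)..Real.pi, f (Circle.exp x) := by
  rw [haar_eq_map, integral_map measurable_circleExp.aemeasurable hf.aestronglyMeasurable,
    integral_smul_measure, ENNReal.toReal_ofReal (by positivity),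
    intervalIntegral.integral_of_le (by linarith [Real.pi_pos]), integral_Ico_eq_integral_Ioc]

theorem integral_haar_mul_left {f : Circle → ℝ} (hf : Measurable f) (a : Circle) :
    ∫ z, f (a * z) ∂haar = ∫ z, f z ∂haar := by
  rw [integral_haar hf.stronglyMeasurable,
    integral_haar (f := fun z => f (a * z)) (hf.comp (measurable_const_mul a)).stronglyMeasurable]
  congr 1
  obtain ⟨t, rfl⟩ := Circle.exp_surjective a
  have hper : Function.Periodic (fun x : ℝ => f (Circle.exp x)) (2 * Real.pi) := fun x => by
    simp only [Circle.periodic_exp x]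
  simp_rw [← Circle.exp_add]
  rw [intervalIntegral.integral_comp_add_left (fun x => f (Circle.exp x))]
  have := hper.intervalIntegral_add_eq (t + -Real.pi) (-Real.pi)
  convert this using 2 <;> ring

theorem integral_haar_inv {f : Circle → ℝ} (hf : Measurable f) :
    ∫ z, f z⁻¹ ∂haar = ∫ z, f z ∂haar := by
  rw [integral_haar hf.stronglyMeasurable,
    integral_haar (f := fun z => f z⁻¹) (hf.comp measurable_inv).stronglyMeasurable]
  congr 1
  simp_rw [← Circle.exp_neg]
  rw [intervalIntegral.integral_comp_neg (fun x => f (Circle.exp x))]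
  simp

theorem integral_haar_of_differentiableAt {f : ℂ → ℂ}
    (hf : ∀ z ∈ Metric.closedBall (0 : ℂ) 1, DifferentiableAt ℂ f z) :
    ∫ z : Circle, f z ∂haar = f 0 := by
  have hc : ContinuousOn f (Metric.closedBall 0 1) :=
    fun z hz => (hf z hz).continuousAt.continuousWithinAt
  have h := circleAverage_of_differentiable_on_off_countable (f := f) (c := 0) (R := 1)
    countable_empty (by simpa using hc)
    (fun z hz => hf z (Metric.ball_subset_closedBall (by simpa using hz.1)))
  rw [← h, Real.circleAverage_def]
  have hcont : Continuous fun z : Circle => f z :=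
    hc.comp_continuous (by fun_prop)
      (fun z => by rw [mem_closedBall_zero_iff, Circle.norm_coe])
  rw [integral_haar hcont.stronglyMeasurable, one_div]
  congr 1
  have hper : Function.Periodic (fun x : ℝ => f (Circle.exp x)) (2 * Real.pi) := fun x => by
    simp only [Circle.periodic_exp x]
  have := hper.intervalIntegral_add_eq (-Real.pi) 0
  simp only [Circle.coe_exp] at this ⊢
  simp only [circleMap, zero_add, Complex.ofReal_one, one_mul] at this ⊢
  rw [← this]
  congr 1; ring

/-! ### Fourier expansion and positivity of the logarithmic energy -/

/-- The `n`-th moment of a measure on the circle. -/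
noncomputable def moment (μ : Measure Circle) (n : ℕ) : ℂ := ∫ z, (z : ℂ) ^ n ∂μ

/-- The kernel `log (2 / |z - r w|)`. -/
noncomputable def regKernel (r : ℝ) (z w : Circle) : ℝ :=
  Real.log (2 / ‖(z : ℂ) - r * (w : ℂ)‖)

theorem norm_sub_mul_pos {r : ℝ} (h0 : 0 ≤ r) (z w : Circle) :
    1 - r ≤ ‖(z : ℂ) - r * (w : ℂ)‖ := by
  have := norm_sub_norm_le (z : ℂ) (r * (w : ℂ))
  rw [norm_mul, Circle.norm_coe, Circle.norm_coe, Complex.norm_real, Real.norm_of_nonneg h0] at this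
  linarith

theorem norm_sub_mul_le_two {r : ℝ} (h0 : 0 ≤ r) (h1 : r < 1) (z w : Circle) :
    ‖(z : ℂ) - r * (w : ℂ)‖ ≤ 2 := by
  have := norm_sub_le (z : ℂ) (r * (w : ℂ))
  rw [norm_mul, Circle.norm_coe, Circle.norm_coe, Complex.norm_real, Real.norm_of_nonneg h0] at this
  linarith

theorem norm_sub_le_two_mul {r : ℝ} (h0 : 0 ≤ r) (h1 : r < 1) (z w : Circle) :
    ‖(z : ℂ) - (w : ℂ)‖ ≤ 2 * ‖(z : ℂ) - r * (w : ℂ)‖ := by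
  have h2 := norm_sub_mul_pos h0 z w
  have h3 : (z : ℂ) - w = ((z : ℂ) - r * w) - ((1 - r : ℝ) : ℂ) * w := by push_cast; ring
  have h4 := norm_sub_le ((z : ℂ) - r * w) (((1 - r : ℝ) : ℂ) * w)
  rw [← h3, norm_mul, Circle.norm_coe, Complex.norm_real,
    Real.norm_of_nonneg (by linarith : (0 : ℝ) ≤ 1 - r)] at h4
  linarith

theorem continuous_regKernel {r : ℝ} (h0 : 0 ≤ r) (h1 : r < 1) :
    Continuous fun p : Circle × Circle => regKernel r p.1 p.2 := by
  have hp : ∀ p : Circle × Circle, 0 < ‖(p.1 : ℂ) - r * (p.2 : ℂ)‖ := fun p => by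
    have := norm_sub_mul_pos h0 p.1 p.2
    linarith
  unfold regKernel
  refine Continuous.log (Continuous.div continuous_const (by fun_prop) fun p => (hp p).ne') ?_
  intro p
  have := hp p
  positivity

theorem regKernel_nonneg {r : ℝ} (h0 : 0 ≤ r) (h1 : r < 1) (z w : Circle) :
    0 ≤ regKernel r z w := by
  have := norm_sub_mul_pos h0 z w
  refine Real.log_nonneg ?_
  rw [le_div_iff₀ (by linarith)]
  simpa using norm_sub_mul_le_two h0 h1 z w

/-- The chord `|z - w|` is at most `2 |z - r w|`, whence a majorant independent of `r`. It permits
dominated convergence as `r → 1` when the energy is finite. -/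
theorem ofReal_regKernel_le {r : ℝ} (h0 : 0 ≤ r) (h1 : r < 1) (z w : Circle) :
    ENNReal.ofReal (regKernel r z w) ≤ logKernel z w + ENNReal.ofReal (Real.log 2) := by
  unfold logKernel
  split_ifs with h
  · simp
  · have hne : 0 < ‖(z : ℂ) - (w : ℂ)‖ := by
      rw [norm_pos_iff, sub_ne_zero]
      exact fun h' => h (Circle.ext h')
    have h2 := norm_sub_mul_pos h0 z w
    have h3 : 1 ≤ 2 / ‖(z : ℂ) - (w : ℂ)‖ := by
      rw [le_div_iff₀ hne]; simpa using norm_sub_le_two z w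
    rw [← ENNReal.ofReal_add (Real.log_nonneg h3) (Real.log_nonneg (by norm_num)),
      ← Real.log_mul (by positivity) (by norm_num)]
    refine ENNReal.ofReal_le_ofReal (Real.log_le_log (div_pos two_pos (by linarith)) ?_)
    rw [div_mul_eq_mul_div, div_le_div_iff₀ (by linarith) hne]
    nlinarith [norm_sub_le_two_mul h0 h1 z w]

theorem tendsto_regKernel (z w : Circle) :
    Tendsto (fun r => ENNReal.ofReal (regKernel r z w)) (𝓝[<] 1) (𝓝 (logKernel z w)) := by
  have hcont : Continuous fun r : ℝ =>
      (ENNReal.log (2 * (‖(z : ℂ) - r * (w : ℂ)‖ₑ)⁻¹)).toENNReal := by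
    refine EReal.continuous_toENNReal.comp (ENNReal.continuous_log.comp ?_)
    refine (ENNReal.continuous_const_mul (by simp)).comp (continuous_inv.comp ?_)
    fun_prop
  have h := (hcont.tendsto 1).mono_left (nhdsWithin_le_nhds (s := Iio 1))
  simp only [Complex.ofReal_one, one_mul] at h
  rw [← logKernel_eq] at h
  refine h.congr' ?_
  have h01 : ∀ᶠ r : ℝ in 𝓝[<] 1, r ∈ Ioo 0 1 := Ioo_mem_nhdsLT (by norm_num)
  filter_upwards [h01] with r hr
  have hne : 0 < ‖(z : ℂ) - r * (w : ℂ)‖ := by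
    have := norm_sub_mul_pos hr.1.le z w
    linarith [hr.2]
  have : (2 * (‖(z : ℂ) - r * (w : ℂ)‖ₑ)⁻¹) = ENNReal.ofReal (2 / ‖(z : ℂ) - r * (w : ℂ)‖) := by
    rw [ENNReal.ofReal_div_of_pos hne, ofReal_norm, div_eq_mul_inv]
    simp
  rw [this, ENNReal.log_ofReal_of_pos (by positivity), EReal.toENNReal_of_ne_top (by simp)]
  simp [regKernel]

/-- Since `|z - r w| = |1 - r w z̄|`, this is the real part of the Taylor series of `-log (1 - ζ)`
at `ζ = r w z̄`. -/
theorem hasSum_regKernel {r : ℝ} (h0 : 0 ≤ r) (h1 : r < 1) (z w : Circle) :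
    HasSum (fun n : ℕ => r ^ (n + 1) / (n + 1) *
      (((w : ℂ) ^ (n + 1) * (starRingEnd ℂ) ((z : ℂ) ^ (n + 1))).re))
      (regKernel r z w - Real.log 2) := by
  have hz : (z : ℂ) * (starRingEnd ℂ) (z : ℂ) = 1 := by
    rw [Complex.mul_conj, Complex.normSq_eq_norm_sq, Circle.norm_coe]; simp
  have hn : ‖(r : ℂ) * w * (starRingEnd ℂ) (z : ℂ)‖ < 1 := by
    rw [norm_mul, norm_mul, RCLike.norm_conj, Circle.norm_coe, Circle.norm_coe, Complex.norm_real,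
      Real.norm_of_nonneg h0]
    linarith
  have h := Complex.hasSum_re (Complex.hasSum_taylorSeries_neg_log' hn)
  rw [Complex.neg_re, Complex.log_re] at h
  have hk : ‖1 - (r : ℂ) * w * (starRingEnd ℂ) (z : ℂ)‖ = ‖(z : ℂ) - r * w‖ := by
    have : (z : ℂ) - r * w = z * (1 - (r : ℂ) * w * (starRingEnd ℂ) (z : ℂ)) := by
      linear_combination (r : ℂ) * w * hz
    rw [this, norm_mul, Circle.norm_coe, one_mul]
  have hpos := norm_sub_mul_pos h0 z w
  have hv : regKernel r z w - Real.log 2 = -Real.log ‖1 - (r : ℂ) * w * (starRingEnd ℂ) (z : ℂ)‖ := by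
    rw [hk, regKernel, Real.log_div (by norm_num) (by linarith)]
    ring
  rw [hv]
  convert h using 2 with n
  have : ((r : ℂ) * w * (starRingEnd ℂ) (z : ℂ)) ^ (n + 1) / (n + 1) =
      ((r ^ (n + 1) / (n + 1) : ℝ) : ℂ) *
        ((w : ℂ) ^ (n + 1) * (starRingEnd ℂ) ((z : ℂ) ^ (n + 1))) := by
    push_cast
    rw [map_pow]
    ring
  rw [this, Complex.re_ofReal_mul]

theorem integrable_circle_of_continuous {E : Type*} [NormedAddCommGroup E] {X : Type*}
    [TopologicalSpace X] [CompactSpace X] [MeasurableSpace X] [OpensMeasurableSpace X]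
    [TopologicalSpace.PseudoMetrizableSpace X] [SecondCountableTopology E]
    {f : X → E} (hf : Continuous f) (μ : Measure X) [IsFiniteMeasure μ] :
    Integrable f μ := by
  borelize E
  obtain ⟨C, hC⟩ := isCompact_univ.exists_bound_of_continuousOn hf.continuousOn
  exact Integrable.of_bound hf.stronglyMeasurable.aestronglyMeasurable C
    (Eventually.of_forall fun x => hC x (mem_univ x))

/-- Each term of the kernel expansion is a product in the two variables, so the regularized energy
is diagonal in the moments. The weights `r ^ (n + 1) / (n + 1)` are nonnegative, which is the source
of positive definiteness. -/
theorem hasSum_integral_regKernel {r : ℝ} (h0 : 0 ≤ r) (h1 : r < 1) (μ ν : Measure Circle)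
    [IsProbabilityMeasure μ] [IsProbabilityMeasure ν] :
    HasSum (fun n : ℕ => r ^ (n + 1) / (n + 1) *
      ((moment ν (n + 1) * (starRingEnd ℂ) (moment μ (n + 1))).re))
      (∫ p, regKernel r p.1 p.2 ∂(μ.prod ν) - Real.log 2) := by
  have hfc : ∀ n : ℕ, Continuous fun p : Circle × Circle =>
      (p.2 : ℂ) ^ (n + 1) * (starRingEnd ℂ) ((p.1 : ℂ) ^ (n + 1)) := fun n => by fun_prop
  have hfr : ∀ n : ℕ, Continuous fun p : Circle × Circle => r ^ (n + 1) / (n + 1) *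
      ((p.2 : ℂ) ^ (n + 1) * (starRingEnd ℂ) ((p.1 : ℂ) ^ (n + 1))).re := fun n =>
    continuous_const.mul (Complex.continuous_re.comp (hfc n))
  have hsum : Summable fun n : ℕ => r ^ (n + 1) :=
    (summable_geometric_of_lt_one h0 h1).comp_injective (add_left_injective 1)
  have h := hasSum_integral_of_dominated_convergence (μ := μ.prod ν)
    (F := fun (n : ℕ) (p : Circle × Circle) => r ^ (n + 1) / (n + 1) *
      (((p.2 : ℂ) ^ (n + 1) * (starRingEnd ℂ) ((p.1 : ℂ) ^ (n + 1))).re))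
    (f := fun p => regKernel r p.1 p.2 - Real.log 2)
    (fun n _ => r ^ (n + 1)) (fun n => (hfr n).stronglyMeasurable.aestronglyMeasurable)
    (fun n => Eventually.of_forall fun p => by
      have hb : |((p.2 : ℂ) ^ (n + 1) * (starRingEnd ℂ) ((p.1 : ℂ) ^ (n + 1))).re| ≤ 1 := by
        refine (Complex.abs_re_le_norm _).trans ?_
        rw [norm_mul, RCLike.norm_conj, norm_pow, norm_pow, Circle.norm_coe, Circle.norm_coe]
        simp
      rw [Real.norm_eq_abs, abs_mul, abs_of_nonneg (by positivity)]
      have h2 : r ^ (n + 1) / ((n : ℝ) + 1) ≤ r ^ (n + 1) :=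
        div_le_self (by positivity) (by linarith [n.cast_nonneg (α := ℝ)])
      calc _ ≤ r ^ (n + 1) / ((n : ℝ) + 1) * 1 := by gcongr
        _ ≤ _ := by linarith)
    (Eventually.of_forall fun _ => hsum) (integrable_const _)
    (Eventually.of_forall fun p => hasSum_regKernel h0 h1 p.1 p.2)
  rw [integral_sub (integrable_circle_of_continuous (continuous_regKernel h0 h1) _)
    (integrable_const _), integral_const] at h
  simp only [probReal_univ, smul_eq_mul, one_mul] at h
  refine (congrArg (fun F => HasSum F _) (funext fun n => ?_)).mp h
  rw [integral_const_mul]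
  congr 1
  have h2 : ∫ p : Circle × Circle, ((p.2 : ℂ) ^ (n + 1) * (starRingEnd ℂ) ((p.1 : ℂ) ^ (n + 1)))
      ∂(μ.prod ν) = moment ν (n + 1) * (starRingEnd ℂ) (moment μ (n + 1)) := by
    rw [mul_comm, moment, moment, ← integral_conj, ← integral_prod_mul]
    exact integral_congr_ae (Eventually.of_forall fun p => mul_comm _ _)
  rw [← h2]
  exact (integral_re (integrable_circle_of_continuous (hfc n) (μ.prod ν)))

theorem moment_haar (n : ℕ) : moment haar (n + 1) = 0 := by
  have := integral_haar_of_differentiableAt (f := fun z => z ^ (n + 1)) (fun z _ => by fun_prop)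
  rw [moment, this]; simp

theorem lintegral_regKernel {r : ℝ} (h0 : 0 ≤ r) (h1 : r < 1) (μ ν : Measure Circle)
    [IsProbabilityMeasure μ] [IsProbabilityMeasure ν] :
    ∫⁻ p, ENNReal.ofReal (regKernel r p.1 p.2) ∂(μ.prod ν) =
      ENNReal.ofReal (∫ p, regKernel r p.1 p.2 ∂(μ.prod ν)) :=
  (ofReal_integral_eq_lintegral_ofReal
    (integrable_circle_of_continuous (continuous_regKernel h0 h1) _)
    (Eventually.of_forall fun p => regKernel_nonneg h0 h1 p.1 p.2)).symm

/-- A sequence in `(0, 1)` that tends to `1`. -/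
noncomputable def radius (k : ℕ) : ℝ := 1 - 1 / ((k : ℝ) + 2)

theorem radius_pos (k : ℕ) : 0 < radius k := by
  have : (1 : ℝ) / (k + 2) < 1 := by
    rw [div_lt_one (by positivity)]; linarith [k.cast_nonneg (α := ℝ)]
  unfold radius; linarith

theorem radius_lt_one (k : ℕ) : radius k < 1 := by
  have : (0 : ℝ) < 1 / (k + 2) := by positivity
  unfold radius; linarith

theorem tendsto_radius : Tendsto radius atTop (𝓝[<] 1) := by
  refine tendsto_nhdsWithin_iff.2 ⟨?_, Eventually.of_forall radius_lt_one⟩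
  have h : Tendsto (fun k : ℕ => (1 : ℝ) / ((k : ℝ) + 2)) atTop (𝓝 0) := by
    simp_rw [one_div]
    exact (tendsto_atTop_add_const_right _ _ tendsto_natCast_atTop_atTop).inv_tendsto_atTop
  have h2 := h.const_sub 1
  rw [sub_zero] at h2
  exact h2

/-- The moments of Haar measure vanish, so every regularized energy equals `log 2`, and Fatou's
lemma passes to `r → 1`. This makes the minimal energy finite. -/
theorem logEnergy_haar : logEnergy haar < ⊤ := by
  have h : ∀ k, ∫⁻ p, ENNReal.ofReal (regKernel (radius k) p.1 p.2) ∂(haar.prod haar) =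
      ENNReal.ofReal (Real.log 2) := by
    intro k
    rw [lintegral_regKernel (radius_pos k).le (radius_lt_one k)]
    congr 1
    have h := hasSum_integral_regKernel (radius_pos k).le (radius_lt_one k) haar haar
    simp only [moment_haar, zero_mul, Complex.zero_re, mul_zero] at h
    linarith [h.unique hasSum_zero]
  refine lt_of_le_of_lt ?_ (ENNReal.ofReal_lt_top (r := Real.log 2))
  calc logEnergy haar
      = ∫⁻ p, liminf (fun k => ENNReal.ofReal (regKernel (radius k) p.1 p.2)) atTop
          ∂(haar.prod haar) := by
        refine lintegral_congr fun p => ?_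
        exact ((tendsto_regKernel p.1 p.2).comp tendsto_radius).liminf_eq.symm
    _ ≤ liminf (fun k => ∫⁻ p, ENNReal.ofReal (regKernel (radius k) p.1 p.2) ∂(haar.prod haar))
          atTop := lintegral_liminf_le fun k =>
            (continuous_regKernel (radius_pos k).le (radius_lt_one k)).measurable.ennreal_ofReal
    _ = ENNReal.ofReal (Real.log 2) := by simp [h]

/-- The star algebra generated by the coordinate function separates points and is spanned by integer
powers of `z`. Negative powers are conjugates of positive ones, so the positive moments suffice. -/
theorem ext_of_moment {μ ν : Measure Circle} [IsProbabilityMeasure μ] [IsProbabilityMeasure ν]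
    (h : ∀ n, moment μ (n + 1) = moment ν (n + 1)) : μ = ν := by
  let ι : BoundedContinuousFunction Circle ℂ :=
    BoundedContinuousFunction.mkOfCompact ⟨fun z => (z : ℂ), by fun_prop⟩
  let A : StarSubalgebra ℂ (BoundedContinuousFunction Circle ℂ) := StarAlgebra.adjoin ℂ {ι}
  refine ext_of_forall_mem_subalgebra_integral_eq_of_pseudoEMetric_complete_countable
    (𝕜 := ℂ) (A := A) ?_ ?_
  · intro z w hzw
    refine ⟨ι, ⟨ι.toContinuousMap, ⟨ι, StarAlgebra.subset_adjoin ℂ _ rfl, rfl⟩, rfl⟩, ?_⟩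
    exact fun h' => hzw (Circle.ext h')
  · have hmon : ∀ g ∈ Submonoid.closure (({ι} : Set (BoundedContinuousFunction Circle ℂ)) ∪
        star {ι}), ∃ n : ℤ, ∀ z : Circle, g z = (z : ℂ) ^ n := by
      intro g hg
      induction hg using Submonoid.closure_induction with
      | mem x hx =>
        rcases hx with hx | hx
        · rw [mem_singleton_iff] at hx
          subst hx
          exact ⟨1, fun z => (zpow_one _).symm⟩
        · rw [star_singleton, mem_singleton_iff] at hx
          subst hx
          refine ⟨-1, fun z => ?_⟩
          rw [zpow_neg_one, ← Circle.coe_inv, Circle.coe_inv_eq_conj]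
          rfl
      | one => exact ⟨0, fun z => by simp⟩
      | mul x y _ _ hx hy =>
        obtain ⟨n, hn⟩ := hx
        obtain ⟨m, hm⟩ := hy
        refine ⟨n + m, fun z => ?_⟩
        rw [zpow_add₀ (Circle.coe_ne_zero z), ← hn, ← hm]
        rfl
    have hint : ∀ n : ℤ, ∫ z : Circle, (z : ℂ) ^ n ∂μ = ∫ z : Circle, (z : ℂ) ^ n ∂ν := by
      have hnat : ∀ n : ℕ, ∫ z : Circle, (z : ℂ) ^ n ∂μ = ∫ z : Circle, (z : ℂ) ^ n ∂ν := by
        intro n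
        rcases n with _ | n
        · simp
        · exact h n
      intro n
      rcases n.eq_nat_or_neg with ⟨m, rfl | rfl⟩
      · simpa using hnat m
      · have hc : ∀ z : Circle, (z : ℂ) ^ (-(m : ℤ)) = (starRingEnd ℂ) ((z : ℂ) ^ m) := by
          intro z
          rw [zpow_neg, zpow_natCast, ← inv_pow, ← Circle.coe_inv, Circle.coe_inv_eq_conj, map_pow]
        simp_rw [hc]
        rw [integral_conj, integral_conj, hnat]
    intro g hg
    have hg' : g ∈ Submodule.span ℂ (Submonoid.closure
        (({ι} : Set (BoundedContinuousFunction Circle ℂ)) ∪ star {ι}) :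
          Set (BoundedContinuousFunction Circle ℂ)) := by
      rw [← StarAlgebra.adjoin_eq_span]
      exact hg
    clear hg
    induction hg' using Submodule.span_induction with
    | mem x hx =>
      obtain ⟨n, hn⟩ := hmon x hx
      simp_rw [hn]
      exact hint n
    | zero => simp
    | add x y _ _ hx hy =>
      have e : ∀ z, (x + y) z = x z + y z := fun z => rfl
      simp_rw [e]
      rw [integral_add (x.integrable μ) (y.integrable μ),
        integral_add (x.integrable ν) (y.integrable ν), hx, hy]
    | smul a x _ hx =>
      have e : ∀ z, (a • x) z = a • x z := fun z => rfl
      simp_rw [e]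
      rw [integral_smul, integral_smul, hx]

/-- The energy of `μ - ν` is the sum of `r ^ (j + 1) / (j + 1) * ‖moment μ (j + 1) - moment ν (j +
1)‖ ^ 2`, and a sum of nonnegative terms dominates any single one. -/
theorem two_mul_integral_regKernel_add_le {r : ℝ} (h0 : 0 ≤ r) (h1 : r < 1)
    (μ ν : Measure Circle) [IsProbabilityMeasure μ] [IsProbabilityMeasure ν] (n : ℕ) :
    2 * ∫ p, regKernel r p.1 p.2 ∂(μ.prod ν) +
      r ^ (n + 1) / (n + 1) * ‖moment μ (n + 1) - moment ν (n + 1)‖ ^ 2 ≤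
    ∫ p, regKernel r p.1 p.2 ∂(μ.prod μ) + ∫ p, regKernel r p.1 p.2 ∂(ν.prod ν) := by
  have h := (((hasSum_integral_regKernel h0 h1 μ μ).add (hasSum_integral_regKernel h0 h1 ν ν)).sub
    ((hasSum_integral_regKernel h0 h1 μ ν).mul_left 2))
  have e : ∀ a b : ℂ, (a * (starRingEnd ℂ) a).re + (b * (starRingEnd ℂ) b).re -
      2 * (b * (starRingEnd ℂ) a).re = ‖a - b‖ ^ 2 := by
    intro a b
    rw [← Complex.normSq_eq_norm_sq, Complex.normSq_apply]
    simp only [Complex.mul_re, Complex.conj_re, Complex.conj_im, Complex.sub_re, Complex.sub_im]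
    ring
  have e' : ∀ j : ℕ, r ^ (j + 1) / (j + 1) * (moment μ (j + 1) * (starRingEnd ℂ) (moment μ (j + 1))).re
      + r ^ (j + 1) / (j + 1) * (moment ν (j + 1) * (starRingEnd ℂ) (moment ν (j + 1))).re
      - 2 * (r ^ (j + 1) / (j + 1) * (moment ν (j + 1) * (starRingEnd ℂ) (moment μ (j + 1))).re)
      = r ^ (j + 1) / (j + 1) * ‖moment μ (j + 1) - moment ν (j + 1)‖ ^ 2 := by
    intro j
    rw [← e]
    ring
  have h2 := le_hasSum h n (fun j _ => by
    rw [e']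
    positivity)
  rw [e'] at h2
  linarith

theorem tendsto_lintegral_regKernel (μ : Measure Circle) [IsProbabilityMeasure μ]
    (hμ : logEnergy μ < ⊤) :
    Tendsto (fun k => ∫⁻ p, ENNReal.ofReal (regKernel (radius k) p.1 p.2) ∂(μ.prod μ)) atTop
      (𝓝 (logEnergy μ)) := by
  refine tendsto_lintegral_of_dominated_convergence
    (fun p => logKernel p.1 p.2 + ENNReal.ofReal (Real.log 2))
    (fun k => (continuous_regKernel (radius_pos k).le (radius_lt_one k)).measurable.ennreal_ofReal)
    (fun k => Eventually.of_forall fun p =>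
      ofReal_regKernel_le (radius_pos k).le (radius_lt_one k) p.1 p.2) ?_
    (Eventually.of_forall fun p => (tendsto_regKernel p.1 p.2).comp tendsto_radius)
  rw [lintegral_add_right _ measurable_const, lintegral_const]
  exact (ENNReal.add_lt_top.2 ⟨hμ, by simp⟩).ne

/-- Strict positive definiteness, obtained from the single-term inequality by letting `r → 1`: the
discrepancy of each moment is squeezed to zero. -/
theorem eq_of_logEnergy_add_le {μ ν : Measure Circle} [IsProbabilityMeasure μ]
    [IsProbabilityMeasure ν] (hμ : logEnergy μ < ⊤) (hν : logEnergy ν < ⊤)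
    (h : logEnergy μ + logEnergy ν ≤ 2 * ∫⁻ p, logKernel p.1 p.2 ∂(μ.prod ν)) : μ = ν := by
  refine ext_of_moment fun n => ?_
  let c : ℝ → ℝ := fun r => r ^ (n + 1) / (n + 1) * ‖moment μ (n + 1) - moment ν (n + 1)‖ ^ 2
  have hc : ∀ r, 0 ≤ r → 0 ≤ c r := fun r hr => by positivity
  have key : ∀ k, ∫⁻ p, (2 * ENNReal.ofReal (regKernel (radius k) p.1 p.2) +
      ENNReal.ofReal (c (radius k))) ∂(μ.prod ν) ≤
      ∫⁻ p, ENNReal.ofReal (regKernel (radius k) p.1 p.2) ∂(μ.prod μ) +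
      ∫⁻ p, ENNReal.ofReal (regKernel (radius k) p.1 p.2) ∂(ν.prod ν) := by
    intro k
    have h0 := (radius_pos k).le
    have h1 := radius_lt_one k
    have hnn : ∀ α β : Measure Circle, 0 ≤ ∫ p, regKernel (radius k) p.1 p.2 ∂(α.prod β) :=
      fun α β => integral_nonneg fun p => regKernel_nonneg h0 h1 p.1 p.2
    rw [lintegral_add_right _ measurable_const, lintegral_const_mul' _ _ (by simp),
      lintegral_const, lintegral_regKernel h0 h1, lintegral_regKernel h0 h1,
      lintegral_regKernel h0 h1, measure_univ, mul_one, ← ENNReal.ofReal_add (hnn _ _) (hnn _ _),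
      ← ENNReal.ofReal_ofNat, ← ENNReal.ofReal_mul (by norm_num),
      ← ENNReal.ofReal_add (mul_nonneg (by norm_num) (hnn _ _)) (hc _ h0)]
    exact ENNReal.ofReal_le_ofReal (two_mul_integral_regKernel_add_le h0 h1 μ ν n)
  have hctend : Tendsto (fun k => ENNReal.ofReal (c (radius k))) atTop (𝓝 (ENNReal.ofReal (c 1))) := by
    have hcc : Continuous fun r => ENNReal.ofReal (c r) :=
      ENNReal.continuous_ofReal.comp (by fun_prop)
    exact (hcc.tendsto 1).comp (tendsto_radius.mono_right nhdsWithin_le_nhds)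
  -- The mixed energy is not known to be finite, so it is treated with Fatou's lemma; dominated
  -- convergence is available only for the two pure energies. The outcome shows that the mixed
  -- energy is finite and may be cancelled.
  have main : ∫⁻ p, (2 * logKernel p.1 p.2 + ENNReal.ofReal (c 1)) ∂(μ.prod ν) ≤
      logEnergy μ + logEnergy ν := by
    calc _ = ∫⁻ p, liminf (fun k => 2 * ENNReal.ofReal (regKernel (radius k) p.1 p.2) +
              ENNReal.ofReal (c (radius k))) atTop ∂(μ.prod ν) := by
          refine lintegral_congr fun p => (Tendsto.liminf_eq ?_).symm
          exact (ENNReal.Tendsto.const_mul ((tendsto_regKernel p.1 p.2).comp tendsto_radius)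
            (Or.inr (by simp))).add hctend
      _ ≤ liminf (fun k => ∫⁻ p, (2 * ENNReal.ofReal (regKernel (radius k) p.1 p.2) +
              ENNReal.ofReal (c (radius k))) ∂(μ.prod ν)) atTop :=
          lintegral_liminf_le fun k => ((continuous_regKernel (radius_pos k).le
            (radius_lt_one k)).measurable.ennreal_ofReal.const_mul _).add_const _
      _ ≤ liminf (fun k => ∫⁻ p, ENNReal.ofReal (regKernel (radius k) p.1 p.2) ∂(μ.prod μ) +
            ∫⁻ p, ENNReal.ofReal (regKernel (radius k) p.1 p.2) ∂(ν.prod ν)) atTop :=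
          liminf_le_liminf (Eventually.of_forall key)
      _ = _ := ((tendsto_lintegral_regKernel μ hμ).add (tendsto_lintegral_regKernel ν hν)).liminf_eq
  rw [lintegral_add_right _ measurable_const, lintegral_const_mul' _ _ (by simp), lintegral_const,
    measure_univ, mul_one] at main
  have hfin : logEnergy μ + logEnergy ν < ⊤ := ENNReal.add_lt_top.2 ⟨hμ, hν⟩
  have h3 : 2 * ∫⁻ p, logKernel p.1 p.2 ∂(μ.prod ν) + ENNReal.ofReal (c 1) ≤
      2 * ∫⁻ p, logKernel p.1 p.2 ∂(μ.prod ν) + 0 := by simpa using main.trans h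
  have h4 := (ENNReal.add_le_add_iff_left
    (ne_top_of_le_ne_top hfin.ne (le_self_add.trans main))).1 h3
  have h5 : c 1 ≤ 0 := by simpa using h4
  have h6 : ‖moment μ (n + 1) - moment ν (n + 1)‖ ^ 2 ≤ 0 := by
    simp only [c, one_pow] at h5
    exact nonpos_of_mul_nonpos_right h5 (by positivity)
  rw [← sub_eq_zero, ← norm_eq_zero]
  exact pow_eq_zero_iff (two_ne_zero) |>.1 (le_antisymm h6 (by positivity))

/-! ### Measures of finite energy and uniqueness of the minimizer -/

theorem ae_ne_of_logEnergy_lt_top {μ : Measure Circle} (h : logEnergy μ < ⊤) :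
    ∀ᵐ p ∂(μ.prod μ), p.1 ≠ p.2 := by
  filter_upwards [ae_lt_top measurable_logKernel h.ne] with p hp heq
  simp [logKernel, heq] at hp

/-- The kernel is infinite on the diagonal, which is therefore null for `μ.prod μ`; an atom would
charge it with the square of its mass. -/
theorem measure_singleton_eq_zero {μ : Measure Circle} [SFinite μ] (h : logEnergy μ < ⊤)
    (z : Circle) : μ {z} = 0 := by
  have h1 := ae_ne_of_logEnergy_lt_top h
  have h2 : (μ.prod μ) ({z} ×ˢ {z}) = 0 := by
    refine measure_mono_null ?_ h1
    rintro ⟨a, b⟩ ⟨ha, hb⟩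
    exact not_not.2 (ha.trans hb.symm)
  rw [Measure.prod_prod] at h2
  exact mul_self_eq_zero.1 h2

/-- The real number `E_Q(μ)` when `μ` has finite logarithmic energy. -/
noncomputable def realEnergy (Q : Circle → ℝ) (μ : Measure Circle) : ℝ :=
  ∫ z, Q z ∂μ - Real.log 2 + (logEnergy μ).toReal

theorem energy_eq_realEnergy (Q : Circle → ℝ) {μ : Measure Circle} [SFinite μ]
    (h : logEnergy μ < ⊤) : energy Q μ = (realEnergy Q μ : EReal) := by
  rw [energy_eq, realEnergy, EReal.coe_add, EReal.coe_ennreal_toReal h.ne]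

theorem energy_eq_top (Q : Circle → ℝ) {μ : Measure Circle} [SFinite μ]
    (h : ¬ logEnergy μ < ⊤) : energy Q μ = ⊤ := by
  rw [energy_eq, not_lt_top_iff.1 h, EReal.coe_ennreal_top, EReal.coe_add_top]

theorem logEnergy_lt_top_of_energy {Q : Circle → ℝ} {μ : Measure Circle} [SFinite μ]
    (h : energy Q μ < ⊤) : logEnergy μ < ⊤ := by
  by_contra hn
  rw [energy_eq_top Q hn] at h
  exact lt_irrefl _ h

theorem IsEnergyMinimizer.logEnergy_lt_top {Q : Circle → ℝ} {μ : Measure Circle}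
    (h : IsEnergyMinimizer Q μ) : logEnergy μ < ⊤ := by
  have := h.1
  refine logEnergy_lt_top_of_energy (Q := Q) ((h.2 haar inferInstance).trans_lt ?_)
  rw [energy_eq_realEnergy Q logEnergy_haar]
  exact EReal.coe_lt_top _

theorem IsEnergyMinimizer.unique {Q : Circle → ℝ} (hQ : Continuous Q) {μ ν : Measure Circle}
    (hμ : IsEnergyMinimizer Q μ) (hν : IsEnergyMinimizer Q ν) : μ = ν := by
  have := hμ.1
  have := hν.1
  have lμ := hμ.logEnergy_lt_top
  have lν := hν.logEnergy_lt_top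
  refine eq_of_logEnergy_add_le lμ lν ?_
  by_cases hm : ∫⁻ p, logKernel p.1 p.2 ∂(μ.prod ν) = ⊤
  · rw [hm]; simp
  -- Comparing both minimizers with their midpoint and adding, the `Q`-terms cancel. What remains is
  -- the reverse of the positivity inequality, so strict definiteness applies.
  let M : Measure Circle := (2⁻¹ : ℝ≥0∞) • (μ + ν)
  have hsymm : ∫⁻ p, logKernel p.1 p.2 ∂(ν.prod μ) = ∫⁻ p, logKernel p.1 p.2 ∂(μ.prod ν) := by
    rw [← Measure.prod_swap, lintegral_map measurable_logKernel measurable_swap]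
    exact lintegral_congr fun p => logKernel_comm _ _
  have hM : IsProbabilityMeasure M := ⟨by
    simp only [M, Measure.smul_apply, Measure.add_apply, measure_univ, smul_eq_mul]
    rw [one_add_one_eq_two]
    exact ENNReal.inv_mul_cancel (by simp) (by simp)⟩
  have hMQ : ∫ z, Q z ∂M = 2⁻¹ * (∫ z, Q z ∂μ + ∫ z, Q z ∂ν) := by
    rw [integral_smul_measure, integral_add_measure (integrable_circle_of_continuous hQ _)
      (integrable_circle_of_continuous hQ _)]
    simp
  have hML : logEnergy M = 2⁻¹ * (2⁻¹ * (logEnergy μ + logEnergy ν +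
      2 * ∫⁻ p, logKernel p.1 p.2 ∂(μ.prod ν))) := by
    simp only [logEnergy, M]
    rw [Measure.prod_smul_left, Measure.prod_smul_right, lintegral_smul_measure,
      lintegral_smul_measure, Measure.add_prod, Measure.prod_add, Measure.prod_add,
      lintegral_add_measure, lintegral_add_measure, lintegral_add_measure, hsymm]
    simp only [smul_eq_mul]
    congr 2
    ring
  have hMfin : logEnergy M < ⊤ := by
    rw [hML]
    have h1 : logEnergy μ + logEnergy ν + 2 * ∫⁻ p, logKernel p.1 p.2 ∂(μ.prod ν) < ⊤ :=
      ENNReal.add_lt_top.2 ⟨ENNReal.add_lt_top.2 ⟨lμ, lν⟩,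
        ENNReal.mul_lt_top (by simp) (lt_top_iff_ne_top.2 hm)⟩
    exact ENNReal.mul_lt_top (by simp) (ENNReal.mul_lt_top (by simp) h1)
  have h1 := hμ.2 M hM
  have h2 := hν.2 M hM
  rw [energy_eq_realEnergy Q lμ, energy_eq_realEnergy Q hMfin, EReal.coe_le_coe_iff, realEnergy,
    realEnergy, hMQ, hML] at h1
  rw [energy_eq_realEnergy Q lν, energy_eq_realEnergy Q hMfin, EReal.coe_le_coe_iff, realEnergy,
    realEnergy, hMQ, hML] at h2
  have h2m : 2 * ∫⁻ p, logKernel p.1 p.2 ∂(μ.prod ν) ≠ ⊤ := ENNReal.mul_ne_top (by simp) hm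
  rw [ENNReal.toReal_mul, ENNReal.toReal_mul, ENNReal.toReal_add (ENNReal.add_lt_top.2 ⟨lμ, lν⟩).ne
    h2m, ENNReal.toReal_add lμ.ne lν.ne] at h1 h2
  simp only [ENNReal.toReal_inv, ENNReal.toReal_ofNat] at h1 h2
  rw [← ENNReal.toReal_le_toReal (ENNReal.add_lt_top.2 ⟨lμ, lν⟩).ne h2m,
    ENNReal.toReal_add lμ.ne lν.ne]
  linarith

/-! ### Differentiable functions on the circle and the cotangent kernel -/

theorem isQuotientMap_circleExp : IsQuotientMap (Circle.exp : ℝ → Circle) :=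
  isLocalHomeomorph_circleExp.isOpenMap.isQuotientMap Circle.exp.continuous Circle.exp_surjective

theorem IsCn.continuous {n : WithTop ℕ∞} {φ : Circle → ℝ} (h : IsCn n φ) : Continuous φ :=
  isQuotientMap_circleExp.continuous_iff.2 (ContDiff.continuous h)

theorem circleDeriv_exp (Q : Circle → ℝ) (x : ℝ) :
    circleDeriv Q (Circle.exp x) = deriv (fun y : ℝ => Q (Circle.exp y)) x := by
  unfold circleDeriv
  simp_rw [← Circle.exp_add]
  rw [deriv_comp_const_add (fun y : ℝ => Q (Circle.exp y)) x 0, add_zero]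

theorem IsCn.continuous_circleDeriv {Q : Circle → ℝ} (h : IsCn 1 Q) :
    Continuous (circleDeriv Q) := by
  refine isQuotientMap_circleExp.continuous_iff.2 ?_
  have : circleDeriv Q ∘ Circle.exp = deriv (fun y : ℝ => Q (Circle.exp y)) :=
    funext fun x => circleDeriv_exp Q x
  rw [this]
  exact ContDiff.continuous_deriv h le_rfl

theorem IsCn.hasDerivAt_mul_exp {Q : Circle → ℝ} (h : IsCn 1 Q) (z : Circle) (c t : ℝ) :
    HasDerivAt (fun t : ℝ => Q (z * Circle.exp (t * c)))
      (circleDeriv Q (z * Circle.exp (t * c)) * c) t := by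
  obtain ⟨x, rfl⟩ := Circle.exp_surjective z
  simp_rw [← Circle.exp_add]
  rw [circleDeriv_exp]
  have hd : HasDerivAt (fun y : ℝ => Q (Circle.exp y))
      (deriv (fun y : ℝ => Q (Circle.exp y)) (x + t * c)) (x + t * c) :=
    ((ContDiff.differentiable h one_ne_zero) _).hasDerivAt
  have hl : HasDerivAt (fun t : ℝ => x + t * c) c t := by
    simpa using ((hasDerivAt_id t).mul_const c).const_add x
  exact hd.comp t hl

/-- The kernel `cot ((x - y) / 2)` at `z = e^{ix}`, `w = e^{iy}`. -/
noncomputable def cotKernel (z w : Circle) : ℝ := Real.cot (Complex.arg ((z / w : Circle) : ℂ) / 2)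

/-- This rational form removes the argument function from all later computations. It also holds on
the diagonal, where both sides take the default value `0`. -/
theorem cotKernel_coe (z w : Circle) :
    (cotKernel z w : ℂ) = Complex.I * (z + w) / (z - w) := by
  rw [cotKernel, Complex.ofReal_cot, Complex.cot_eq_exp_ratio]
  have he : Complex.exp (2 * Complex.I * ((Complex.arg ((z / w : Circle) : ℂ) / 2 : ℝ) : ℂ)) =
      (z : ℂ) / w := by
    rw [← Circle.coe_div]
    conv_rhs => rw [← Circle.exp_arg (z / w), Circle.coe_exp]
    congr 1
    push_cast
    ring
  rw [he]
  have hw := Circle.coe_ne_zero w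
  rcases eq_or_ne (z : ℂ) w with h | h
  · simp [h]
  · have h1 : (z : ℂ) - w ≠ 0 := sub_ne_zero.2 h
    have h2 : (w : ℂ) - z ≠ 0 := sub_ne_zero.2 h.symm
    have h3 : (1 : ℂ) - z / w ≠ 0 := by
      rw [sub_ne_zero, ne_comm, Ne, div_eq_one_iff_eq hw]
      exact h
    rw [div_eq_div_iff (mul_ne_zero Complex.I_ne_zero h3) h1]
    field_simp
    linear_combination -(z + w : ℂ) * (w - z) * Complex.I_sq

theorem cotKernel_swap (z w : Circle) : cotKernel w z = -cotKernel z w := by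
  have h : (cotKernel w z : ℂ) = ((-cotKernel z w : ℝ) : ℂ) := by
    push_cast
    rw [cotKernel_coe, cotKernel_coe, ← neg_sub (z : ℂ) w, div_neg, add_comm]
  exact_mod_cast h

theorem measurable_cotKernel : Measurable fun p : Circle × Circle => cotKernel p.1 p.2 := by
  have h : (fun p : Circle × Circle => cotKernel p.1 p.2) =
      fun p : Circle × Circle => (Complex.I * ((p.1 : ℂ) + p.2) / ((p.1 : ℂ) - p.2)).re := by
    funext p
    rw [← cotKernel_coe, Complex.ofReal_re]
  rw [h]
  have h1 : Measurable fun p : Circle × Circle => (p.1 : ℂ) :=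
    Continuous.measurable (by fun_prop)
  have h2 : Measurable fun p : Circle × Circle => (p.2 : ℂ) :=
    Continuous.measurable (by fun_prop)
  exact Complex.measurable_re.comp (((h1.add h2).const_mul _).div (h1.sub h2))

/-- Off the diagonal the product is `|z + w|`. Consequently the singularity of the cotangent is
cancelled by the increments of a Lipschitz function. -/
theorem abs_cotKernel_mul_le (z w : Circle) : |cotKernel z w| * ‖(z : ℂ) - w‖ ≤ 2 := by
  rw [← Real.norm_eq_abs, ← Complex.norm_real, cotKernel_coe, norm_div, norm_mul, Complex.norm_I,
    one_mul]
  have h1 : ‖(z : ℂ) + w‖ ≤ 2 := by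
    refine (norm_add_le _ _).trans ?_
    rw [Circle.norm_coe, Circle.norm_coe]; norm_num
  rcases eq_or_ne ‖(z : ℂ) - w‖ 0 with h | h
  · rw [h]; norm_num
  · rwa [div_mul_cancel₀ _ h]

/-- Chords have length `2 |sin ((x - y) / 2)|`, and this is the addition formula for the sine with
`sin ((x - y) / 2)` factored out. -/
theorem norm_mul_exp_sub_mul_exp (z w : Circle) (hzw : z ≠ w) (a b : ℝ) :
    ‖((z * Circle.exp a : Circle) : ℂ) - ((w * Circle.exp b : Circle) : ℂ)‖ =
      ‖(z : ℂ) - w‖ * |Real.cos ((a - b) / 2) + cotKernel z w * Real.sin ((a - b) / 2)| := by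
  have hne : (z : ℂ) - w ≠ 0 := sub_ne_zero.2 fun h => hzw (Circle.ext h)
  have e : ((z * Circle.exp a : Circle) : ℂ) - ((w * Circle.exp b : Circle) : ℂ) =
      Complex.exp (((a + b) / 2 : ℝ) * Complex.I) * (((z : ℂ) - w) *
        ((Real.cos ((a - b) / 2) + cotKernel z w * Real.sin ((a - b) / 2) : ℝ) : ℂ)) := by
    have ha : Complex.exp (a * Complex.I) = Complex.exp (((a + b) / 2 : ℝ) * Complex.I) *
        Complex.exp (((a - b) / 2 : ℝ) * Complex.I) := by
      rw [← Complex.exp_add]; congr 1; push_cast; ring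
    have hb : Complex.exp (b * Complex.I) = Complex.exp (((a + b) / 2 : ℝ) * Complex.I) *
        Complex.exp (-((a - b) / 2 : ℝ) * Complex.I) := by
      rw [← Complex.exp_add]; congr 1; push_cast; ring
    rw [Circle.coe_mul, Circle.coe_mul, Circle.coe_exp, Circle.coe_exp, ha, hb]
    have hc : ((z : ℂ) - w) * cotKernel z w = Complex.I * (z + w) := by
      rw [cotKernel_coe]; field_simp
    have h1 := Complex.exp_mul_I (((a - b) / 2 : ℝ) : ℂ)
    have h2 := Complex.exp_mul_I (-(((a - b) / 2 : ℝ) : ℂ))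
    rw [Complex.cos_neg, Complex.sin_neg] at h2
    rw [h1, h2]
    push_cast at hc ⊢
    linear_combination (-Complex.exp ((a + b) / 2 * Complex.I) * Complex.sin ((a - b) / 2)) * hc
  rw [e, norm_mul, norm_mul, Complex.norm_exp_ofReal_mul_I, one_mul, Complex.norm_real,
    Real.norm_eq_abs]

/-! ### First variation of the energy -/

theorem sub_two_mul_sq_le_log {x : ℝ} (hx : |x| ≤ 1 / 2) : x - 2 * x ^ 2 ≤ Real.log (1 + x) := by
  rw [abs_le] at hx
  have h1 : 0 < 1 + x := by linarith
  refine le_trans ?_ (Real.one_sub_inv_le_log_of_pos h1)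
  rw [← sub_nonneg]
  have : 1 - (1 + x)⁻¹ - (x - 2 * x ^ 2) = x ^ 2 * (1 + 2 * x) / (1 + x) := by
    field_simp; ring
  rw [this]
  exact div_nonneg (mul_nonneg (sq_nonneg _) (by linarith)) h1.le

theorem abs_sin_sub_self_le {x : ℝ} (hx : |x| ≤ 1) : |Real.sin x - x| ≤ |x| ^ 3 := by
  have h := Real.sin_bound hx
  have h2 : |x| ^ 5 ≤ |x| ^ 3 := pow_le_pow_of_le_one (abs_nonneg x) hx (by norm_num)
  have h3 : |x ^ 3 / 6| = |x| ^ 3 / 6 := by rw [abs_div, abs_pow]; norm_num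
  have h4 : 0 ≤ |x| ^ 3 := by positivity
  calc |Real.sin x - x| = |(Real.sin x - (x - x ^ 3 / 6)) - x ^ 3 / 6| := by congr 1; ring
    _ ≤ |Real.sin x - (x - x ^ 3 / 6)| + |x ^ 3 / 6| := abs_sub _ _
    _ ≤ _ := by rw [h3]; linarith

/-- The relative change of the chord is `1 + x` with `x` equal to `C d` up to `c²`, where `C` is the
cotangent and `d = (a - b) / 2`. The quadratic error is uniform in `z` and `w`, even near the
diagonal, because the displacement is measured against the chord. -/
theorem log_norm_mul_exp_le {z w : Circle} (hzw : z ≠ w) {a b c : ℝ}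
    (hab : |a - b| ≤ c * ‖(z : ℂ) - w‖) (hc : c ≤ 1 / 8) :
    z * Circle.exp a ≠ w * Circle.exp b ∧
      Real.log (2 / ‖((z * Circle.exp a : Circle) : ℂ) - ((w * Circle.exp b : Circle) : ℂ)‖) ≤
        Real.log (2 / ‖(z : ℂ) - w‖) - cotKernel z w * (a - b) / 2 + 6 * c ^ 2 := by
  have hpos : 0 < ‖(z : ℂ) - w‖ := norm_pos_iff.2 (sub_ne_zero.2 fun h => hzw (Circle.ext h))
  have hc0 : 0 ≤ c := by
    by_contra! hneg
    nlinarith [abs_nonneg (a - b)]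
  -- Both `|d| ≤ c` and `|C d| ≤ c` hold. Then `|x| ≤ 3c/2`, and the total error is at most `c² + 2
  -- (3c/2)² = 5.5 c²`, rounded up to `6 c²`.
  set d := (a - b) / 2 with hd
  set C := cotKernel z w with hC
  have hda : |d| ≤ c := by
    rw [hd, abs_div, abs_two]
    have := norm_sub_le_two z w
    nlinarith
  have hCd : |C| * |d| ≤ c := by
    rw [hd, abs_div, abs_two]
    have h1 := abs_cotKernel_mul_le z w
    have h2 := abs_nonneg C
    have h3 := mul_le_mul_of_nonneg_left hab h2
    nlinarith
  set x := Real.cos d - 1 + C * Real.sin d with hx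
  have h1 : |Real.cos d - 1| ≤ c ^ 2 / 2 := by
    rw [abs_le]
    have h2 := Real.one_sub_sq_div_two_le_cos (x := d)
    have h3 : d ^ 2 ≤ c ^ 2 := sq_le_sq' (by linarith [abs_le.1 hda]) (abs_le.1 hda).2
    exact ⟨by linarith, by linarith [Real.cos_le_one d, sq_nonneg c]⟩
  have h2 : |C * (Real.sin d - d)| ≤ c ^ 2 / 2 := by
    rw [abs_mul]
    have h3 := abs_sin_sub_self_le (x := d) (by linarith)
    calc |C| * |Real.sin d - d| ≤ |C| * |d| ^ 3 := by gcongr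
      _ = (|C| * |d|) * |d| ^ 2 := by ring
      _ ≤ c * c ^ 2 := by gcongr
      _ ≤ c ^ 2 / 2 := by nlinarith [sq_nonneg c]
  have hxd : |x - C * d| ≤ c ^ 2 := by
    have : x - C * d = (Real.cos d - 1) + C * (Real.sin d - d) := by rw [hx]; ring
    rw [this]
    exact (abs_add_le _ _).trans (by linarith)
  have hxc : |x| ≤ 3 / 2 * c := by
    have h3 : |x| ≤ |x - C * d| + |C * d| := by
      simpa using abs_add_le (x - C * d) (C * d)
    rw [abs_mul C d] at h3
    nlinarith
  have hlog := sub_two_mul_sq_le_log (x := x) (by linarith)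
  have hx2 : x ^ 2 ≤ (3 / 2 * c) ^ 2 := sq_le_sq' (by linarith [abs_le.1 hxc]) (abs_le.1 hxc).2
  have hx1 : 0 < 1 + x := by linarith [abs_le.1 hxc]
  have hn := norm_mul_exp_sub_mul_exp z w hzw a b
  rw [← hd, ← hC, show Real.cos d + C * Real.sin d = 1 + x by rw [hx]; ring, abs_of_pos hx1] at hn
  have hne : z * Circle.exp a ≠ w * Circle.exp b := by
    intro h
    rw [h, sub_self, norm_zero] at hn
    nlinarith
  refine ⟨hne, ?_⟩
  rw [hn, ← div_div, Real.log_div (by positivity) hx1.ne']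
  have h4 : C * (a - b) / 2 = C * d := by rw [hd]; ring
  rw [h4]
  nlinarith [abs_le.1 hxd]

theorem log_two_div_norm_nonneg {z w : Circle} (h : z ≠ w) :
    0 ≤ Real.log (2 / ‖(z : ℂ) - w‖) := by
  have hpos : 0 < ‖(z : ℂ) - w‖ := norm_pos_iff.2 (sub_ne_zero.2 fun h' => h (Circle.ext h'))
  refine Real.log_nonneg ?_
  rw [le_div_iff₀ hpos]
  simpa using norm_sub_le_two z w

/-- The flow `z ↦ z e^{itφ(z)}` of the vector field `φ`. -/
noncomputable def flow (φ : Circle → ℝ) (t : ℝ) (z : Circle) : Circle := z * Circle.exp (t * φ z)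

theorem continuous_flow {φ : Circle → ℝ} (hφ : Continuous φ) (t : ℝ) :
    Continuous (flow φ t) := by
  unfold flow
  exact continuous_id.mul (Circle.exp.continuous.comp (continuous_const.mul hφ))

/-- The bilinear form `½ ∬ cot ((x - y) / 2) (φ(z) - φ(w)) μ(dz) μ(dw)`. -/
noncomputable def cotForm (μ : Measure Circle) (φ : Circle → ℝ) : ℝ :=
  1 / 2 * ∫ p, cotKernel p.1 p.2 * (φ p.1 - φ p.2) ∂(μ.prod μ)

theorem integrable_cotKernel_mul (μ : Measure Circle) [IsProbabilityMeasure μ] {φ : Circle → ℝ}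
    (hφ : Continuous φ) {Λ : ℝ} (hΛ : ∀ z w : Circle, |φ z - φ w| ≤ Λ * ‖(z : ℂ) - w‖) :
    Integrable (fun p : Circle × Circle => cotKernel p.1 p.2 * (φ p.1 - φ p.2)) (μ.prod μ) := by
  refine Integrable.of_bound (C := 2 * Λ) ?_ (Eventually.of_forall fun p => ?_)
  · refine (measurable_cotKernel.mul ?_).aestronglyMeasurable
    exact Continuous.measurable (by fun_prop)
  · rw [Real.norm_eq_abs, abs_mul]
    have h1 := abs_cotKernel_mul_le p.1 p.2
    have h2 := mul_le_mul_of_nonneg_left (hΛ p.1 p.2) (abs_nonneg (cotKernel p.1 p.2))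
    have hΛ0 : 0 ≤ Λ := by
      have h3 := (abs_nonneg _).trans (hΛ 1 (-1))
      have h4 : ‖((1 : Circle) : ℂ) - ((-1 : Circle) : ℂ)‖ = 2 := by
        simp; norm_num
      rw [h4] at h3
      linarith
    nlinarith

theorem logEnergy_eq_ofReal {μ : Measure Circle} [IsProbabilityMeasure μ] (h : logEnergy μ < ⊤) :
    Integrable (fun p : Circle × Circle => Real.log (2 / ‖(p.1 : ℂ) - p.2‖)) (μ.prod μ) ∧
    ∫ p, Real.log (2 / ‖(p.1 : ℂ) - p.2‖) ∂(μ.prod μ) = (logEnergy μ).toReal := by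
  have hne := ae_ne_of_logEnergy_lt_top h
  have hnn : 0 ≤ᵐ[μ.prod μ] fun p : Circle × Circle => Real.log (2 / ‖(p.1 : ℂ) - p.2‖) := by
    filter_upwards [hne] with p hp using log_two_div_norm_nonneg hp
  have hm : Measurable fun p : Circle × Circle => Real.log (2 / ‖(p.1 : ℂ) - p.2‖) := by
    have h1 : Measurable fun p : Circle × Circle => ‖(p.1 : ℂ) - p.2‖ :=
      Continuous.measurable (by fun_prop)
    exact (h1.const_div 2).log
  have he : ∫⁻ p, ENNReal.ofReal (Real.log (2 / ‖(p.1 : ℂ) - p.2‖)) ∂(μ.prod μ) = logEnergy μ := by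
    refine lintegral_congr_ae ?_
    filter_upwards [hne] with p hp
    rw [logKernel, if_neg hp]
  refine ⟨⟨hm.aestronglyMeasurable, ?_⟩, ?_⟩
  · rw [hasFiniteIntegral_iff_ofReal hnn, he]
    exact h
  · rw [integral_eq_lintegral_of_nonneg_ae hnn hm.aestronglyMeasurable, he]

/-- Integrating the pointwise expansion of the kernel gives an upper bound to second order in `t`.
Only an upper bound is needed, since a competitor with smaller energy is what contradicts
near-minimality. -/
theorem logEnergy_map_flow_le {μ : Measure Circle} [IsProbabilityMeasure μ] (h : logEnergy μ < ⊤)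
    {φ : Circle → ℝ} (hφ : Continuous φ) {Λ : ℝ}
    (hΛ : ∀ z w : Circle, |φ z - φ w| ≤ Λ * ‖(z : ℂ) - w‖) {t : ℝ} (ht : 0 ≤ t)
    (htΛ : t * Λ ≤ 1 / 8) :
    logEnergy (μ.map (flow φ t)) < ⊤ ∧ (logEnergy (μ.map (flow φ t))).toReal ≤
      (logEnergy μ).toReal - t * cotForm μ φ + 6 * (t * Λ) ^ 2 := by
  obtain ⟨hi, he⟩ := logEnergy_eq_ofReal h
  have hb := integrable_cotKernel_mul μ hφ hΛ
  let g : Circle × Circle → ℝ := fun p => Real.log (2 / ‖(p.1 : ℂ) - p.2‖) -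
    t / 2 * (cotKernel p.1 p.2 * (φ p.1 - φ p.2)) + 6 * (t * Λ) ^ 2
  have hgi : Integrable g (μ.prod μ) := (hi.sub (hb.const_mul _)).add (integrable_const _)
  have hgv : ∫ p, g p ∂(μ.prod μ) =
      (logEnergy μ).toReal - t * cotForm μ φ + 6 * (t * Λ) ^ 2 := by
    refine (integral_add (hi.sub (hb.const_mul (t / 2))) (integrable_const _)).trans ?_
    refine (congrArg₂ (· + ·) ((integral_sub hi (hb.const_mul (t / 2))).trans
      (congrArg₂ (· - ·) he (integral_const_mul _ _))) (integral_const _)).trans ?_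
    simp only [probReal_univ, smul_eq_mul, one_mul, cotForm]
    ring
  have hpt : ∀ p : Circle × Circle, p.1 ≠ p.2 → 0 ≤ g p ∧
      logKernel (flow φ t p.1) (flow φ t p.2) ≤ ENNReal.ofReal (g p) := by
    intro p hp
    have hab : |t * φ p.1 - t * φ p.2| ≤ t * Λ * ‖(p.1 : ℂ) - p.2‖ := by
      rw [← mul_sub, abs_mul, abs_of_nonneg ht, mul_assoc]
      exact mul_le_mul_of_nonneg_left (hΛ _ _) ht
    obtain ⟨h1, h2⟩ := log_norm_mul_exp_le hp hab htΛ
    have h3 := log_two_div_norm_nonneg h1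
    have h4 : Real.log (2 / ‖(p.1 : ℂ) - p.2‖) - cotKernel p.1 p.2 * (t * φ p.1 - t * φ p.2) / 2 +
        6 * (t * Λ) ^ 2 = g p := by
      simp only [g]; ring
    rw [h4] at h2
    refine ⟨h3.trans h2, ?_⟩
    rw [flow, flow, logKernel, if_neg h1]
    exact ENNReal.ofReal_le_ofReal h2
  have hne := ae_ne_of_logEnergy_lt_top h
  have hm := (continuous_flow hφ t).measurable
  have hmain : logEnergy (μ.map (flow φ t)) ≤ ENNReal.ofReal (∫ p, g p ∂(μ.prod μ)) := by
    rw [logEnergy, Measure.map_prod_map _ _ hm hm,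
      lintegral_map measurable_logKernel (hm.prodMap hm), ofReal_integral_eq_lintegral_ofReal hgi
        (by filter_upwards [hne] with p hp using (hpt p hp).1)]
    refine lintegral_mono_ae ?_
    filter_upwards [hne] with p hp using (hpt p hp).2
  refine ⟨hmain.trans_lt ENNReal.ofReal_lt_top, ?_⟩
  rw [← hgv]
  refine ENNReal.toReal_le_of_le_ofReal (integral_nonneg_of_ae ?_) hmain
  filter_upwards [hne] with p hp using (hpt p hp).1

theorem hasDerivAt_integral_map_flow {Q : Circle → ℝ} (hQ : IsCn 1 Q) (μ : Measure Circle)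
    [IsProbabilityMeasure μ] {φ : Circle → ℝ} (hφ : Continuous φ) :
    HasDerivAt (fun t => ∫ z, Q z ∂(μ.map (flow φ t))) (∫ z, circleDeriv Q z * φ z ∂μ) 0 := by
  have hQ' := hQ.continuous_circleDeriv
  have e : ∀ t, ∫ z, Q z ∂(μ.map (flow φ t)) = ∫ z, Q (z * Circle.exp (t * φ z)) ∂μ := fun t =>
    integral_map (continuous_flow hφ t).measurable.aemeasurable
      hQ.continuous.stronglyMeasurable.aestronglyMeasurable
  simp_rw [e]
  obtain ⟨A, hA⟩ := isCompact_univ.exists_bound_of_continuousOn hQ'.continuousOn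
  obtain ⟨B, hB⟩ := isCompact_univ.exists_bound_of_continuousOn hφ.continuousOn
  have hc : ∀ t, Continuous fun z : Circle => z * Circle.exp (t * φ z) := continuous_flow hφ
  have h := hasDerivAt_integral_of_dominated_loc_of_deriv_le (μ := μ) (x₀ := (0 : ℝ)) (s := univ)
    (F := fun t z => Q (z * Circle.exp (t * φ z)))
    (F' := fun t z => circleDeriv Q (z * Circle.exp (t * φ z)) * φ z)
    (bound := fun _ => A * B) univ_mem
    (Eventually.of_forall fun t =>
      (hQ.continuous.comp (hc t)).stronglyMeasurable.aestronglyMeasurable)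
    (integrable_circle_of_continuous (hQ.continuous.comp (hc 0)) μ)
    ((hQ'.comp (hc 0)).mul hφ).stronglyMeasurable.aestronglyMeasurable
    (Eventually.of_forall fun z t _ => by
      rw [norm_mul]
      exact mul_le_mul (hA _ (mem_univ _)) (hB _ (mem_univ _)) (norm_nonneg _)
        ((norm_nonneg _).trans (hA 1 (mem_univ _))))
    (integrable_const _)
    (Eventually.of_forall fun z t _ => hQ.hasDerivAt_mul_exp z (φ z) t)
  simpa using h.2

/-- The first variation of the energy along the flow of `φ`. -/
noncomputable def firstVariation (Q : Circle → ℝ) (μ : Measure Circle) (φ : Circle → ℝ) : ℝ :=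
  ∫ z, circleDeriv Q z * φ z ∂μ - cotForm μ φ

theorem eventually_realEnergy_map_flow_le {Q : Circle → ℝ} (hQ : IsCn 1 Q) {μ : Measure Circle}
    [IsProbabilityMeasure μ] (h : logEnergy μ < ⊤) {φ : Circle → ℝ} (hφ : Continuous φ) {Λ : ℝ}
    (hΛ : ∀ z w : Circle, |φ z - φ w| ≤ Λ * ‖(z : ℂ) - w‖) {a : ℝ}
    (ha : firstVariation Q μ φ < a) :
    ∀ᶠ t in 𝓝[>] (0 : ℝ), logEnergy (μ.map (flow φ t)) < ⊤ ∧
      realEnergy Q (μ.map (flow φ t)) ≤ realEnergy Q μ + t * a := by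
  set b := ∫ z, circleDeriv Q z * φ z ∂μ with hb
  have hd := (hasDerivAt_integral_map_flow hQ μ hφ).hasDerivWithinAt (s := Ioi 0)
  rw [hasDerivWithinAt_iff_tendsto_slope' self_notMem_Ioi] at hd
  have hΛ1 : Tendsto (fun t : ℝ => t * Λ) (𝓝[>] 0) (𝓝 0) := by
    have : Continuous fun t : ℝ => t * Λ := by fun_prop
    simpa using (this.tendsto 0).mono_left nhdsWithin_le_nhds
  have hΛ2 : Tendsto (fun t : ℝ => 6 * t * Λ ^ 2) (𝓝[>] 0) (𝓝 0) := by
    have : Continuous fun t : ℝ => 6 * t * Λ ^ 2 := by fun_prop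
    simpa using (this.tendsto 0).mono_left nhdsWithin_le_nhds
  unfold firstVariation at ha
  rw [← hb] at ha
  set δ := a - (b - cotForm μ φ) with hδ
  have e1 : ∀ᶠ t in 𝓝[>] (0 : ℝ), t * Λ < 1 / 8 := hΛ1.eventually_lt_const (by norm_num)
  have e2 : ∀ᶠ t in 𝓝[>] (0 : ℝ), 6 * t * Λ ^ 2 < δ / 2 :=
    hΛ2.eventually_lt_const (by linarith)
  have e3 := hd.eventually_lt_const (show b < b + δ / 2 by linarith)
  filter_upwards [e1, e2, e3, self_mem_nhdsWithin] with t h1 h2 h3 (ht : 0 < t)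
  obtain ⟨h4, h5⟩ := logEnergy_map_flow_le h hφ hΛ ht.le h1.le
  refine ⟨h4, ?_⟩
  have h0 : μ.map (flow φ 0) = μ := by
    have : flow φ 0 = id := by funext z; simp [flow]
    rw [this, Measure.map_id]
  rw [slope_def_field, h0, sub_zero, div_lt_iff₀ ht] at h3
  unfold realEnergy
  nlinarith

/-! ### Herglotz and Poisson kernels -/

/-- The Herglotz kernel `(w + r z) / (w - r z)` of the unit disc, in the variables `z` and `w`. -/
noncomputable def herglotz (r : ℝ) (z s : Circle) : ℂ := ((s : ℂ) + r * z) / (s - r * z)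

theorem herglotz_denom_ne {r : ℝ} (h0 : 0 ≤ r) (h1 : r < 1) (z s : Circle) :
    (s : ℂ) - r * z ≠ 0 := by
  have := norm_sub_mul_pos h0 s z
  exact norm_pos_iff.1 (by linarith)

theorem continuous_herglotz {r : ℝ} (h0 : 0 ≤ r) (h1 : r < 1) :
    Continuous fun p : Circle × Circle => herglotz r p.1 p.2 := by
  unfold herglotz
  exact Continuous.div (by fun_prop) (by fun_prop) fun p => herglotz_denom_ne h0 h1 p.1 p.2

/-- The Poisson kernel of the unit disc. -/
noncomputable def poisson (r : ℝ) (z s : Circle) : ℝ := (herglotz r z s).re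

theorem poisson_eq {r : ℝ} (h0 : 0 ≤ r) (h1 : r < 1) (z s : Circle) :
    poisson r z s = (1 - r ^ 2) / ‖(s : ℂ) - r * z‖ ^ 2 := by
  have hne := herglotz_denom_ne h0 h1 z s
  have hs : (s : ℂ).re ^ 2 + (s : ℂ).im ^ 2 = 1 := by
    have := Circle.normSq_coe s
    rw [Complex.normSq_apply] at this; linarith
  have hz : (z : ℂ).re ^ 2 + (z : ℂ).im ^ 2 = 1 := by
    have := Circle.normSq_coe z
    rw [Complex.normSq_apply] at this; linarith
  rw [poisson, herglotz, Complex.div_re, Complex.normSq_eq_norm_sq, ← add_div]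
  congr 1
  simp only [Complex.add_re, Complex.sub_re, Complex.mul_re, Complex.ofReal_re, Complex.ofReal_im,
    Complex.add_im, Complex.sub_im, Complex.mul_im]
  linear_combination hs - r ^ 2 * hz

theorem poisson_nonneg {r : ℝ} (h0 : 0 ≤ r) (h1 : r < 1) (z s : Circle) : 0 ≤ poisson r z s := by
  rw [poisson_eq h0 h1]
  exact div_nonneg (by nlinarith) (by positivity)

theorem continuous_poisson {r : ℝ} (h0 : 0 ≤ r) (h1 : r < 1) :
    Continuous fun p : Circle × Circle => poisson r p.1 p.2 :=
  Complex.continuous_re.comp (continuous_herglotz h0 h1)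

/-- From `|s - r z|² = (1 - r)² + r |z - s|²`. The bound tends to `0` as `r → 1`, which expresses
concentration of the Poisson kernel on the diagonal. -/
theorem norm_sub_sq_mul_poisson_le {r : ℝ} (h0 : 0 < r) (h1 : r < 1) (z s : Circle) :
    ‖(z : ℂ) - s‖ ^ 2 * poisson r z s ≤ (1 - r ^ 2) / r := by
  have hs : (s : ℂ).re ^ 2 + (s : ℂ).im ^ 2 = 1 := by
    have := Circle.normSq_coe s
    rw [Complex.normSq_apply] at this; linarith
  have hz : (z : ℂ).re ^ 2 + (z : ℂ).im ^ 2 = 1 := by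
    have := Circle.normSq_coe z
    rw [Complex.normSq_apply] at this; linarith
  have e : ‖(s : ℂ) - r * z‖ ^ 2 = (1 - r) ^ 2 + r * ‖(z : ℂ) - s‖ ^ 2 := by
    rw [← Complex.normSq_eq_norm_sq, ← Complex.normSq_eq_norm_sq, Complex.normSq_apply,
      Complex.normSq_apply]
    simp only [Complex.sub_re, Complex.mul_re, Complex.ofReal_re, Complex.ofReal_im,
      Complex.sub_im, Complex.mul_im]
    linear_combination (1 - r) * hs + (r ^ 2 - r) * hz
  have hpos : 0 < ‖(s : ℂ) - r * z‖ ^ 2 := by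
    have := norm_pos_iff.2 (herglotz_denom_ne h0.le h1 z s)
    positivity
  rw [poisson_eq h0.le h1, mul_div_assoc', div_le_div_iff₀ hpos h0, e]
  nlinarith [sq_nonneg (1 - r), mul_nonneg (sq_nonneg (1 - r)) (by nlinarith : 0 ≤ 1 - r ^ 2)]

theorem integral_herglotz {r : ℝ} (h0 : 0 ≤ r) (h1 : r < 1) (s : Circle) :
    ∫ z, herglotz r z s ∂haar = 1 := by
  have h := integral_haar_of_differentiableAt (f := fun ζ => ((s : ℂ) + r * ζ) / (s - r * ζ)) (by
    intro ζ hζ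
    rw [mem_closedBall_zero_iff] at hζ
    have hne : (s : ℂ) - r * ζ ≠ 0 := by
      have := norm_sub_norm_le (s : ℂ) (r * ζ)
      rw [norm_mul, Circle.norm_coe, Complex.norm_real, Real.norm_of_nonneg h0] at this
      exact norm_pos_iff.1 (by nlinarith)
    fun_prop (disch := exact hne))
  refine h.trans ?_
  simp

theorem integral_poisson {r : ℝ} (h0 : 0 ≤ r) (h1 : r < 1) (s : Circle) :
    ∫ z, poisson r z s ∂haar = 1 := by
  have hc : Continuous fun z => herglotz r z s :=
    (continuous_herglotz h0 h1).comp (by fun_prop : Continuous fun z : Circle => (z, s))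
  have := integral_re (integrable_circle_of_continuous hc haar)
  rw [integral_herglotz h0 h1] at this
  exact this

/-- This is the addition formula for the cotangent: the cotangent times the difference of two
Herglotz kernels is `-i (h(z, s) h(z, t) - 1)`. The right side is smooth and factorizes in `s` and
`t`, so the singular double integral in `cotForm` reduces to the square of a Herglotz integral. -/
theorem cotKernel_mul_poisson_sub {r : ℝ} (h0 : 0 ≤ r) (h1 : r < 1) (z : Circle) {s t : Circle}
    (hst : s ≠ t) : cotKernel s t * (poisson r z s - poisson r z t) =
      (herglotz r z s * herglotz r z t).im := by
  have hs := herglotz_denom_ne h0 h1 z s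
  have ht := herglotz_denom_ne h0 h1 z t
  have hne : (s : ℂ) - t ≠ 0 := sub_ne_zero.2 fun h => hst (Circle.ext h)
  have e : (cotKernel s t : ℂ) * (herglotz r z s - herglotz r z t) =
      -Complex.I * (herglotz r z s * herglotz r z t - 1) := by
    rw [cotKernel_coe, herglotz, herglotz]
    field_simp
    ring
  have := congrArg Complex.re e
  rw [Complex.re_ofReal_mul, Complex.sub_re] at this
  rw [poisson, poisson, this]
  simp

/-- The same identity in the other variable, with the opposite sign of the difference; this version
serves to compute the Hilbert transform. -/
theorem cotKernel_mul_poisson_sub' {r : ℝ} (h0 : 0 ≤ r) (h1 : r < 1) {z w : Circle} (s : Circle)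
    (hzw : z ≠ w) : cotKernel z w * (poisson r w s - poisson r z s) =
      (herglotz r z s * herglotz r w s).im := by
  have hs := herglotz_denom_ne h0 h1 z s
  have ht := herglotz_denom_ne h0 h1 w s
  have hne : (z : ℂ) - w ≠ 0 := sub_ne_zero.2 fun h => hzw (Circle.ext h)
  have e : (cotKernel z w : ℂ) * (herglotz r w s - herglotz r z s) =
      -Complex.I * (herglotz r z s * herglotz r w s - 1) := by
    rw [cotKernel_coe, herglotz, herglotz]
    rw [div_sub_div _ _ ht hs, div_mul_div_comm, div_mul_div_comm, div_sub_one (mul_ne_zero hs ht),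
      mul_div_assoc', div_eq_div_iff (mul_ne_zero hne (mul_ne_zero ht hs)) (mul_ne_zero hs ht)]
    ring
  have := congrArg Complex.re e
  rw [Complex.re_ofReal_mul, Complex.sub_re] at this
  rw [poisson, poisson, this]
  simp

theorem abs_poisson_sub_le {r : ℝ} (h0 : 0 ≤ r) (h1 : r < 1) (z s t : Circle) :
    |poisson r z s - poisson r z t| ≤ 2 / (1 - r) ^ 2 * ‖(s : ℂ) - t‖ := by
  have hs := herglotz_denom_ne h0 h1 z s
  have ht := herglotz_denom_ne h0 h1 z t
  have e : herglotz r z s - herglotz r z t = 2 * r * z * (t - s) / ((s - r * z) * (t - r * z)) := by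
    rw [herglotz, herglotz]
    field_simp
    ring
  rw [poisson, poisson, ← Complex.sub_re]
  refine (Complex.abs_re_le_norm _).trans ?_
  rw [e, norm_div, norm_mul, norm_mul, norm_mul, norm_mul, Circle.norm_coe, Complex.norm_real,
    Real.norm_of_nonneg h0, norm_sub_rev, div_mul_eq_mul_div]
  have h2 := norm_sub_mul_pos h0 s z
  have h3 := norm_sub_mul_pos h0 t z
  have h4 : (1 - r) ^ 2 ≤ ‖(s : ℂ) - r * z‖ * ‖(t : ℂ) - r * z‖ := by
    rw [sq]; exact mul_le_mul h2 h3 (by linarith) (norm_nonneg _)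
  have h5 : ‖(2 : ℂ)‖ = 2 := by simp
  rw [h5]
  refine div_le_div₀ (by positivity) ?_ (by nlinarith) h4
  nlinarith [norm_nonneg ((s : ℂ) - t)]

/-! ### Poisson regularization of measures -/

/-- The Herglotz integral of a measure. -/
noncomputable def herglotzIntegral (r : ℝ) (μ : Measure Circle) (z : Circle) : ℂ :=
  ∫ s, herglotz r z s ∂μ

/-- The density of the Poisson regularization of a measure. -/
noncomputable def poissonDensity (r : ℝ) (μ : Measure Circle) (z : Circle) : ℝ :=
  ∫ s, poisson r z s ∂μ

/-- The Poisson regularization of a measure. -/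
noncomputable def poissonMeasure (r : ℝ) (μ : Measure Circle) : Measure Circle :=
  haar.withDensity fun z => ENNReal.ofReal (poissonDensity r μ z)

theorem continuous_herglotz_right {r : ℝ} (h0 : 0 ≤ r) (h1 : r < 1) (z : Circle) :
    Continuous fun s => herglotz r z s :=
  (continuous_herglotz h0 h1).comp (by fun_prop : Continuous fun s : Circle => (z, s))

theorem re_herglotzIntegral {r : ℝ} (h0 : 0 ≤ r) (h1 : r < 1) (μ : Measure Circle)
    [IsProbabilityMeasure μ] (z : Circle) : (herglotzIntegral r μ z).re = poissonDensity r μ z :=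
  (integral_re (integrable_circle_of_continuous (continuous_herglotz_right h0 h1 z) μ)).symm

theorem im_herglotzIntegral {r : ℝ} (h0 : 0 ≤ r) (h1 : r < 1) (μ : Measure Circle)
    [IsProbabilityMeasure μ] (z : Circle) :
    (herglotzIntegral r μ z).im = ∫ s, (herglotz r z s).im ∂μ :=
  (integral_im (integrable_circle_of_continuous (continuous_herglotz_right h0 h1 z) μ)).symm

theorem continuous_herglotzIntegral {r : ℝ} (h0 : 0 ≤ r) (h1 : r < 1) (μ : Measure Circle)
    [IsProbabilityMeasure μ] : Continuous (herglotzIntegral r μ) := by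
  obtain ⟨C, hC⟩ := isCompact_univ.exists_bound_of_continuousOn
    (continuous_herglotz h0 h1).continuousOn
  refine continuous_of_dominated (bound := fun _ => C)
    (fun z => (continuous_herglotz_right h0 h1 z).stronglyMeasurable.aestronglyMeasurable)
    (fun z => Eventually.of_forall fun s => hC (z, s) (mem_univ _)) (integrable_const _)
    (Eventually.of_forall fun s => ?_)
  exact (continuous_herglotz h0 h1).comp (by fun_prop : Continuous fun z : Circle => (z, s))

theorem continuous_poissonDensity {r : ℝ} (h0 : 0 ≤ r) (h1 : r < 1) (μ : Measure Circle)
    [IsProbabilityMeasure μ] : Continuous (poissonDensity r μ) := by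
  have : poissonDensity r μ = fun z => (herglotzIntegral r μ z).re :=
    funext fun z => (re_herglotzIntegral h0 h1 μ z).symm
  rw [this]
  exact Complex.continuous_re.comp (continuous_herglotzIntegral h0 h1 μ)

theorem poissonDensity_nonneg {r : ℝ} (h0 : 0 ≤ r) (h1 : r < 1) (μ : Measure Circle) (z : Circle) :
    0 ≤ poissonDensity r μ z :=
  integral_nonneg fun s => poisson_nonneg h0 h1 z s

theorem integral_poissonMeasure {r : ℝ} (h0 : 0 ≤ r) (h1 : r < 1) (μ : Measure Circle)
    [IsProbabilityMeasure μ] (f : Circle → ℝ) :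
    ∫ z, f z ∂(poissonMeasure r μ) = ∫ z, f z * poissonDensity r μ z ∂haar := by
  rw [poissonMeasure, integral_withDensity_eq_integral_toReal_smul
    (continuous_poissonDensity h0 h1 μ).measurable.ennreal_ofReal
    (Eventually.of_forall fun _ => ENNReal.ofReal_lt_top)]
  refine integral_congr_ae (Eventually.of_forall fun z => ?_)
  simp only [smul_eq_mul]
  rw [ENNReal.toReal_ofReal (poissonDensity_nonneg h0 h1 μ z), mul_comm]

theorem integral_mul_poissonDensity {r : ℝ} (h0 : 0 ≤ r) (h1 : r < 1) (μ : Measure Circle)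
    [IsProbabilityMeasure μ] {f : Circle → ℝ} (hf : Continuous f) :
    ∫ z, f z * poissonDensity r μ z ∂haar =
      ∫ p, f p.1 * poisson r p.1 p.2 ∂(haar.prod μ) := by
  have hi : Integrable (fun p : Circle × Circle => f p.1 * poisson r p.1 p.2) (haar.prod μ) :=
    integrable_circle_of_continuous ((hf.comp continuous_fst).mul (continuous_poisson h0 h1)) _
  rw [integral_prod _ hi]
  refine integral_congr_ae (Eventually.of_forall fun z => ?_)
  exact (integral_const_mul _ _).symm

theorem integral_mul_poisson_right {r : ℝ} (h0 : 0 ≤ r) (h1 : r < 1) (μ : Measure Circle)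
    [IsProbabilityMeasure μ] {f : Circle → ℝ} (hf : Continuous f) :
    ∫ p, f p.2 * poisson r p.1 p.2 ∂(haar.prod μ) = ∫ s, f s ∂μ := by
  have hi : Integrable (fun p : Circle × Circle => f p.2 * poisson r p.1 p.2) (haar.prod μ) :=
    integrable_circle_of_continuous ((hf.comp continuous_snd).mul (continuous_poisson h0 h1)) _
  rw [integral_prod_symm _ hi]
  refine integral_congr_ae (Eventually.of_forall fun s => ?_)
  refine (integral_const_mul (f s) fun z => poisson r z s).trans ?_
  rw [integral_poisson h0 h1, mul_one]

theorem isProbabilityMeasure_poissonMeasure {r : ℝ} (h0 : 0 ≤ r) (h1 : r < 1) (μ : Measure Circle)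
    [IsProbabilityMeasure μ] : IsProbabilityMeasure (poissonMeasure r μ) := by
  refine ⟨?_⟩
  rw [poissonMeasure, withDensity_apply _ MeasurableSet.univ, setLIntegral_univ,
    ← ofReal_integral_eq_lintegral_ofReal
      (integrable_circle_of_continuous (continuous_poissonDensity h0 h1 μ) _)
      (Eventually.of_forall fun z => poissonDensity_nonneg h0 h1 μ z)]
  have h := integral_mul_poissonDensity h0 h1 μ (f := fun _ => 1) continuous_const
  have h' := integral_mul_poisson_right h0 h1 μ (f := fun _ => 1) continuous_const
  rw [h'] at h
  simp only [one_mul, integral_const, probReal_univ, smul_eq_mul, mul_one] at h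
  rw [h, ENNReal.ofReal_one]

theorem differentiableOn_herglotz_integral (μ : Measure Circle) [IsProbabilityMeasure μ] :
    DifferentiableOn ℂ (fun ζ : ℂ => ∫ s : Circle, ((s : ℂ) + ζ) / (s - ζ) ∂μ)
      (Metric.ball 0 1) := by
  intro ζ hζ
  rw [mem_ball_zero_iff] at hζ
  -- Half the distance from `ζ` to the unit circle, so that all poles stay at distance at least `d`
  -- from the ball of radius `d` about `ζ`.
  set d := (1 - ‖ζ‖) / 2 with hd
  have hd0 : 0 < d := by linarith
  have hlow : ∀ ξ ∈ Metric.ball ζ d, ∀ s : Circle, d ≤ ‖(s : ℂ) - ξ‖ := by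
    intro ξ hξ s
    rw [mem_ball_iff_norm] at hξ
    have h1 := norm_sub_norm_le (s : ℂ) ξ
    have h2 := norm_sub_norm_le ξ ζ
    rw [Circle.norm_coe] at h1
    linarith
  have hne : ∀ ξ ∈ Metric.ball ζ d, ∀ s : Circle, (s : ℂ) - ξ ≠ 0 := fun ξ hξ s =>
    norm_pos_iff.1 (hd0.trans_le (hlow ξ hξ s))
  have hζd : ζ ∈ Metric.ball ζ d := Metric.mem_ball_self hd0
  have hcont : ∀ ξ ∈ Metric.ball ζ d, Continuous fun s : Circle => ((s : ℂ) + ξ) / (s - ξ) :=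
    fun ξ hξ => Continuous.div (by fun_prop) (by fun_prop) fun s => hne ξ hξ s
  have h := hasDerivAt_integral_of_dominated_loc_of_deriv_le (μ := μ) (x₀ := ζ)
    (s := Metric.ball ζ d) (F := fun (ξ : ℂ) (s : Circle) => ((s : ℂ) + ξ) / (s - ξ))
    (F' := fun ξ s => 2 * (s : ℂ) / (s - ξ) ^ 2) (bound := fun _ => 2 / d ^ 2)
    (Metric.ball_mem_nhds ζ hd0)
    (by
      filter_upwards [Metric.ball_mem_nhds ζ hd0] with ξ hξ
      exact (hcont ξ hξ).stronglyMeasurable.aestronglyMeasurable)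
    (integrable_circle_of_continuous (hcont ζ hζd) μ)
    (Continuous.div (by fun_prop) (by fun_prop)
      fun s => pow_ne_zero 2 (hne ζ hζd s)).stronglyMeasurable.aestronglyMeasurable
    (Eventually.of_forall fun s ξ hξ => by
      rw [norm_div, norm_mul, norm_pow, Circle.norm_coe, Complex.norm_ofNat, mul_one]
      have := hlow ξ hξ s
      gcongr)
    (integrable_const _)
    (Eventually.of_forall fun s ξ hξ => by
      have h1 : HasDerivAt (fun ξ : ℂ => (s : ℂ) + ξ) 1 ξ := (hasDerivAt_id ξ).const_add _
      have h2 : HasDerivAt (fun ξ : ℂ => (s : ℂ) - ξ) (-1) ξ := (hasDerivAt_id ξ).const_sub _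
      refine (h1.div h2 (hne ξ hξ s)).congr_deriv ?_
      congr 1
      ring)
  exact h.2.differentiableAt.differentiableWithinAt

/-- The density is the real part of a function holomorphic in the open unit disc, read along the
circle of radius `r < 1`. -/
theorem isCn_poissonDensity {r : ℝ} (h0 : 0 ≤ r) (h1 : r < 1) (μ : Measure Circle)
    [IsProbabilityMeasure μ] : IsCn ∞ (poissonDensity r μ) := by
  have hG := ((differentiableOn_herglotz_integral μ).contDiffOn (n := ∞)
    Metric.isOpen_ball).restrict_scalars ℝ
  have hm : ∀ x : ℝ, (r : ℂ) * Complex.exp (x * Complex.I) ∈ Metric.ball (0 : ℂ) 1 := by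
    intro x
    rw [mem_ball_zero_iff, norm_mul, Complex.norm_exp_ofReal_mul_I, Complex.norm_real,
      Real.norm_of_nonneg h0, mul_one]
    exact h1
  have hl : ContDiff ℝ ∞ fun x : ℝ => (r : ℂ) * Complex.exp (x * Complex.I) := by
    have : ContDiff ℝ ∞ fun x : ℝ => (x : ℂ) := Complex.ofRealCLM.contDiff
    exact contDiff_const.mul ((this.mul contDiff_const).cexp)
  have hc := Complex.reCLM.contDiff.comp (hG.comp_contDiff hl hm)
  have e : (fun x : ℝ => poissonDensity r μ (Circle.exp x)) = Complex.reCLM ∘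
      ((fun ζ : ℂ => ∫ s : Circle, ((s : ℂ) + ζ) / (s - ζ) ∂μ) ∘
        fun x : ℝ => (r : ℂ) * Complex.exp (x * Complex.I)) := by
    funext x
    rw [← re_herglotzIntegral h0 h1]
    simp only [Function.comp, herglotzIntegral, herglotz, Circle.coe_exp, Complex.reCLM_apply]
  unfold IsCn
  rw [e]
  exact hc

theorem isSmoothProbability_poissonMeasure {r : ℝ} (h0 : 0 ≤ r) (h1 : r < 1) (μ : Measure Circle)
    [IsProbabilityMeasure μ] : IsSmoothProbability (poissonMeasure r μ) :=
  ⟨isProbabilityMeasure_poissonMeasure h0 h1 μ, poissonDensity r μ, isCn_poissonDensity h0 h1 μ,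
    poissonDensity_nonneg h0 h1 μ, rfl⟩

/-! ### The Hilbert transform of a Poisson regularization -/

theorem measurable_cotKernel_right (z : Circle) : Measurable fun w => cotKernel z w := by
  have h : (fun w => cotKernel z w) =
      (fun p : Circle × Circle => cotKernel p.1 p.2) ∘ fun w : Circle => (z, w) := rfl
  rw [h]
  exact measurable_cotKernel.comp measurable_prodMk_left

/-- After rotating `z` to `1`, the inversion `u ↦ u⁻¹` preserves Haar measure and the truncated
region but changes the sign of the cotangent. -/
theorem setIntegral_cotKernel_haar (z : Circle) (ε : ℝ) :
    ∫ w in {w : Circle | ε < ‖(z : ℂ) - w‖}, cotKernel z w ∂haar = 0 := by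
  have hS : MeasurableSet {w : Circle | ε < ‖(z : ℂ) - w‖} :=
    measurableSet_lt measurable_const (Continuous.measurable (by fun_prop))
  rw [← integral_indicator hS]
  set f : Circle → ℝ := {w : Circle | ε < ‖(z : ℂ) - w‖}.indicator (cotKernel z) with hf
  have hfm : Measurable f :=
    (measurable_cotKernel_right z).indicator hS
  rw [← integral_haar_mul_left hfm z]
  have hgm : Measurable fun u => f (z * u) := hfm.comp (measurable_const_mul z)
  have hodd : ∀ u, f (z * u⁻¹) = -f (z * u) := by
    intro u
    have hu := Circle.coe_ne_zero u
    have hz := Circle.coe_ne_zero z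
    have hn : ‖(z : ℂ) - (z * u⁻¹ : Circle)‖ = ‖(z : ℂ) - (z * u : Circle)‖ := by
      have : (z : ℂ) - (z * u : Circle) = -(u : ℂ) * ((z : ℂ) - (z * u⁻¹ : Circle)) := by
        push_cast
        field_simp
        ring
      rw [this, norm_mul, norm_neg, Circle.norm_coe, one_mul]
    have hc : cotKernel z (z * u⁻¹) = -cotKernel z (z * u) := by
      rw [← cotKernel_swap]
      have : z / (z * u⁻¹) = z * u / z := by
        rw [div_mul_cancel_left, inv_inv, mul_div_cancel_left]
      rw [cotKernel, cotKernel, this]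
    simp only [hf, indicator_apply, mem_ofPred_eq, hn, hc]
    split_ifs <;> simp
  have h := integral_haar_inv hgm
  simp_rw [hodd, integral_neg] at h
  linarith

/-- The function `w ↦ ∫ Im (h(z, s) h(w, s)) μ(ds)` for the Herglotz kernel `h`. -/
noncomputable def herglotzCross (r : ℝ) (μ : Measure Circle) (z w : Circle) : ℝ :=
  ∫ s, (herglotz r z s * herglotz r w s).im ∂μ

theorem continuous_im_herglotz_mul {r : ℝ} (h0 : 0 ≤ r) (h1 : r < 1) (z : Circle) :
    Continuous fun p : Circle × Circle => (herglotz r z p.2 * herglotz r p.1 p.2).im :=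
  Complex.continuous_im.comp (((continuous_herglotz_right h0 h1 z).comp continuous_snd).mul
    (continuous_herglotz h0 h1))

theorem exists_abs_im_herglotz_mul_le {r : ℝ} (h0 : 0 ≤ r) (h1 : r < 1) (z : Circle) :
    ∃ B, ∀ w s, ‖(herglotz r z s * herglotz r w s).im‖ ≤ B := by
  obtain ⟨B, hB⟩ := isCompact_univ.exists_bound_of_continuousOn
    (continuous_im_herglotz_mul h0 h1 z).continuousOn
  exact ⟨B, fun w s => hB (w, s) (mem_univ _)⟩

theorem continuous_herglotzCross {r : ℝ} (h0 : 0 ≤ r) (h1 : r < 1) (μ : Measure Circle)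
    [IsProbabilityMeasure μ] (z : Circle) : Continuous (herglotzCross r μ z) := by
  obtain ⟨B, hB⟩ := exists_abs_im_herglotz_mul_le h0 h1 z
  have hprod := continuous_im_herglotz_mul h0 h1 z
  refine continuous_of_dominated (bound := fun _ => B)
    (fun w => ?_) (fun w => Eventually.of_forall fun s => hB w s) (integrable_const _)
    (Eventually.of_forall fun s => ?_)
  · exact (hprod.comp (by fun_prop : Continuous fun s : Circle =>
      (w, s))).stronglyMeasurable.aestronglyMeasurable
  · exact hprod.comp (by fun_prop : Continuous fun w : Circle => (w, s))

theorem cotKernel_mul_poissonDensity_sub {r : ℝ} (h0 : 0 ≤ r) (h1 : r < 1) (μ : Measure Circle)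
    [IsProbabilityMeasure μ] {z w : Circle} (hzw : z ≠ w) :
    cotKernel z w * (poissonDensity r μ w - poissonDensity r μ z) = herglotzCross r μ z w := by
  have hi : ∀ w, Integrable (fun s => poisson r w s) μ := fun w =>
    integrable_circle_of_continuous
      (Complex.continuous_re.comp (continuous_herglotz_right h0 h1 w)) μ
  rw [poissonDensity, poissonDensity, ← integral_sub (hi w) (hi z), ← integral_const_mul]
  exact integral_congr_ae (Eventually.of_forall fun s =>
    cotKernel_mul_poisson_sub' h0 h1 s hzw)

theorem integral_herglotzCross {r : ℝ} (h0 : 0 ≤ r) (h1 : r < 1) (μ : Measure Circle)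
    [IsProbabilityMeasure μ] (z : Circle) :
    ∫ w, herglotzCross r μ z w ∂haar = (herglotzIntegral r μ z).im := by
  have hi : Integrable (Function.uncurry fun w s : Circle =>
      (herglotz r z s * herglotz r w s).im) (haar.prod μ) :=
    integrable_circle_of_continuous (continuous_im_herglotz_mul h0 h1 z) _
  refine (integral_integral_swap hi).trans ?_
  rw [im_herglotzIntegral h0 h1]
  refine integral_congr_ae (Eventually.of_forall fun s => ?_)
  have hc : Continuous fun w => herglotz r z s * herglotz r w s :=
    continuous_const.mul ((continuous_herglotz h0 h1).comp
      (by fun_prop : Continuous fun w : Circle => (w, s)))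
  refine (integral_im (integrable_circle_of_continuous hc haar)).trans ?_
  rw [integral_const_mul, integral_herglotz h0 h1, mul_one]
  rfl

theorem setIntegral_cotKernel_poissonMeasure {r : ℝ} (h0 : 0 ≤ r) (h1 : r < 1) (μ : Measure Circle)
    [IsProbabilityMeasure μ] (z : Circle) {ε : ℝ} (hε : 0 < ε) {S : Set Circle}
    (hS : MeasurableSet S) (hmem : ∀ w ∈ S, ε < ‖(z : ℂ) - w‖)
    (hz : ∫ w in S, cotKernel z w ∂haar = 0) :
    ∫ w in S, cotKernel z w ∂(poissonMeasure r μ) =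
      ∫ w, S.indicator (herglotzCross r μ z) w ∂haar := by
  have hCm := measurable_cotKernel_right z
  rw [← integral_indicator hS, integral_poissonMeasure h0 h1]
  rw [← integral_indicator hS] at hz
  have hm := (hCm.indicator hS).aestronglyMeasurable (μ := haar)
  have hb : ∀ w, ‖S.indicator (cotKernel z) w‖ ≤ 2 / ε := by
    intro w
    by_cases hw : w ∈ S
    · rw [indicator_of_mem hw, Real.norm_eq_abs, le_div_iff₀ hε]
      have := abs_cotKernel_mul_le z w
      nlinarith [abs_nonneg (cotKernel z w), hmem w hw]
    · rw [indicator_of_notMem hw, norm_zero]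
      positivity
  have hi1 : Integrable (S.indicator (cotKernel z)) haar :=
    Integrable.of_bound hm (2 / ε) (Eventually.of_forall hb)
  have hi2 : Integrable (fun w => S.indicator (cotKernel z) w * poissonDensity r μ w) haar :=
    (integrable_circle_of_continuous (continuous_poissonDensity h0 h1 μ) haar).bdd_mul hm
      (Eventually.of_forall hb)
  -- As the cotangent has zero integral over `S`, the constant `poissonDensity r μ z` can be
  -- subtracted from the density. The difference cancels the singularity, leaving the continuous
  -- function `herglotzCross`.
  have hsub : ∫ w, (S.indicator (cotKernel z) w * poissonDensity r μ w -
      S.indicator (cotKernel z) w * poissonDensity r μ z) ∂haar =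
      ∫ w, S.indicator (cotKernel z) w * poissonDensity r μ w ∂haar := by
    rw [integral_sub hi2 (hi1.mul_const _), integral_mul_const, hz, zero_mul, sub_zero]
  rw [← hsub]
  refine integral_congr_ae (Eventually.of_forall fun w => ?_)
  by_cases hw : w ∈ S
  · simp only [indicator_of_mem hw]
    rw [← mul_sub]
    refine cotKernel_mul_poissonDensity_sub h0 h1 μ fun h => ?_
    have := hmem w hw
    rw [h, sub_self, norm_zero] at this
    exact lt_asymm hε this
  · simp only [indicator_of_notMem hw, zero_mul, sub_zero]

/-- The truncated integrals are those of a bounded function over sets that exhaust the circle up to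
the null set `{z}`, so the principal value exists and equals the full integral. -/
theorem tendsto_setIntegral_cotKernel {r : ℝ} (h0 : 0 ≤ r) (h1 : r < 1) (μ : Measure Circle)
    [IsProbabilityMeasure μ] (z : Circle) :
    Tendsto (fun ε : ℝ => ∫ w in {w : Circle | ε < ‖(z : ℂ) - w‖}, cotKernel z w
      ∂(poissonMeasure r μ)) (𝓝[>] 0) (𝓝 (herglotzIntegral r μ z).im) := by
  have hS : ∀ ε : ℝ, MeasurableSet {w : Circle | ε < ‖(z : ℂ) - w‖} := fun ε =>
    measurableSet_lt measurable_const (Continuous.measurable (by fun_prop))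
  have hkc := continuous_herglotzCross h0 h1 μ z
  obtain ⟨B, hB⟩ := isCompact_univ.exists_bound_of_continuousOn hkc.continuousOn
  have hlim : Tendsto (fun ε : ℝ =>
      ∫ w, {w : Circle | ε < ‖(z : ℂ) - w‖}.indicator (herglotzCross r μ z) w ∂haar)
      (𝓝[>] 0) (𝓝 (∫ w, herglotzCross r μ z w ∂haar)) := by
    refine tendsto_integral_filter_of_dominated_convergence (fun _ => B)
      (Eventually.of_forall fun ε => (hkc.measurable.indicator (hS ε)).aestronglyMeasurable)
      (Eventually.of_forall fun ε => Eventually.of_forall fun w => ?_) (integrable_const _) ?_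
    · exact (norm_indicator_le_norm_self _ _).trans (hB w (mem_univ w))
    · have hae : ∀ᵐ w ∂haar, w ≠ z := by
        rw [ae_iff]
        simpa using measure_singleton_eq_zero logEnergy_haar z
      filter_upwards [hae] with w hw
      have hpos : 0 < ‖(z : ℂ) - w‖ :=
        norm_pos_iff.2 (sub_ne_zero.2 fun h => hw (Circle.ext h).symm)
      refine tendsto_const_nhds.congr' ?_
      filter_upwards [Ioo_mem_nhdsGT hpos] with ε hε
      exact (indicator_of_mem (s := {w : Circle | ε < ‖(z : ℂ) - w‖}) hε.2 _).symm
  rw [integral_herglotzCross h0 h1] at hlim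
  refine hlim.congr' ?_
  filter_upwards [self_mem_nhdsWithin] with ε hε
  exact (setIntegral_cotKernel_poissonMeasure h0 h1 μ z hε (hS ε) (fun w hw => hw)
    (setIntegral_cotKernel_haar z ε)).symm

theorem hilbertTransform_poissonMeasure {r : ℝ} (h0 : 0 ≤ r) (h1 : r < 1) (μ : Measure Circle)
    [IsProbabilityMeasure μ] (z : Circle) :
    hilbertTransform (poissonMeasure r μ) z = (herglotzIntegral r μ z).im :=
  (tendsto_setIntegral_cotKernel h0 h1 μ z).limUnder_eq

/-! ### Duality between test functions and their Poisson integrals -/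

theorem sq_integral_mul_le {X : Type*} [TopologicalSpace X] [CompactSpace X] [MeasurableSpace X]
    [OpensMeasurableSpace X] [TopologicalSpace.PseudoMetrizableSpace X] (m : Measure X)
    [IsFiniteMeasure m] {f g w : X → ℝ} (hf : Continuous f) (hg : Continuous g)
    (hw : Continuous w) (hw0 : ∀ x, 0 ≤ w x) :
    (∫ x, f x * g x * w x ∂m) ^ 2 ≤ (∫ x, f x ^ 2 * w x ∂m) * ∫ x, g x ^ 2 * w x ∂m := by
  have hi : ∀ {u : X → ℝ}, Continuous u → Integrable u m := fun hu =>
    integrable_circle_of_continuous hu m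
  have h : ∀ t : ℝ, 0 ≤ (∫ x, f x ^ 2 * w x ∂m) * (t * t) +
      (2 * ∫ x, f x * g x * w x ∂m) * t + ∫ x, g x ^ 2 * w x ∂m := by
    intro t
    have e : ∫ x, (f x * t + g x) ^ 2 * w x ∂m = (∫ x, f x ^ 2 * w x ∂m) * (t * t) +
        (2 * ∫ x, f x * g x * w x ∂m) * t + ∫ x, g x ^ 2 * w x ∂m := by
      have i1 : Integrable (fun x => f x ^ 2 * w x * (t * t)) m := hi (by fun_prop)
      have i2 : Integrable (fun x => f x * g x * w x * (2 * t)) m := hi (by fun_prop)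
      have i3 : Integrable (fun x => g x ^ 2 * w x) m := hi (by fun_prop)
      have i12 : Integrable (fun x => f x ^ 2 * w x * (t * t) + f x * g x * w x * (2 * t)) m :=
        i1.add i2
      rw [show (2 * ∫ x, f x * g x * w x ∂m) * t = (∫ x, f x * g x * w x ∂m) * (2 * t) by ring,
        ← integral_mul_const, ← integral_mul_const, ← integral_add i1 i2, ← integral_add i12 i3]
      refine integral_congr_ae (Eventually.of_forall fun x => ?_)
      ring
    rw [← e]
    exact integral_nonneg fun x => mul_nonneg (sq_nonneg _) (hw0 x)
  have := discrim_le_zero h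
  rw [discrim] at this
  nlinarith

/-- The Poisson integral of `ψ`, as a function of the pole. -/
noncomputable def poissonTransform (r : ℝ) (ψ : Circle → ℝ) (s : Circle) : ℝ :=
  ∫ z, poisson r z s * ψ z ∂haar

theorem continuous_poisson_left {r : ℝ} (h0 : 0 ≤ r) (h1 : r < 1) (s : Circle) :
    Continuous fun z => poisson r z s :=
  (continuous_poisson h0 h1).comp (by fun_prop : Continuous fun z : Circle => (z, s))

/-- The Poisson kernel is Lipschitz in its pole, uniformly in `z`. Hence any continuous `ψ` becomes
an admissible direction for the first variation. -/
theorem exists_abs_poissonTransform_sub_le {r : ℝ} (h0 : 0 ≤ r) (h1 : r < 1) {ψ : Circle → ℝ}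
    (hψ : Continuous ψ) : ∃ Λ, ∀ s t : Circle,
      |poissonTransform r ψ s - poissonTransform r ψ t| ≤ Λ * ‖(s : ℂ) - t‖ := by
  obtain ⟨M, hM⟩ := isCompact_univ.exists_bound_of_continuousOn hψ.continuousOn
  refine ⟨2 / (1 - r) ^ 2 * M, fun s t => ?_⟩
  have hi : ∀ s, Integrable (fun z => poisson r z s * ψ z) haar := fun s =>
    integrable_circle_of_continuous ((continuous_poisson_left h0 h1 s).mul hψ) _
  rw [poissonTransform, poissonTransform, ← integral_sub (hi s) (hi t)]
  have h := norm_integral_le_of_norm_le_const (μ := haar)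
    (f := fun z => poisson r z s * ψ z - poisson r z t * ψ z)
    (C := 2 / (1 - r) ^ 2 * M * ‖(s : ℂ) - t‖) (Eventually.of_forall fun z => by
      rw [← sub_mul, norm_mul]
      calc ‖poisson r z s - poisson r z t‖ * ‖ψ z‖
          ≤ (2 / (1 - r) ^ 2 * ‖(s : ℂ) - t‖) * M :=
            mul_le_mul (abs_poisson_sub_le h0 h1 z s t) (hM z (mem_univ _)) (norm_nonneg _)
              (by positivity)
        _ = _ := by ring)
  simpa using h

theorem continuous_of_abs_sub_le {φ : Circle → ℝ} {Λ : ℝ}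
    (h : ∀ s t : Circle, |φ s - φ t| ≤ Λ * ‖(s : ℂ) - t‖) : Continuous φ := by
  rw [continuous_iff_continuousAt]
  intro t
  rw [ContinuousAt, tendsto_iff_dist_tendsto_zero]
  have hc : Continuous fun s : Circle => Λ * ‖(s : ℂ) - t‖ := by fun_prop
  have h2 := hc.tendsto t
  simp only [sub_self, norm_zero, mul_zero] at h2
  exact squeeze_zero (fun _ => dist_nonneg) (fun s => h s t) h2

theorem continuous_poissonTransform {r : ℝ} (h0 : 0 ≤ r) (h1 : r < 1) {ψ : Circle → ℝ}
    (hψ : Continuous ψ) : Continuous (poissonTransform r ψ) := by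
  obtain ⟨Λ, h⟩ := exists_abs_poissonTransform_sub_le h0 h1 hψ
  exact continuous_of_abs_sub_le h

theorem integral_mul_poissonTransform {r : ℝ} (h0 : 0 ≤ r) (h1 : r < 1) (μ : Measure Circle)
    [IsProbabilityMeasure μ] {f ψ : Circle → ℝ} (hf : Continuous f) (hψ : Continuous ψ) :
    ∫ s, f s * poissonTransform r ψ s ∂μ =
      ∫ p, f p.2 * ψ p.1 * poisson r p.1 p.2 ∂(haar.prod μ) := by
  have hi : Integrable (fun p : Circle × Circle => f p.2 * ψ p.1 * poisson r p.1 p.2)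
      (haar.prod μ) := integrable_circle_of_continuous (((hf.comp continuous_snd).mul
        (hψ.comp continuous_fst)).mul (continuous_poisson h0 h1)) _
  rw [integral_prod_symm _ hi]
  refine integral_congr_ae (Eventually.of_forall fun s => ?_)
  refine (integral_const_mul (f s) fun z => poisson r z s * ψ z).symm.trans ?_
  refine integral_congr_ae (Eventually.of_forall fun z => ?_)
  simp only
  ring

/-- Jensen's inequality for the probability density `z ↦ poisson r z s`: the Poisson transform is a
contraction from `L²` of the regularized measure to `L²(μ)`. -/
theorem integral_sq_poissonTransform_le {r : ℝ} (h0 : 0 ≤ r) (h1 : r < 1) (μ : Measure Circle)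
    [IsProbabilityMeasure μ] {ψ : Circle → ℝ} (hψ : Continuous ψ) :
    ∫ s, poissonTransform r ψ s ^ 2 ∂μ ≤ ∫ z, ψ z ^ 2 * poissonDensity r μ z ∂haar := by
  have hψ2 : Continuous fun z => ψ z ^ 2 := hψ.pow 2
  have h := integral_mul_poissonTransform h0 h1 μ (f := fun _ => 1) continuous_const hψ2
  simp only [one_mul] at h
  rw [integral_mul_poissonDensity h0 h1 μ hψ2, ← h]
  refine integral_mono (integrable_circle_of_continuous
    ((continuous_poissonTransform h0 h1 hψ).pow 2) _) (integrable_circle_of_continuous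
    (continuous_poissonTransform h0 h1 hψ2) _) fun s => ?_
  have h2 := sq_integral_mul_le haar (f := fun _ => 1) (g := ψ) continuous_const hψ
    (continuous_poisson_left h0 h1 s) fun z => poisson_nonneg h0 h1 z s
  simp only [one_pow, one_mul, integral_poisson h0 h1] at h2
  unfold poissonTransform
  simp_rw [mul_comm (poisson r _ s)]
  exact h2

/-- By the cotangent identity the integrand is the Haar integral of `Im (h(z, s) h(z, t)) ψ(z)`.
Integrating in `s` and `t` gives the imaginary part of the squared Herglotz integral, twice the
product of its real and imaginary parts; the factor `1 / 2` in `cotForm` removes the `2`. -/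
theorem cotForm_poissonTransform {r : ℝ} (h0 : 0 ≤ r) (h1 : r < 1) {μ : Measure Circle}
    [IsProbabilityMeasure μ] (hμ : logEnergy μ < ⊤) {ψ : Circle → ℝ} (hψ : Continuous ψ) :
    cotForm μ (poissonTransform r ψ) =
      ∫ z, (herglotzIntegral r μ z).im * poissonDensity r μ z * ψ z ∂haar := by
  let F : Circle × Circle → Circle → ℝ := fun p z =>
    (herglotz r z p.1 * herglotz r z p.2).im * ψ z
  have hHc : ∀ z, Continuous fun p : Circle × Circle => herglotz r z p.1 * herglotz r z p.2 :=
    fun z => ((continuous_herglotz_right h0 h1 z).comp continuous_fst).mul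
      ((continuous_herglotz_right h0 h1 z).comp continuous_snd)
  have hFc : Continuous (Function.uncurry F) := by
    have c1 : Continuous fun q : (Circle × Circle) × Circle => herglotz r q.2 q.1.1 :=
      (continuous_herglotz h0 h1).comp
        (by fun_prop : Continuous fun q : (Circle × Circle) × Circle => (q.2, q.1.1))
    have c2 : Continuous fun q : (Circle × Circle) × Circle => herglotz r q.2 q.1.2 :=
      (continuous_herglotz h0 h1).comp
        (by fun_prop : Continuous fun q : (Circle × Circle) × Circle => (q.2, q.1.2))
    exact (Complex.continuous_im.comp (c1.mul c2)).mul (hψ.comp continuous_snd)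
  have hstep : ∀ p : Circle × Circle, p.1 ≠ p.2 →
      cotKernel p.1 p.2 * (poissonTransform r ψ p.1 - poissonTransform r ψ p.2) =
        ∫ z, F p z ∂haar := by
    intro p hp
    have hi : ∀ s, Integrable (fun z => poisson r z s * ψ z) haar := fun s =>
      integrable_circle_of_continuous ((continuous_poisson_left h0 h1 s).mul hψ) _
    rw [poissonTransform, poissonTransform, ← integral_sub (hi _) (hi _), ← integral_const_mul]
    refine integral_congr_ae (Eventually.of_forall fun z => ?_)
    simp only [F]
    rw [← cotKernel_mul_poisson_sub h0 h1 z hp]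
    ring
  have hinner : ∀ z, ∫ p, F p z ∂(μ.prod μ) =
      2 * ((herglotzIntegral r μ z).im * poissonDensity r μ z * ψ z) := by
    intro z
    have h2 : ∫ p : Circle × Circle, (herglotz r z p.1 * herglotz r z p.2).im ∂(μ.prod μ) =
        (herglotzIntegral r μ z * herglotzIntegral r μ z).im := by
      refine (integral_im (integrable_circle_of_continuous (hHc z) (μ.prod μ))).trans ?_
      rw [integral_prod_mul]
      rfl
    simp only [F]
    rw [integral_mul_const, h2, Complex.mul_im, re_herglotzIntegral h0 h1]
    ring
  rw [cotForm]
  have hae : ∫ p, cotKernel p.1 p.2 * (poissonTransform r ψ p.1 - poissonTransform r ψ p.2)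
      ∂(μ.prod μ) = ∫ p, ∫ z, F p z ∂haar ∂(μ.prod μ) := by
    refine integral_congr_ae ?_
    filter_upwards [ae_ne_of_logEnergy_lt_top hμ] with p hp using hstep p hp
  rw [hae, integral_integral_swap (integrable_circle_of_continuous hFc _)]
  simp_rw [hinner]
  rw [integral_const_mul]
  ring

/-! ### Convergence of the regularizations -/

theorem exists_abs_le_add_mul_norm_sub_sq {G : Circle × Circle → ℝ} (hG : Continuous G)
    (hG0 : ∀ z, G (z, z) = 0) {ε : ℝ} (hε : 0 < ε) :
    ∃ C, 0 ≤ C ∧ ∀ p : Circle × Circle, |G p| ≤ ε + C * ‖(p.1 : ℂ) - p.2‖ ^ 2 := by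
  obtain ⟨M, hM⟩ := isCompact_univ.exists_bound_of_continuousOn hG.continuousOn
  have hM' : ∀ p, |G p| ≤ M := fun p => hM p (mem_univ p)
  have hM0 : 0 ≤ M := (abs_nonneg _).trans (hM' (1, 1))
  have hK : IsCompact {p | ε ≤ |G p|} := (isClosed_le continuous_const hG.abs).isCompact
  have hd : Continuous fun p : Circle × Circle => ‖(p.1 : ℂ) - p.2‖ ^ 2 := by fun_prop
  rcases {p | ε ≤ |G p|}.eq_empty_or_nonempty with hempty | hne
  · refine ⟨0, le_rfl, fun p => ?_⟩
    have : p ∉ {p | ε ≤ |G p|} := by rw [hempty]; exact notMem_empty p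
    rw [mem_ofPred_eq, not_le] at this
    linarith
  · obtain ⟨q, hq, hmin⟩ := hK.exists_isMinOn hne hd.continuousOn
    have hqpos : 0 < ‖(q.1 : ℂ) - q.2‖ ^ 2 := by
      have : q.1 ≠ q.2 := by
        intro h
        have h2 : G q = 0 := by
          have : q = (q.1, q.1) := Prod.ext rfl h.symm
          rw [this]; exact hG0 _
        rw [mem_ofPred_eq, h2, abs_zero] at hq
        linarith
      have := norm_pos_iff.2 (sub_ne_zero.2 fun h => this (Circle.ext h))
      positivity
    refine ⟨M / ‖(q.1 : ℂ) - q.2‖ ^ 2, by positivity, fun p => ?_⟩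
    by_cases hp : ε ≤ |G p|
    · have h1 : ‖(q.1 : ℂ) - q.2‖ ^ 2 ≤ ‖(p.1 : ℂ) - p.2‖ ^ 2 := hmin hp
      have h2 : M ≤ M / ‖(q.1 : ℂ) - q.2‖ ^ 2 * ‖(p.1 : ℂ) - p.2‖ ^ 2 := by
        rw [div_mul_eq_mul_div, le_div_iff₀ hqpos]
        exact mul_le_mul_of_nonneg_left h1 hM0
      linarith [hM' p]
    · have : 0 ≤ M / ‖(q.1 : ℂ) - q.2‖ ^ 2 * ‖(p.1 : ℂ) - p.2‖ ^ 2 := by positivity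
      linarith

/-- A continuous function vanishing on the diagonal is at most `ε / 2 + C |z - s|²`, and the Poisson
kernel has total mass one while its second moment tends to zero. -/
theorem tendsto_integral_mul_poisson (μ : Measure Circle) [IsProbabilityMeasure μ]
    {G : Circle × Circle → ℝ} (hG : Continuous G) (hG0 : ∀ z, G (z, z) = 0) :
    Tendsto (fun k => ∫ p, G p * poisson (radius k) p.1 p.2 ∂(haar.prod μ)) atTop (𝓝 0) := by
  rw [Metric.tendsto_nhds]
  intro ε hε
  obtain ⟨C, hC0, hC⟩ := exists_abs_le_add_mul_norm_sub_sq hG hG0 (half_pos hε)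
  have hr : Tendsto (fun k => C * ((1 - radius k ^ 2) / radius k)) atTop (𝓝 0) := by
    have h1 : Tendsto radius atTop (𝓝 1) := tendsto_radius.mono_right nhdsWithin_le_nhds
    have h2 := (((h1.pow 2).const_sub 1).div h1 one_ne_zero).const_mul C
    simpa using h2
  filter_upwards [hr.eventually_lt_const (half_pos hε)] with k hk
  have h0 := radius_pos k
  have h1 := radius_lt_one k
  have hPc := continuous_poisson h0.le h1
  have hP1 : ∫ p : Circle × Circle, poisson (radius k) p.1 p.2 ∂(haar.prod μ) = 1 := by
    have := integral_mul_poisson_right h0.le h1 μ (f := fun _ => 1) continuous_const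
    simpa using this
  rw [dist_zero_right]
  have hi1 : Integrable (fun p : Circle × Circle => ε / 2 * poisson (radius k) p.1 p.2)
      (haar.prod μ) := (integrable_circle_of_continuous hPc _).const_mul _
  have hi2 : Integrable (fun _ : Circle × Circle => C * ((1 - radius k ^ 2) / radius k))
      (haar.prod μ) := integrable_const _
  calc ‖∫ p, G p * poisson (radius k) p.1 p.2 ∂(haar.prod μ)‖
      ≤ ∫ p : Circle × Circle, (ε / 2 * poisson (radius k) p.1 p.2 +
          C * ((1 - radius k ^ 2) / radius k)) ∂(haar.prod μ) := by
        refine norm_integral_le_of_norm_le (hi1.add hi2) (Eventually.of_forall fun p => ?_)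
        have hp := poisson_nonneg h0.le h1 p.1 p.2
        rw [Real.norm_eq_abs, abs_mul, abs_of_nonneg hp]
        have h3 := mul_le_mul_of_nonneg_right (hC p) hp
        have h4 := mul_le_mul_of_nonneg_left (norm_sub_sq_mul_poisson_le h0 h1 p.1 p.2) hC0
        linarith
    _ = ε / 2 + C * ((1 - radius k ^ 2) / radius k) := by
        rw [integral_add hi1 hi2, integral_const_mul, hP1, integral_const]
        simp
    _ < ε := by linarith

/-- The Poisson regularization along the sequence `radius`. -/
noncomputable def poissonApprox (μ : ProbabilityMeasure Circle) (k : ℕ) :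
    ProbabilityMeasure Circle :=
  ⟨poissonMeasure (radius k) μ,
    isProbabilityMeasure_poissonMeasure (radius_pos k).le (radius_lt_one k) μ⟩

theorem tendsto_poissonApprox (μ : ProbabilityMeasure Circle) :
    Tendsto (poissonApprox μ) atTop (𝓝 μ) := by
  rw [ProbabilityMeasure.tendsto_iff_forall_integral_tendsto]
  intro f
  have h := tendsto_integral_mul_poisson (μ : Measure Circle)
    (G := fun p => f p.1 - f p.2)
    ((f.continuous.comp continuous_fst).sub (f.continuous.comp continuous_snd))
    (fun z => sub_self _)
  have e : ∀ k, ∫ p : Circle × Circle, (f p.1 - f p.2) * poisson (radius k) p.1 p.2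
      ∂(haar.prod (μ : Measure Circle)) =
      ∫ z, f z ∂(poissonMeasure (radius k) μ) - ∫ z, f z ∂(μ : Measure Circle) := by
    intro k
    have h0 := (radius_pos k).le
    have h1 := radius_lt_one k
    rw [integral_poissonMeasure h0 h1, integral_mul_poissonDensity h0 h1 _ f.continuous,
      ← integral_mul_poisson_right h0 h1 (μ : Measure Circle) f.continuous]
    refine Eq.trans ?_ (integral_sub (integrable_circle_of_continuous
        ((f.continuous.comp continuous_fst).mul (continuous_poisson h0 h1)) _)
      (integrable_circle_of_continuous
        ((f.continuous.comp continuous_snd).mul (continuous_poisson h0 h1)) _))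
    refine integral_congr_ae (Eventually.of_forall fun p => ?_)
    exact sub_mul _ _ _
  simp_rw [e] at h
  have h2 := h.add_const (∫ z, f z ∂(μ : Measure Circle))
  simp only [sub_add_cancel, zero_add] at h2
  exact h2

/-! ### Fisher information of the regularizations and extension of LSI -/

/-- The oscillation of `g` under the Poisson kernel. -/
noncomputable def poissonDefect (r : ℝ) (μ : Measure Circle) (g : Circle → ℝ) : ℝ :=
  ∫ p, (g p.2 - g p.1) ^ 2 * poisson r p.1 p.2 ∂(haar.prod μ)

/-- The duality formula with `ψ = 1`: constants are fixed by the Poisson transform and killed by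
`cotForm`. -/
theorem integral_im_herglotzIntegral {r : ℝ} (h0 : 0 ≤ r) (h1 : r < 1) {μ : Measure Circle}
    [IsProbabilityMeasure μ] (hμ : logEnergy μ < ⊤) :
    ∫ z, (herglotzIntegral r μ z).im ∂(poissonMeasure r μ) = 0 := by
  have h := cotForm_poissonTransform h0 h1 hμ (ψ := fun _ => 1) continuous_const
  have h2 : poissonTransform r (fun _ => 1) = fun _ => 1 := by
    funext s
    simp only [poissonTransform, mul_one]
    exact integral_poisson h0 h1 s
  rw [h2, cotForm] at h
  rw [integral_poissonMeasure h0 h1]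
  simpa using h.symm

/-- Here `κ` bounds the weak `L²(μ)` norm of the Hilbert transform minus `g - c`. Regularization
does not increase this norm, except for the defect from evaluating `g` at the other endpoint of the
Poisson kernel. -/
theorem integral_sq_mul_poissonDensity_le {r : ℝ} (h0 : 0 ≤ r) (h1 : r < 1) {μ : Measure Circle}
    [IsProbabilityMeasure μ] (hμ : logEnergy μ < ⊤) {g : Circle → ℝ} (hg : Continuous g)
    {c κ : ℝ} (hκ0 : 0 ≤ κ)
    (hκ : ∀ (φ : Circle → ℝ) (Λ : ℝ), (∀ z w : Circle, |φ z - φ w| ≤ Λ * ‖(z : ℂ) - w‖) →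
      cotForm μ φ - ∫ z, (g z - c) * φ z ∂μ ≤ κ * √(∫ z, φ z ^ 2 ∂μ)) :
    ∫ z, ((herglotzIntegral r μ z).im - g z + c) ^ 2 * poissonDensity r μ z ∂haar ≤
      (κ + √(poissonDefect r μ g)) ^ 2 := by
  have hq : Continuous fun z => (herglotzIntegral r μ z).im :=
    Complex.continuous_im.comp (continuous_herglotzIntegral h0 h1 μ)
  have hp := continuous_poissonDensity h0 h1 μ
  have hP := continuous_poisson h0 h1
  -- The function being estimated serves as its own test function. The hypothesis applied to its
  -- Poisson transform, with Cauchy–Schwarz for the defect, yields `N ≤ (κ + √defect) √N`.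
  set ψ : Circle → ℝ := fun z => (herglotzIntegral r μ z).im - g z + c with hψ
  have hψc : Continuous ψ := (hq.sub hg).add continuous_const
  obtain ⟨Λ, hΛ⟩ := exists_abs_poissonTransform_sub_le h0 h1 hψc
  have hvar := hκ _ Λ hΛ
  set N := ∫ z, ψ z ^ 2 * poissonDensity r μ z ∂haar with hN
  have hN0 : 0 ≤ N := integral_nonneg fun z =>
    mul_nonneg (sq_nonneg _) (poissonDensity_nonneg h0 h1 μ z)
  have hφN : √(∫ z, poissonTransform r ψ z ^ 2 ∂μ) ≤ √N :=
    Real.sqrt_le_sqrt (integral_sq_poissonTransform_le h0 h1 μ hψc)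
  rw [cotForm_poissonTransform h0 h1 hμ hψc, integral_mul_poissonTransform h0 h1 μ
    (f := fun z => g z - c) (hg.sub continuous_const) hψc] at hvar
  have hNeq : N = ∫ z, (herglotzIntegral r μ z).im * poissonDensity r μ z * ψ z ∂haar -
      ∫ p, (g p.1 - c) * ψ p.1 * poisson r p.1 p.2 ∂(haar.prod μ) := by
    rw [← integral_mul_poissonDensity h0 h1 μ (f := fun z => (g z - c) * ψ z)
      ((hg.sub continuous_const).mul hψc)]
    refine Eq.trans ?_ (integral_sub (integrable_circle_of_continuous ((hq.mul hp).mul hψc) _)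
      (integrable_circle_of_continuous (((hg.sub continuous_const).mul hψc).mul hp) _))
    refine integral_congr_ae (Eventually.of_forall fun z => ?_)
    simp only [hψ]
    ring
  have hg1 : Continuous fun p : Circle × Circle => g p.1 := hg.comp continuous_fst
  have hg2 : Continuous fun p : Circle × Circle => g p.2 := hg.comp continuous_snd
  have hψ1 : Continuous fun p : Circle × Circle => ψ p.1 := hψc.comp continuous_fst
  have hdiff : ∫ p, (g p.2 - c) * ψ p.1 * poisson r p.1 p.2 ∂(haar.prod μ) -
      ∫ p, (g p.1 - c) * ψ p.1 * poisson r p.1 p.2 ∂(haar.prod μ) =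
      ∫ p, (g p.2 - g p.1) * ψ p.1 * poisson r p.1 p.2 ∂(haar.prod μ) := by
    refine (integral_sub
      (integrable_circle_of_continuous (((hg2.sub continuous_const).mul hψ1).mul hP) _)
      (integrable_circle_of_continuous (((hg1.sub continuous_const).mul hψ1).mul hP) _)).symm.trans ?_
    refine integral_congr_ae (Eventually.of_forall fun p => ?_)
    simp only [Pi.mul_apply, Pi.sub_apply]
    ring
  have hcs := sq_integral_mul_le (haar.prod μ) (f := fun p => g p.2 - g p.1) (hg2.sub hg1) hψ1 hP
    fun p => poisson_nonneg h0 h1 p.1 p.2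
  rw [← integral_mul_poissonDensity h0 h1 μ (f := fun z => ψ z ^ 2) (hψc.pow 2)] at hcs
  have hcs' : ∫ p, (g p.2 - g p.1) * ψ p.1 * poisson r p.1 p.2 ∂(haar.prod μ) ≤
      √(poissonDefect r μ g) * √N := by
    rw [← Real.sqrt_mul' _ hN0]
    exact Real.le_sqrt_of_sq_le hcs
  have hle : N ≤ (κ + √(poissonDefect r μ g)) * √N := by
    have := mul_le_mul_of_nonneg_left hφN hκ0
    nlinarith
  have hs := Real.sq_sqrt hN0
  have hs0 := Real.sqrt_nonneg N
  have hfin : √N ≤ κ + √(poissonDefect r μ g) := by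
    rcases hs0.eq_or_lt with h | h
    · rw [← h]; positivity
    · have h2 : √N * √N ≤ (κ + √(poissonDefect r μ g)) * √N := by nlinarith
      exact le_of_mul_le_mul_right h2 h
  calc N = √N ^ 2 := hs.symm
    _ ≤ _ := pow_le_pow_left₀ hs0 hfin 2

/-- The Hilbert transform has mean zero, so the right side exceeds the left by exactly `(c - ∫
Q')²`, the mean taken under the regularized measure. A constant `c` independent of `r` can therefore
be used. -/
theorem fisherInfo_poissonMeasure_le {r : ℝ} (h0 : 0 ≤ r) (h1 : r < 1) {μ : Measure Circle}
    [IsProbabilityMeasure μ] (hμ : logEnergy μ < ⊤) {Q : Circle → ℝ}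
    (hg : Continuous (circleDeriv Q)) (c : ℝ) :
    fisherInfo Q (poissonMeasure r μ) ≤
      ∫ z, ((herglotzIntegral r μ z).im - circleDeriv Q z + c) ^ 2 * poissonDensity r μ z ∂haar := by
  have := isProbabilityMeasure_poissonMeasure h0 h1 μ
  have hq : Continuous fun z => (herglotzIntegral r μ z).im :=
    Complex.continuous_im.comp (continuous_herglotzIntegral h0 h1 μ)
  set g := circleDeriv Q
  set m := poissonMeasure r μ with hm
  have i1 : Integrable (fun z => ((herglotzIntegral r μ z).im - g z) ^ 2) m :=
    integrable_circle_of_continuous ((hq.sub hg).pow 2) _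
  have i2 : Integrable (fun z => (herglotzIntegral r μ z).im) m :=
    integrable_circle_of_continuous hq _
  have i3 : Integrable g m := integrable_circle_of_continuous hg _
  have i4 : Integrable (fun z => 2 * c * ((herglotzIntegral r μ z).im - g z)) m :=
    (i2.sub i3).const_mul _
  have e : ∫ z, ((herglotzIntegral r μ z).im - g z + c) ^ 2 ∂m =
      ∫ z, ((herglotzIntegral r μ z).im - g z) ^ 2 ∂m - 2 * c * ∫ z, g z ∂m + c ^ 2 := by
    calc _ = ∫ z, (((herglotzIntegral r μ z).im - g z) ^ 2 +
            2 * c * ((herglotzIntegral r μ z).im - g z) + c ^ 2) ∂m :=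
          integral_congr_ae (Eventually.of_forall fun z => by simp only; ring)
      _ = _ := by
          have i14 : Integrable (fun z => ((herglotzIntegral r μ z).im - g z) ^ 2 +
            2 * c * ((herglotzIntegral r μ z).im - g z)) m := i1.add i4
          rw [integral_add i14 (integrable_const _), integral_add i1 i4, integral_const_mul,
            integral_sub i2 i3, integral_im_herglotzIntegral h0 h1 hμ, integral_const]
          simp
          ring
  rw [← integral_poissonMeasure h0 h1 μ fun z => ((herglotzIntegral r μ z).im - g z + c) ^ 2,
    ← hm, e, fisherInfo]
  simp_rw [hm, hilbertTransform_poissonMeasure h0 h1]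
  nlinarith [sq_nonneg (c - ∫ z, g z ∂(poissonMeasure r μ))]

/-- LSI holds along the Poisson regularizations, whose Fisher information is at most `κ²` in the
limit because the defect tends to zero. Lower semicontinuity of the energy transfers the inequality
to `μ`, for which the Hilbert transform itself need not make sense. -/
theorem LSI.realEnergy_sub_le {Q : Circle → ℝ} (hQ : IsCn 1 Q) {ρ : ℝ} (hρ : 0 < ρ)
    (hLSI : LSI Q ρ) {μ : Measure Circle} [IsProbabilityMeasure μ] (hμ : logEnergy μ < ⊤)
    {c κ : ℝ} (hκ0 : 0 ≤ κ)
    (hκ : ∀ (φ : Circle → ℝ) (Λ : ℝ), (∀ z w : Circle, |φ z - φ w| ≤ Λ * ‖(z : ℂ) - w‖) →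
      cotForm μ φ - ∫ z, (circleDeriv Q z - c) * φ z ∂μ ≤ κ * √(∫ z, φ z ^ 2 ∂μ)) :
    realEnergy Q μ - realEnergy Q (equilibriumMeasure Q) ≤ 1 / (4 * ρ) * κ ^ 2 := by
  have hmin := isEnergyMinimizer_equilibriumMeasure hQ.continuous
  have := hmin.1
  have hg := hQ.continuous_circleDeriv
  set e := realEnergy Q (equilibriumMeasure Q) with he
  have hbound : ∀ k, energy Q (poissonMeasure (radius k) μ) ≤
      ((e + 1 / (4 * ρ) * (κ + √(poissonDefect (radius k) μ (circleDeriv Q))) ^ 2 : ℝ) : EReal) := by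
    intro k
    have h0 := (radius_pos k).le
    have h1 := radius_lt_one k
    have h2 := hLSI _ (isSmoothProbability_poissonMeasure h0 h1 μ)
    rw [energy_eq_realEnergy Q hmin.logEnergy_lt_top, ← he] at h2
    have h3 := EReal.sub_le_iff_le_add (Or.inl (EReal.coe_ne_bot e))
      (Or.inl (EReal.coe_ne_top e)) |>.1 h2
    refine h3.trans ?_
    rw [← EReal.coe_add, EReal.coe_le_coe_iff, add_comm]
    have h4 := (fisherInfo_poissonMeasure_le h0 h1 hμ hg c).trans
      (integral_sq_mul_poissonDensity_le h0 h1 hμ hg hκ0 hκ)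
    gcongr
  have hdef : Tendsto (fun k => poissonDefect (radius k) μ (circleDeriv Q)) atTop (𝓝 0) :=
    tendsto_integral_mul_poisson μ (G := fun p => (circleDeriv Q p.2 - circleDeriv Q p.1) ^ 2)
      (((hg.comp continuous_snd).sub (hg.comp continuous_fst)).pow 2) (fun z => by simp)
  have hlim : Tendsto (fun k => ((e + 1 / (4 * ρ) *
      (κ + √(poissonDefect (radius k) μ (circleDeriv Q))) ^ 2 : ℝ) : EReal)) atTop
      (𝓝 ((e + 1 / (4 * ρ) * κ ^ 2 : ℝ) : EReal)) := by
    refine (continuous_coe_real_ereal.tendsto _).comp ?_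
    have h5 := ((((Real.continuous_sqrt.tendsto 0).comp hdef).const_add κ).pow 2).const_mul
      (1 / (4 * ρ)) |>.const_add e
    simpa using h5
  have hfin : energy Q μ ≤ ((e + 1 / (4 * ρ) * κ ^ 2 : ℝ) : EReal) := by
    by_contra! hlt
    obtain ⟨y, hy1, hy2⟩ := exists_between hlt
    have h5 := (tendsto_poissonApprox ⟨μ, inferInstance⟩).eventually
      (lowerSemicontinuous_energy hQ.continuous ⟨μ, inferInstance⟩ y hy2)
    obtain ⟨k, h6, h7⟩ := (h5.and (hlim.eventually_lt_const hy1)).exists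
    exact absurd ((hbound k).trans_lt h7) h6.not_gt
  rw [energy_eq_realEnergy Q hμ, EReal.coe_le_coe_iff] at hfin
  linarith

/-! ### Oscillation of lifted perturbations -/

theorem norm_exp_sub_exp_le (a b : ℝ) :
    ‖(Circle.exp a : ℂ) - Circle.exp b‖ ≤ |a - b| := by
  have e : (Circle.exp a : ℂ) - Circle.exp b =
      Circle.exp b * (Complex.exp (Complex.I * (a - b : ℝ)) - 1) := by
    rw [Circle.coe_exp, Circle.coe_exp, mul_sub, ← Complex.exp_add]
    congr 2
    · push_cast; ring
    · ring
  rw [e, norm_mul, Circle.norm_coe, one_mul]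
  exact Real.norm_exp_I_mul_ofReal_sub_one_le

theorem norm_exp_sub_exp_le_two_pi_sub {a b : ℝ} (h : |a - b| ≤ 2 * Real.pi) :
    ‖(Circle.exp a : ℂ) - Circle.exp b‖ ≤ 2 * Real.pi - |a - b| := by
  wlog hab : b ≤ a generalizing a b
  · rw [norm_sub_rev, abs_sub_comm]
    exact this (by rwa [abs_sub_comm]) (le_of_not_ge hab)
  have h1 := norm_exp_sub_exp_le a (b + 2 * Real.pi)
  rw [Circle.exp_add_two_pi] at h1
  rw [abs_of_nonneg (by linarith : 0 ≤ a - b)] at h ⊢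
  rw [abs_of_nonpos (by linarith)] at h1
  linarith

/-- The displacement depends only on the point of the circle, so it is Lipschitz in the chord, which
is at most both `|a - b|` and `2π - |a - b|`. Hence neither the ordering nor the window of length
`2π` is violated. -/
theorem abs_add_mul_sub_le_two_pi {φ : Circle → ℝ} {Λ : ℝ}
    (hΛ : ∀ z w : Circle, |φ z - φ w| ≤ Λ * ‖(z : ℂ) - w‖) {t : ℝ} (ht : 0 ≤ t) (htΛ : t * Λ ≤ 1)
    (htΛ0 : 0 ≤ t * Λ) {a b : ℝ} (h : |a - b| ≤ 2 * Real.pi) :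
    |(a + t * φ (Circle.exp a)) - (b + t * φ (Circle.exp b))| ≤ 2 * Real.pi := by
  wlog hab : b ≤ a generalizing a b
  · rw [abs_sub_comm]
    exact this (by rwa [abs_sub_comm]) (le_of_not_ge hab)
  have h1 := norm_exp_sub_exp_le a b
  have h2 := norm_exp_sub_exp_le_two_pi_sub h
  rw [abs_of_nonneg (by linarith : 0 ≤ a - b)] at h h1 h2
  have h3 := mul_le_mul_of_nonneg_left (hΛ (Circle.exp a) (Circle.exp b)) ht
  have h4 : t * |φ (Circle.exp a) - φ (Circle.exp b)| ≤ t * Λ * (a - b) := by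
    have := mul_le_mul_of_nonneg_left h1 htΛ0
    linarith
  have h5 : t * |φ (Circle.exp a) - φ (Circle.exp b)| ≤ t * Λ * (2 * Real.pi - (a - b)) := by
    have := mul_le_mul_of_nonneg_left h2 htΛ0
    linarith
  have h6 := abs_le.1 (le_refl |φ (Circle.exp a) - φ (Circle.exp b)|)
  have h7 : t * Λ * (a - b) ≤ a - b := mul_le_of_le_one_left (by linarith) htΛ
  have h8 : t * Λ * (2 * Real.pi - (a - b)) ≤ 2 * Real.pi - (a - b) :=
    mul_le_of_le_one_left (by linarith) htΛ
  have h9 := mul_le_mul_of_nonneg_left h6.1 ht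
  have h10 := mul_le_mul_of_nonneg_left h6.2 ht
  rw [abs_le]
  constructor <;> linarith [Real.pi_pos]

/-! ### The space of competitors in `L²` -/

/-- The law on the circle of `e^{iY}`. -/
noncomputable def circleLaw {Ω : Type*} [MeasurableSpace Ω] (μ : Measure Ω)
    [IsProbabilityMeasure μ] (Y : Lp ℝ 2 μ) : ProbabilityMeasure Circle :=
  ⟨μ.map fun o => Circle.exp (Y o), Measure.isProbabilityMeasure_map
    (measurable_circleExp.comp_aemeasurable (Lp.aestronglyMeasurable Y).aemeasurable)⟩

theorem continuous_circleLaw {Ω : Type*} [MeasurableSpace Ω] (μ : Measure Ω)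
    [IsProbabilityMeasure μ] : Continuous (circleLaw μ) := by
  rw [continuous_iff_seqContinuous]
  intro Y Z hYZ
  have h := (tendstoInMeasure_of_tendsto_Lp hYZ).tendstoInDistribution
    fun n => (Lp.aestronglyMeasurable (Y n)).aemeasurable
  exact (h.continuous_comp Circle.exp.continuous).tendsto

theorem continuous_integral_Lp {Ω : Type*} [MeasurableSpace Ω] (μ : Measure Ω)
    [IsProbabilityMeasure μ] : Continuous fun Y : Lp ℝ 2 μ => ∫ o, Y o ∂μ := by
  have h : (fun Y : Lp ℝ 2 μ => ∫ o, Y o ∂μ) = fun Y : Lp ℝ 2 μ =>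
      inner ℝ (indicatorConstLp 2 MeasurableSet.univ (measure_ne_top μ _) (1 : ℝ)) Y := by
    funext Y
    rw [L2.inner_indicatorConstLp_one, setIntegral_univ]
  rw [h]
  fun_prop

theorem isClosed_setOf_ae_abs_sub_le {Ω : Type*} [MeasurableSpace Ω] (μ : Measure Ω)
    [IsProbabilityMeasure μ] (C : ℝ) :
    IsClosed {Y : Lp ℝ 2 μ | ∀ᵐ p ∂(μ.prod μ), |Y p.1 - Y p.2| ≤ C} := by
  refine IsSeqClosed.isClosed fun Y Z hY hYZ => ?_
  obtain ⟨ns, -, hns⟩ := (tendstoInMeasure_of_tendsto_Lp hYZ).exists_seq_tendsto_ae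
  have h1 := (Measure.quasiMeasurePreserving_fst (μ := μ) (ν := μ)).ae hns
  have h2 := (Measure.quasiMeasurePreserving_snd (μ := μ) (ν := μ)).ae hns
  have h3 : ∀ᵐ p ∂(μ.prod μ), ∀ n, |Y n p.1 - Y n p.2| ≤ C := ae_all_iff.2 fun n => hY n
  rw [mem_ofPred_eq]
  filter_upwards [h1, h2, h3] with p hp1 hp2 hp3
  exact le_of_tendsto' (hp1.sub hp2).abs fun n => hp3 _

theorem realEnergy_equilibriumMeasure_le {Q : Circle → ℝ} (hQ : Continuous Q) {μ : Measure Circle}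
    [IsProbabilityMeasure μ] (hμ : logEnergy μ < ⊤) :
    realEnergy Q (equilibriumMeasure Q) ≤ realEnergy Q μ := by
  have hmin := isEnergyMinimizer_equilibriumMeasure hQ
  have := hmin.1
  have h := hmin.2 μ inferInstance
  rwa [energy_eq_realEnergy Q hmin.logEnergy_lt_top, energy_eq_realEnergy Q hμ,
    EReal.coe_le_coe_iff] at h

theorem eq_equilibriumMeasure_of_realEnergy_le {Q : Circle → ℝ} (hQ : Continuous Q)
    {μ : Measure Circle} [IsProbabilityMeasure μ] (hμ : logEnergy μ < ⊤)
    (h : realEnergy Q μ ≤ realEnergy Q (equilibriumMeasure Q)) : μ = equilibriumMeasure Q := by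
  have hmin := isEnergyMinimizer_equilibriumMeasure hQ
  have := hmin.1
  refine IsEnergyMinimizer.unique hQ ⟨inferInstance, fun ν hν => ?_⟩ hmin
  refine le_trans ?_ (hmin.2 ν hν)
  rwa [energy_eq_realEnergy Q hmin.logEnergy_lt_top, energy_eq_realEnergy Q hμ,
    EReal.coe_le_coe_iff]

/-- The random variables `Y` in `L²(μ)` with mean `m` and oscillation at most `2π` whose law on
the circle has energy at most `E`. -/
def competitors {Ω : Type*} [MeasurableSpace Ω] (μ : Measure Ω) [IsProbabilityMeasure μ]
    (Q : Circle → ℝ) (m E : ℝ) : Set (Lp ℝ 2 μ) :=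
  {Y | (∀ᵐ p ∂(μ.prod μ), |Y p.1 - Y p.2| ≤ 2 * Real.pi) ∧ ∫ o, Y o ∂μ = m ∧
    energy Q (circleLaw μ Y) ≤ E}

theorem isClosed_competitors {Ω : Type*} [MeasurableSpace Ω] (μ : Measure Ω)
    [IsProbabilityMeasure μ] {Q : Circle → ℝ} (hQ : Continuous Q) (m E : ℝ) :
    IsClosed (competitors μ Q m E) := by
  refine (isClosed_setOf_ae_abs_sub_le μ _).inter (IsClosed.inter ?_ ?_)
  · exact isClosed_eq (continuous_integral_Lp μ) continuous_const
  · exact ((lowerSemicontinuous_energy hQ).comp (continuous_circleLaw μ)).isClosed_preimage _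

theorem logEnergy_lt_top_of_mem_competitors {Ω : Type*} [MeasurableSpace Ω] {μ : Measure Ω}
    [IsProbabilityMeasure μ] {Q : Circle → ℝ} {m E : ℝ} {Y : Lp ℝ 2 μ}
    (hY : Y ∈ competitors μ Q m E) : logEnergy (circleLaw μ Y : Measure Circle) < ⊤ :=
  logEnergy_lt_top_of_energy (hY.2.2.trans_lt (EReal.coe_lt_top E))

/-- Sublevel sets at negative heights are empty; the others are sublevel sets of the extended-valued
energy, which agrees with `realEnergy` on competitors. -/
theorem lowerSemicontinuous_sqrt_realEnergy {Ω : Type*} [MeasurableSpace Ω] (μ : Measure Ω)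
    [IsProbabilityMeasure μ] {Q : Circle → ℝ} (hQ : Continuous Q) (m E e : ℝ) :
    LowerSemicontinuous fun Y : competitors μ Q m E =>
      √(realEnergy Q (circleLaw μ (Y : Lp ℝ 2 μ)) - e) := by
  rw [lowerSemicontinuous_iff_isClosed_preimage]
  intro y
  rcases lt_or_ge y 0 with hy | hy
  · convert isClosed_empty
    rw [eq_empty_iff_forall_notMem]
    intro Y hY
    exact absurd (hY.trans_lt hy) (Real.sqrt_nonneg _).not_gt
  · have h := (((lowerSemicontinuous_energy hQ).comp (continuous_circleLaw μ)).comp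
      (continuous_subtype_val (p := (· ∈ competitors μ Q m E)))).isClosed_preimage
        ((e + y ^ 2 : ℝ) : EReal)
    convert h using 1
    ext Y
    simp only [mem_preimage, mem_Iic, Function.comp]
    rw [energy_eq_realEnergy Q (logEnergy_lt_top_of_mem_competitors Y.2), EReal.coe_le_coe_iff,
      Real.sqrt_le_left hy, sub_le_iff_le_add, add_comm]

theorem coe_circleLaw {Ω : Type*} [MeasurableSpace Ω] (μ : Measure Ω)
    [IsProbabilityMeasure μ] (Y : Lp ℝ 2 μ) :
    (circleLaw μ Y : Measure Circle) = μ.map fun o => Circle.exp (Y o) := rfl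

theorem aemeasurable_exp_Lp {Ω : Type*} [MeasurableSpace Ω] {μ : Measure Ω}
    (Y : Lp ℝ 2 μ) : AEMeasurable (fun o => Circle.exp (Y o)) μ :=
  measurable_circleExp.comp_aemeasurable (Lp.aestronglyMeasurable Y).aemeasurable

theorem memLp_comp_exp {Ω : Type*} [MeasurableSpace Ω] {μ : Measure Ω}
    [IsProbabilityMeasure μ] {φ : Circle → ℝ} (hφ : Continuous φ) (Y : Lp ℝ 2 μ) :
    MemLp (fun o => φ (Circle.exp (Y o))) 2 μ := by
  obtain ⟨C, hC⟩ := isCompact_univ.exists_bound_of_continuousOn hφ.continuousOn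
  refine MemLp.of_bound (hφ.measurable.comp_aemeasurable
    (aemeasurable_exp_Lp Y)).aestronglyMeasurable C (Eventually.of_forall fun o => hC _ (mem_univ _))

theorem circleLaw_add_smul {Ω : Type*} [MeasurableSpace Ω] {μ : Measure Ω}
    [IsProbabilityMeasure μ] {φ : Circle → ℝ} (hφ : Continuous φ) (Y : Lp ℝ 2 μ) (t : ℝ) :
    (circleLaw μ (Y + t • (memLp_comp_exp hφ Y).toLp _) : Measure Circle) =
      (circleLaw μ Y : Measure Circle).map (flow φ t) := by
  rw [coe_circleLaw, coe_circleLaw, AEMeasurable.map_map_of_aemeasurable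
    (continuous_flow hφ t).aemeasurable (aemeasurable_exp_Lp Y)]
  refine Measure.map_congr ?_
  filter_upwards [Lp.coeFn_add Y (t • (memLp_comp_exp hφ Y).toLp _),
    Lp.coeFn_smul t ((memLp_comp_exp hφ Y).toLp _), (memLp_comp_exp hφ Y).coeFn_toLp]
    with o h1 h2 h3
  rw [h1, Pi.add_apply, h2, Pi.smul_apply, h3, Circle.exp_add]
  rfl

theorem norm_toLp_comp_exp {Ω : Type*} [MeasurableSpace Ω] {μ : Measure Ω}
    [IsProbabilityMeasure μ] {φ : Circle → ℝ} (hφ : Continuous φ) (Y : Lp ℝ 2 μ) :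
    ‖(memLp_comp_exp hφ Y).toLp _‖ = √(∫ z, φ z ^ 2 ∂(circleLaw μ Y : Measure Circle)) := by
  rw [coe_circleLaw, integral_map (aemeasurable_exp_Lp Y)
    (by fun_prop : Continuous fun z => φ z ^ 2).aestronglyMeasurable, ← Real.sqrt_sq (norm_nonneg _)]
  congr 1
  rw [← real_inner_self_eq_norm_sq, L2.inner_def]
  refine integral_congr_ae ?_
  filter_upwards [(memLp_comp_exp hφ Y).coeFn_toLp] with o h
  rw [h, real_inner_self_eq_norm_sq, Real.norm_eq_abs, sq_abs]

/-- Adding `t φ(e^{iY})` keeps the mean because `φ` is centred, keeps the oscillation once `t Λ <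
1`, and does not raise the energy because `a ≤ 0`. -/
theorem eventually_add_smul_mem_competitors {Ω : Type*} [MeasurableSpace Ω] {μ : Measure Ω}
    [IsProbabilityMeasure μ] {Q : Circle → ℝ} (hQ : IsCn 1 Q) {m E : ℝ} {Y : Lp ℝ 2 μ}
    (hY : Y ∈ competitors μ Q m E) {φ : Circle → ℝ} (hφ : Continuous φ) {Λ : ℝ}
    (hΛ : ∀ z w : Circle, |φ z - φ w| ≤ Λ * ‖(z : ℂ) - w‖)
    (hφ0 : ∫ z, φ z ∂(circleLaw μ Y : Measure Circle) = 0) {a : ℝ} (ha0 : a ≤ 0)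
    (ha : firstVariation Q (circleLaw μ Y) φ < a) :
    ∀ᶠ t in 𝓝[>] (0 : ℝ), Y + t • (memLp_comp_exp hφ Y).toLp _ ∈ competitors μ Q m E ∧
      realEnergy Q (circleLaw μ (Y + t • (memLp_comp_exp hφ Y).toLp _)) ≤
        realEnergy Q (circleLaw μ Y) + t * a := by
  have hlog := logEnergy_lt_top_of_mem_competitors hY
  have hΛ0 : 0 ≤ Λ := by
    have h := (abs_nonneg _).trans (hΛ 1 (Circle.exp Real.pi))
    rw [Circle.coe_one, Circle.coe_exp, Complex.exp_pi_mul_I] at h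
    norm_num at h
    exact h
  have h1 : ∀ᶠ t in 𝓝[>] (0 : ℝ), t * Λ < 1 := by
    refine nhdsWithin_le_nhds ?_
    have : Tendsto (fun t : ℝ => t * Λ) (𝓝 0) (𝓝 (0 * Λ)) := tendsto_id.mul_const Λ
    rw [zero_mul] at this
    exact this.eventually_lt_const one_pos
  filter_upwards [eventually_realEnergy_map_flow_le hQ hlog hφ hΛ ha, h1, self_mem_nhdsWithin]
    with t ht htΛ ht0
  have ht0 : 0 < t := ht0
  have key : realEnergy Q (circleLaw μ (Y + t • (memLp_comp_exp hφ Y).toLp _)) ≤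
        realEnergy Q (circleLaw μ Y) + t * a := by
    rw [circleLaw_add_smul hφ]
    exact ht.2
  refine ⟨⟨?_, ?_, ?_⟩, key⟩
  · have h2 : ∀ᵐ o ∂μ, (Y + t • (memLp_comp_exp hφ Y).toLp _ : Lp ℝ 2 μ) o =
        Y o + t * φ (Circle.exp (Y o)) := by
      filter_upwards [Lp.coeFn_add Y (t • (memLp_comp_exp hφ Y).toLp _),
        Lp.coeFn_smul t ((memLp_comp_exp hφ Y).toLp _), (memLp_comp_exp hφ Y).coeFn_toLp]
        with o h1 h2 h3
      rw [h1, Pi.add_apply, h2, Pi.smul_apply, h3, smul_eq_mul]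
    filter_upwards [hY.1, (Measure.quasiMeasurePreserving_fst (μ := μ) (ν := μ)).ae h2,
      (Measure.quasiMeasurePreserving_snd (μ := μ) (ν := μ)).ae h2] with p hp h3 h4
    rw [h3, h4]
    exact abs_add_mul_sub_le_two_pi hΛ ht0.le htΛ.le (by positivity) hp
  · have h2 : ∫ o, φ (Circle.exp (Y o)) ∂μ = 0 := by
      rw [← hφ0, coe_circleLaw, integral_map (aemeasurable_exp_Lp Y) hφ.aestronglyMeasurable]
    have h3 : ∫ o, ((memLp_comp_exp hφ Y).toLp _ : Lp ℝ 2 μ) o ∂μ = 0 := by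
      rw [← h2]
      exact integral_congr_ae (memLp_comp_exp hφ Y).coeFn_toLp
    have hi : ∀ Z : Lp ℝ 2 μ, Integrable Z μ := fun Z =>
      (Lp.memLp Z).integrable (by norm_num)
    rw [integral_congr_ae (Lp.coeFn_add Y _)]
    refine (integral_add (hi _) (hi _)).trans ?_
    rw [integral_congr_ae (Lp.coeFn_smul t _)]
    refine (congrArg _ (integral_const_mul t _)).trans ?_
    rw [h3, mul_zero, add_zero]
    exact hY.2.1
  · have h5 : logEnergy (circleLaw μ (Y + t • (memLp_comp_exp hφ Y).toLp _) : Measure Circle) < ⊤ := by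
      rw [circleLaw_add_smul hφ]
      exact ht.1
    have h6 := hY.2.2
    rw [energy_eq_realEnergy Q hlog, EReal.coe_le_coe_iff] at h6
    rw [energy_eq_realEnergy Q h5, EReal.coe_le_coe_iff]
    nlinarith [mul_nonneg ht0.le (neg_nonneg.2 ha0)]

/-! ### Slope at the Ekeland point and the resulting transport -/

/-- Chain rule for `√F`: if `√F` decreases at rate at most `ε` per unit of `L²` distance, then `F`
decreases at rate at most `2ε√F`. -/
theorem neg_two_mul_le_firstVariation {Ω : Type*} [MeasurableSpace Ω] {μ : Measure Ω}
    [IsProbabilityMeasure μ] {Q : Circle → ℝ} (hQ : IsCn 1 Q) {m E : ℝ} {Y : Lp ℝ 2 μ}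
    (hY : Y ∈ competitors μ Q m E) {ε : ℝ} (hε : 0 < ε)
    (hpos : 0 < realEnergy Q (circleLaw μ Y) - realEnergy Q (equilibriumMeasure Q))
    (hmin : ∀ Z ∈ competitors μ Q m E,
      √(realEnergy Q (circleLaw μ Y) - realEnergy Q (equilibriumMeasure Q)) ≤
        √(realEnergy Q (circleLaw μ Z) - realEnergy Q (equilibriumMeasure Q)) + ε * dist Y Z)
    {φ : Circle → ℝ} {Λ : ℝ} (hΛ : ∀ z w : Circle, |φ z - φ w| ≤ Λ * ‖(z : ℂ) - w‖)
    (hφ0 : ∫ z, φ z ∂(circleLaw μ Y : Measure Circle) = 0) :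
    -(2 * ε * √(realEnergy Q (circleLaw μ Y) - realEnergy Q (equilibriumMeasure Q)) *
      √(∫ z, φ z ^ 2 ∂(circleLaw μ Y : Measure Circle))) ≤ firstVariation Q (circleLaw μ Y) φ := by
  have hφ := continuous_of_abs_sub_le hΛ
  set e := realEnergy Q (equilibriumMeasure Q)
  set F := realEnergy Q (circleLaw μ Y) - e with hF
  set n := √(∫ z, φ z ^ 2 ∂(circleLaw μ Y : Measure Circle)) with hn
  have hn0 : 0 ≤ n := Real.sqrt_nonneg _
  have hs0 : 0 < √F := Real.sqrt_pos.2 hpos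
  by_contra! hlt
  obtain ⟨a, ha1, ha2⟩ := exists_between hlt
  have ha0 : a ≤ 0 := ha2.le.trans (neg_nonpos.2 (by positivity))
  have hsmall : ∀ᶠ t in 𝓝[>] (0 : ℝ), ε * (t * n) < √F := by
    refine nhdsWithin_le_nhds ?_
    have : Tendsto (fun t : ℝ => ε * (t * n)) (𝓝 0) (𝓝 (ε * (0 * n))) :=
      (tendsto_id.mul_const n).const_mul ε
    rw [zero_mul, mul_zero] at this
    exact this.eventually_lt_const hs0
  obtain ⟨t, ⟨⟨hZ, hZE⟩, hts⟩, ht0⟩ := (((eventually_add_smul_mem_competitors hQ hY hφ hΛ hφ0 ha0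
    ha1).and hsmall).and self_mem_nhdsWithin).exists
  have ht0 : 0 < t := ht0
  set Z := Y + t • (memLp_comp_exp hφ Y).toLp _ with hZdef
  have hdist : dist Y Z = t * n := by
    rw [dist_eq_norm, hZdef, sub_add_cancel_left, norm_neg, norm_smul, norm_toLp_comp_exp hφ,
      Real.norm_eq_abs, abs_of_pos ht0]
  have h1 := hmin Z hZ
  rw [hdist] at h1
  have h2 : √(realEnergy Q (circleLaw μ Z) - e) ≤ √(F + t * a) :=
    Real.sqrt_le_sqrt (by rw [hF]; linarith)
  have h3 : 0 ≤ F + t * a := by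
    have := realEnergy_equilibriumMeasure_le hQ.continuous
      (logEnergy_lt_top_of_mem_competitors hZ)
    rw [hF]
    linarith
  -- The restriction to `t` with `ε t n < √F` makes squaring legitimate. Expanding and dropping `(ε
  -- t n)²` gives `a ≥ -2ε√F n`, against the choice of `a`.
  have h4 : (√F - ε * (t * n)) ^ 2 ≤ F + t * a := by
    rw [← Real.sq_sqrt h3]
    exact pow_le_pow_left₀ (by linarith) (by linarith) 2
  have h5 := Real.sq_sqrt hpos.le
  have h6 : 0 ≤ t * (a + 2 * ε * √F * n) := by nlinarith [sq_nonneg (ε * (t * n))]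
  have h7 := nonneg_of_mul_nonneg_right h6 ht0
  linarith

theorem cotForm_sub_const (μ : Measure Circle) (φ : Circle → ℝ) (c : ℝ) :
    cotForm μ (fun z => φ z - c) = cotForm μ φ := by
  simp only [cotForm, sub_sub_sub_cancel_right]

theorem integral_sub_integral_sq_le {Ω : Type*} [MeasurableSpace Ω] {μ : Measure Ω}
    [IsProbabilityMeasure μ] {φ : Ω → ℝ} (h1 : Integrable φ μ)
    (h2 : Integrable (fun o => φ o ^ 2) μ) :
    ∫ o, (φ o - ∫ x, φ x ∂μ) ^ 2 ∂μ ≤ ∫ o, φ o ^ 2 ∂μ := by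
  set c := ∫ x, φ x ∂μ with hc
  have e : ∀ o, (φ o - c) ^ 2 = φ o ^ 2 - (2 * c * φ o - c ^ 2) := fun o => by ring
  simp_rw [e]
  refine (integral_sub h2 ((h1.const_mul _).sub (integrable_const _))).trans_le ?_
  have e2 : ∫ o, (2 * c * φ o - c ^ 2) ∂μ = c ^ 2 := by
    refine (integral_sub (h1.const_mul _) (integrable_const _)).trans ?_
    rw [integral_const_mul, ← hc, integral_const, probReal_univ, one_smul]
    ring
  refine (sub_le_self _ ?_)
  exact (sq_nonneg c).trans_eq e2.symm

/-- Under `LSI(ρ)` the law of a random variable on the circle can be transported, through a real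
valued transport preserving the mean and the oscillation bound, to the equilibrium measure at
quadratic cost at most the excess energy divided by `ε²`, for every `ε² < ρ`. -/
theorem LSI.exists_transport {Q : Circle → ℝ} (hQ : IsCn 1 Q) {ρ : ℝ} (hρ : 0 < ρ)
    (hLSI : LSI Q ρ) {Ω : Type*} [MeasurableSpace Ω] {μ : Measure Ω} [IsProbabilityMeasure μ]
    {X : Lp ℝ 2 μ} (hX : ∀ᵐ p ∂(μ.prod μ), |X p.1 - X p.2| ≤ 2 * Real.pi)
    (hlog : logEnergy (circleLaw μ X : Measure Circle) < ⊤) {ε : ℝ} (hε : 0 < ε)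
    (hερ : ε ^ 2 < ρ) :
    ∃ Y : Lp ℝ 2 μ, (∀ᵐ p ∂(μ.prod μ), |Y p.1 - Y p.2| ≤ 2 * Real.pi) ∧
      ∫ o, Y o ∂μ = ∫ o, X o ∂μ ∧ (circleLaw μ Y : Measure Circle) = equilibriumMeasure Q ∧
      ε * dist X Y ≤ √(realEnergy Q (circleLaw μ X) - realEnergy Q (equilibriumMeasure Q)) := by
  set m := ∫ o, X o ∂μ
  set E := realEnergy Q (circleLaw μ X)
  set e := realEnergy Q (equilibriumMeasure Q) with he
  have hXmem : X ∈ competitors μ Q m E := ⟨hX, rfl, (energy_eq_realEnergy Q hlog).le⟩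
  have : CompleteSpace (competitors μ Q m E) :=
    (isClosed_competitors μ hQ.continuous m E).completeSpace_coe
  obtain ⟨⟨Y, hY⟩, hY1, hY2⟩ := exists_ekeland_point
    (lowerSemicontinuous_sqrt_realEnergy μ hQ.continuous m E e) (fun _ => Real.sqrt_nonneg _)
    ⟨X, hXmem⟩ hε
  have hlogY := logEnergy_lt_top_of_mem_competitors hY
  refine ⟨Y, hY.1, hY.2.1, ?_, ?_⟩
  · refine eq_equilibriumMeasure_of_realEnergy_le hQ.continuous hlogY ?_
    by_contra! hlt
    have hpos : 0 < realEnergy Q (circleLaw μ Y) - e := sub_pos.2 hlt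
    have hfv := fun (φ : Circle → ℝ) (Λ : ℝ) => neg_two_mul_le_firstVariation hQ hY hε hpos
      (fun Z hZ => hY2 ⟨Z, hZ⟩) (φ := φ) (Λ := Λ)
    set η : Measure Circle := (circleLaw μ Y : Measure Circle) with hη
    set F := realEnergy Q η - e with hF
    -- The constant `c` is the Lagrange multiplier of the mean constraint: with this choice the
    -- tested expression depends on `φ` only through its centring.
    have key := hLSI.realEnergy_sub_le hQ hρ hlogY (c := ∫ z, circleDeriv Q z ∂η)
      (κ := 2 * ε * √F) (by positivity) ?_
    · rw [← he, ← hF, mul_pow, Real.sq_sqrt hpos.le, mul_pow] at key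
      have h1 : 1 / (4 * ρ) * (2 ^ 2 * ε ^ 2 * F) = ε ^ 2 / ρ * F := by
        field_simp
        ring
      rw [h1] at key
      have h2 : ε ^ 2 / ρ < 1 := (div_lt_one hρ).2 hερ
      have h3 := mul_lt_mul_of_pos_right h2 hpos
      linarith
    · intro φ Λ hΛ
      have hφ := continuous_of_abs_sub_le hΛ
      have hφi := integrable_circle_of_continuous hφ η
      have hQ' := hQ.continuous_circleDeriv
      have hm : ∫ z, (φ z - ∫ w, φ w ∂η) ∂η = 0 := by
        refine (integral_sub hφi (integrable_const _)).trans ?_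
        rw [integral_const, probReal_univ, one_smul, sub_self]
      have h := hfv (fun z => φ z - ∫ w, φ w ∂η) Λ
        (fun z w => by rw [sub_sub_sub_cancel_right]; exact hΛ z w) hm
      -- The slope bound is known only for centred directions; centring `φ` does not increase its
      -- `L²` norm.
      have hsq : √(∫ z, (φ z - ∫ w, φ w ∂η) ^ 2 ∂η) ≤ √(∫ z, φ z ^ 2 ∂η) :=
        Real.sqrt_le_sqrt (integral_sub_integral_sq_le hφi
          (integrable_circle_of_continuous (hφ.pow 2) η))
      have h2 := mul_le_mul_of_nonneg_left hsq (by positivity : 0 ≤ 2 * ε * √F)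
      have hQi := integrable_circle_of_continuous hQ' η
      have hQφ := integrable_circle_of_continuous (hQ'.mul hφ) η
      have e1 : ∫ z, (circleDeriv Q z - ∫ w, circleDeriv Q w ∂η) * φ z ∂η =
          ∫ z, circleDeriv Q z * φ z ∂η - (∫ w, circleDeriv Q w ∂η) * ∫ w, φ w ∂η := by
        simp_rw [sub_mul]
        refine (integral_sub hQφ (hφi.const_mul _)).trans ?_
        rw [integral_const_mul]
        rfl
      have e2 : firstVariation Q η (fun z => φ z - ∫ w, φ w ∂η) =
          ∫ z, circleDeriv Q z * φ z ∂η - (∫ w, circleDeriv Q w ∂η) * (∫ w, φ w ∂η) -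
            cotForm η φ := by
        rw [firstVariation, cotForm_sub_const]
        simp_rw [mul_sub]
        congr 1
        refine (integral_sub hQφ (hQi.mul_const _)).trans ?_
        rw [integral_mul_const]
        rfl
      rw [e2] at h
      rw [e1]
      linarith
  · have h := hY1
    simp only [Subtype.dist_eq] at h
    linarith [Real.sqrt_nonneg (realEnergy Q (circleLaw μ Y) - e)]

/-! ### Lifts, their means and balanced pairs -/

theorem expInv_exp {u x : ℝ} (hx : x ∈ Ico u (u + 2 * Real.pi)) :
    expInv u (Circle.exp x) = x := by
  obtain ⟨k, hk⟩ := Circle.exp_eq_exp.1 (exp_expInv u (Circle.exp x))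
  have h := expInv_mem u (Circle.exp x)
  have hpi := Real.two_pi_pos
  have h1 : (k : ℝ) < 1 := by
    by_contra! h1
    nlinarith [h.2, hx.1]
  have h2 : (-1 : ℝ) < k := by
    by_contra! h2
    nlinarith [h.1, hx.2]
  have h3 : k = 0 := by
    have h1' : k < 1 := by exact_mod_cast h1
    have h2' : -1 < k := by exact_mod_cast h2
    omega
  rw [hk, h3, Int.cast_zero, zero_mul, add_zero]

theorem expInv_mono (z : Circle) : Monotone fun u => expInv u z := by
  intro a v hav
  obtain ⟨k, hk⟩ := Circle.exp_eq_exp.1 ((exp_expInv a z).trans (exp_expInv v z).symm)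
  have h1 := expInv_mem a z
  have h2 := expInv_mem v z
  have hpi := Real.two_pi_pos
  by_contra! hlt
  have h3 : (0 : ℝ) < k := by
    by_contra! h3
    have := mul_nonpos_of_nonpos_of_nonneg h3 hpi.le
    linarith
  have h4 : (1 : ℝ) ≤ k := by
    have : 0 < k := by exact_mod_cast h3
    exact_mod_cast this
  have h5 := le_mul_of_one_le_left hpi.le h4
  linarith [h1.1, h1.2, h2.1, h2.2]

theorem abs_expInv_le (u : ℝ) (z : Circle) : |expInv u z| ≤ |u| + 2 * Real.pi := by
  have h := expInv_mem u z
  rw [abs_le]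
  constructor <;> linarith [h.1, h.2, le_abs_self u, neg_abs_le u, Real.pi_pos]

theorem memLp_expInv (u : ℝ) (μ : Measure Circle) [IsFiniteMeasure μ] :
    MemLp (expInv u) 2 μ :=
  MemLp.of_bound (measurable_expInv u).aestronglyMeasurable (|u| + 2 * Real.pi)
    (Eventually.of_forall fun z => abs_expInv_le u z)

theorem integrable_expInv (u : ℝ) (μ : Measure Circle) [IsFiniteMeasure μ] :
    Integrable (expInv u) μ :=
  (memLp_expInv u μ).integrable (by norm_num)

theorem integral_lift (u : ℝ) (μ : Measure Circle) :
    ∫ x, x ∂(lift u μ) = ∫ z, expInv u z ∂μ :=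
  integral_map (measurable_expInv u).aemeasurable measurable_id.aestronglyMeasurable

/-- Moving the cut upwards only moves lifted points upwards, so equal means force the two lifts to
agree almost everywhere. -/
theorem lift_eq_lift_of_integral_eq {ν : Measure Circle} [IsProbabilityMeasure ν] {a v : ℝ}
    (h : ∫ x, x ∂(lift a ν) = ∫ x, x ∂(lift v ν)) : lift a ν = lift v ν := by
  wlog hav : a ≤ v generalizing a v
  · exact (this h.symm (le_of_not_ge hav)).symm
  rw [integral_lift, integral_lift] at h
  have h0 : ∫ z, (expInv v z - expInv a z) ∂ν = 0 := by
    refine (integral_sub (integrable_expInv v ν) (integrable_expInv a ν)).trans ?_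
    rw [h, sub_self]
  rw [integral_eq_zero_iff_of_nonneg (fun z => sub_nonneg.2 (expInv_mono z hav))
    ((integrable_expInv v ν).sub (integrable_expInv a ν))] at h0
  refine Measure.map_congr ?_
  filter_upwards [h0] with z hz
  exact (sub_eq_zero.1 hz).symm

/-- The cut is placed at the essential infimum of `Y`; the oscillation bound then confines `Y` to
the closed window of length `2π` above it. -/
theorem exists_map_eq_lift {Ω : Type*} [MeasurableSpace Ω] {μ : Measure Ω}
    [IsProbabilityMeasure μ] {Y : Ω → ℝ} (hY : AEMeasurable Y μ)
    (hosc : ∀ᵐ p ∂(μ.prod μ), |Y p.1 - Y p.2| ≤ 2 * Real.pi)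
    (hν : ∀ z, μ.map (fun o => Circle.exp (Y o)) {z} = 0) :
    ∃ a, μ.map Y = lift a (μ.map fun o => Circle.exp (Y o)) := by
  have hae := Measure.ae_ae_of_ae_prod hosc
  obtain ⟨x, hx⟩ := hae.exists
  have hb : IsBoundedUnder (· ≥ ·) (ae μ) Y :=
    ⟨Y x - 2 * Real.pi, by
      rw [eventually_map]
      filter_upwards [hx] with o ho
      linarith [(abs_le.1 ho).2]⟩
  have hc : IsBoundedUnder (· ≤ ·) (ae μ) Y :=
    ⟨Y x + 2 * Real.pi, by
      rw [eventually_map]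
      filter_upwards [hx] with o ho
      linarith [(abs_le.1 ho).1]⟩
  have h1 : ∀ᵐ o ∂μ, essInf Y μ ≤ Y o := ae_essInf_le hb
  have h2 : ∀ᵐ o ∂μ, Y o ≤ essInf Y μ + 2 * Real.pi := by
    filter_upwards [hae] with o ho
    have : Y o - 2 * Real.pi ≤ essInf Y μ := by
      refine le_essInf_of_ae_le _ ?_ hc.isCoboundedUnder_ge
      filter_upwards [ho] with o' ho'
      linarith [(abs_le.1 ho').2]
    linarith
  have hexp : AEMeasurable (fun o => Circle.exp (Y o)) μ :=
    measurable_circleExp.comp_aemeasurable hY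
  -- The lift uses a half-open interval, so the right endpoint has to be excluded; the absence of
  -- atoms does this.
  have h3 : ∀ᵐ o ∂μ, Circle.exp (Y o) ≠ Circle.exp (essInf Y μ + 2 * Real.pi) := by
    refine ae_of_ae_map hexp (p := fun z => z ≠ Circle.exp (essInf Y μ + 2 * Real.pi)) ?_
    rw [ae_iff]
    simpa using hν _
  refine ⟨essInf Y μ, ?_⟩
  rw [lift, AEMeasurable.map_map_of_aemeasurable (measurable_expInv _).aemeasurable hexp]
  refine Measure.map_congr ?_
  filter_upwards [h1, h2, h3] with o ho1 ho2 ho3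
  exact (expInv_exp ⟨ho1, lt_of_le_of_ne ho2 fun h => ho3 (by rw [h])⟩).symm

theorem wasserstein_two_map_le {Ω : Type*} [MeasurableSpace Ω] {μ : Measure Ω}
    (X Y : Lp ℝ 2 μ) : wasserstein 2 (μ.map X) (μ.map Y) ≤ ENNReal.ofReal (dist X Y) := by
  have hX := (Lp.aestronglyMeasurable X).aemeasurable
  have hY := (Lp.aestronglyMeasurable Y).aemeasurable
  have hXY : AEMeasurable (fun o => (X o, Y o)) μ := hX.prodMk hY
  rw [← edist_dist, Lp.edist_def, eLpNorm_eq_lintegral_rpow_enorm_toReal (by norm_num)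
    (by norm_num), wasserstein, ENNReal.toReal_ofNat]
  gcongr
  refine iInf_le_of_le (μ.map fun o => (X o, Y o)) (iInf_le_of_le ?_ (iInf_le_of_le ?_ ?_))
  · rw [AEMeasurable.map_map_of_aemeasurable measurable_fst.aemeasurable hXY]
    rfl
  · rw [AEMeasurable.map_map_of_aemeasurable measurable_snd.aemeasurable hXY]
    rfl
  · rw [lintegral_map' (Measurable.aemeasurable (by fun_prop)) hXY]
    refine lintegral_mono fun o => ?_
    rw [← ENNReal.ofReal_rpow_of_nonneg (abs_nonneg _) (by norm_num), Pi.sub_apply,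
      Real.enorm_eq_ofReal_abs]

theorem continuousAt_expInv {v : ℝ} {z : Circle} (h : z ≠ Circle.exp v) :
    ContinuousAt (fun u => expInv u z) v := by
  have e : (fun u => expInv u z) = fun u =>
      Int.fract ((Complex.arg (z : ℂ) - u) / (2 * Real.pi)) * (2 * Real.pi) + u := by
    funext u
    rw [expInv, toIcoMod_eq_sub, toIcoMod_eq_fract_mul]
  rw [e]
  have h1 : (Complex.arg (z : ℂ) - v) / (2 * Real.pi) ≠
      ⌊(Complex.arg (z : ℂ) - v) / (2 * Real.pi)⌋ := by
    intro h1
    rw [div_eq_iff Real.two_pi_pos.ne'] at h1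
    refine h ?_
    rw [← Circle.exp_arg z, Circle.exp_eq_exp]
    exact ⟨_, by linarith⟩
  have h2 : ContinuousAt (fun u : ℝ => (Complex.arg (z : ℂ) - u) / (2 * Real.pi)) v := by
    fun_prop
  exact ((ContinuousAt.comp (f := fun u : ℝ => (Complex.arg (z : ℂ) - u) / (2 * Real.pi))
    (continuousAt_fract h1) h2).mul_const _).add continuousAt_id

theorem continuous_integral_expInv {ν : Measure Circle} [IsProbabilityMeasure ν]
    (hν : ∀ z, ν {z} = 0) : Continuous fun v => ∫ z, expInv v z ∂ν := by
  rw [continuous_iff_continuousAt]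
  intro v
  refine continuousAt_of_dominated (bound := fun _ => |v| + 1 + 2 * Real.pi)
    (Eventually.of_forall fun u => (measurable_expInv u).aestronglyMeasurable) ?_
    (integrable_const _) ?_
  · have h : ∀ᶠ u in 𝓝 v, |u| < |v| + 1 :=
      continuous_abs.continuousAt.eventually_lt_const (lt_add_one _)
    filter_upwards [h] with u hu
    exact Eventually.of_forall fun z => (abs_expInv_le u z).trans (by linarith)
  · have h : ∀ᵐ z ∂ν, z ≠ Circle.exp v := by
      rw [ae_iff]
      simpa using hν _
    filter_upwards [h] with z hz
    exact continuousAt_expInv hz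

theorem integral_expInv_two_pi (μ : Measure Circle) [IsProbabilityMeasure μ] :
    ∫ z, expInv (2 * Real.pi) z ∂μ = ∫ z, expInv 0 z ∂μ + 2 * Real.pi := by
  have e : ∀ z, expInv (2 * Real.pi) z = expInv 0 z + 2 * Real.pi := fun z => by
    rw [expInv, expInv, ← toIcoMod_add_right', zero_add]
  simp_rw [e]
  refine (integral_add (integrable_expInv 0 μ) (integrable_const _)).trans ?_
  rw [integral_const, probReal_univ, one_smul]

theorem integral_expInv_zero_mem (μ : Measure Circle) [IsProbabilityMeasure μ] :
    ∫ z, expInv 0 z ∂μ ∈ Icc 0 (2 * Real.pi) := by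
  refine ⟨integral_nonneg fun z => (expInv_mem 0 z).1, ?_⟩
  have h := integral_mono (integrable_expInv 0 μ) (integrable_const (2 * Real.pi))
    fun z => (by linarith [(expInv_mem 0 z).2] : expInv 0 z ≤ 2 * Real.pi)
  rwa [integral_const, probReal_univ, one_smul] at h

/-- Without atoms the mean of the lift of `ν` depends continuously on the cut and sweeps an interval
of length `2π`. That interval contains the mean of the lift of `μ` at `0` or at `2π`. This rules out
the value `⊤` assigned to an empty supremum. -/
theorem balancedPairs_nonempty (μ : Measure Circle) [IsProbabilityMeasure μ] {ν : Measure Circle}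
    [IsProbabilityMeasure ν] (hν : ∀ z, ν {z} = 0) : (balancedPairs μ ν).Nonempty := by
  have hpi := Real.two_pi_pos
  have key : ∀ u ∈ Icc 0 (2 * Real.pi), ∫ z, expInv u z ∂μ ∈
      Icc (∫ z, expInv 0 z ∂ν) (∫ z, expInv (2 * Real.pi) z ∂ν) →
        (balancedPairs μ ν).Nonempty := by
    intro u hu h
    obtain ⟨v, hv, hvu⟩ := intermediate_value_Icc hpi.le
      (continuous_integral_expInv hν).continuousOn h
    exact ⟨(u, v), hu, hv, by rw [integral_lift, integral_lift]; exact hvu.symm⟩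
  have hμ0 := integral_expInv_zero_mem μ
  have hν0 := integral_expInv_zero_mem ν
  have hμ1 := integral_expInv_two_pi μ
  have hν1 := integral_expInv_two_pi ν
  rcases le_total (∫ z, expInv 0 z ∂ν) (∫ z, expInv 0 z ∂μ) with h | h
  · exact key 0 ⟨le_rfl, hpi.le⟩ ⟨h, by linarith [hμ0.2, hν0.1]⟩
  · exact key (2 * Real.pi) ⟨hpi.le, le_rfl⟩ ⟨by linarith [hμ0.1, hν0.2], by linarith⟩

/-! ### From the transport in `L²` to the modified distance -/

theorem LSI.wasserstein_lift_le {Q : Circle → ℝ} (hQ : IsCn 1 Q) {ρ : ℝ} (hρ : 0 < ρ)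
    (hLSI : LSI Q ρ) {μ : Measure Circle} [IsProbabilityMeasure μ] (hμ : logEnergy μ < ⊤)
    {u v : ℝ} (huv : ∫ x, x ∂(lift u μ) = ∫ x, x ∂(lift v (equilibriumMeasure Q))) :
    wasserstein 2 (lift u μ) (lift v (equilibriumMeasure Q)) ≤
      ENNReal.ofReal (√(realEnergy Q μ - realEnergy Q (equilibriumMeasure Q)) / √ρ) := by
  have hmin := isEnergyMinimizer_equilibriumMeasure hQ.continuous
  have := hmin.1
  set X := (memLp_expInv u μ).toLp _ with hXdef
  have hX : ∀ᵐ z ∂μ, X z = expInv u z := (memLp_expInv u μ).coeFn_toLp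
  have hlaw : (circleLaw μ X : Measure Circle) = μ := by
    rw [coe_circleLaw]
    refine (Measure.map_congr ?_).trans Measure.map_id
    filter_upwards [hX] with z hz
    rw [hz, exp_expInv, id]
  have hosc : ∀ᵐ p ∂(μ.prod μ), |X p.1 - X p.2| ≤ 2 * Real.pi := by
    filter_upwards [(Measure.quasiMeasurePreserving_fst (μ := μ) (ν := μ)).ae hX,
      (Measure.quasiMeasurePreserving_snd (μ := μ) (ν := μ)).ae hX] with p h1 h2
    rw [h1, h2, abs_le]
    have h3 := expInv_mem u p.1
    have h4 := expInv_mem u p.2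
    constructor <;> linarith [h3.1, h3.2, h4.1, h4.2]
  have hXmap : μ.map X = lift u μ := Measure.map_congr hX
  have hρ' := Real.sqrt_pos.2 hρ
  -- The transport exists only for `ε < √ρ`; the sharp constant is recovered as `ε` increases to
  -- `√ρ`.
  refine ge_of_tendsto (x := 𝓝[<] (√ρ)) (f := fun ε => ENNReal.ofReal
    (√(realEnergy Q μ - realEnergy Q (equilibriumMeasure Q)) / ε)) ?_ ?_
  · refine (ENNReal.continuous_ofReal.tendsto _).comp (tendsto_const_nhds.div ?_ hρ'.ne')
    exact tendsto_nhdsWithin_of_tendsto_nhds tendsto_id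
  filter_upwards [Ioo_mem_nhdsLT hρ'] with ε hε
  obtain ⟨Y, hYosc, hYint, hYlaw, hY⟩ := hLSI.exists_transport hQ hρ hosc
    (by rwa [hlaw]) hε.1 (by rw [← Real.sq_sqrt hρ.le]; exact pow_lt_pow_left₀ hε.2 hε.1.le two_ne_zero)
  rw [hlaw] at hY
  have hYm := (Lp.aestronglyMeasurable Y).aemeasurable
  rw [coe_circleLaw] at hYlaw
  obtain ⟨a, ha⟩ := exists_map_eq_lift hYm hYosc fun z => by
    rw [hYlaw]
    exact measure_singleton_eq_zero hmin.logEnergy_lt_top z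
  rw [hYlaw] at ha
  have hav : ∫ x, x ∂(lift a (equilibriumMeasure Q)) =
      ∫ x, x ∂(lift v (equilibriumMeasure Q)) := by
    rw [← huv, ← ha, ← hXmap]
    refine (integral_map hYm measurable_id.aestronglyMeasurable).trans (hYint.trans ?_)
    exact (integral_map (Lp.aestronglyMeasurable X).aemeasurable
      measurable_id.aestronglyMeasurable).symm
  -- The cut `a` produced by the transport need not equal `v`, but preservation of the mean makes
  -- the two lifts coincide. This handles every balanced pair at once.
  rw [← lift_eq_lift_of_integral_eq hav, ← ha, ← hXmap]
  refine (wasserstein_two_map_le X Y).trans (ENNReal.ofReal_le_ofReal ?_)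
  rw [le_div_iff₀ hε.1, mul_comm]
  exact hY

theorem LSI.modifiedWasserstein_le {Q : Circle → ℝ} (hQ : IsCn 1 Q) {ρ : ℝ} (hρ : 0 < ρ)
    (hLSI : LSI Q ρ) {μ : Measure Circle} [IsProbabilityMeasure μ] (hμ : logEnergy μ < ⊤) :
    modifiedWasserstein 2 μ (equilibriumMeasure Q) ≤
      ENNReal.ofReal (√(realEnergy Q μ - realEnergy Q (equilibriumMeasure Q)) / √ρ) := by
  have hmin := isEnergyMinimizer_equilibriumMeasure hQ.continuous
  have := hmin.1
  rw [modifiedWasserstein, if_pos (balancedPairs_nonempty μ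
    (measure_singleton_eq_zero hmin.logEnergy_lt_top))]
  exact iSup₂_le fun s hs => hLSI.wasserstein_lift_le hQ hρ hμ hs.2.2

end FreeCircle

/-- For a `C¹` potential `Q` on the circle and `ρ > 0`, `LSI(ρ)` implies `T(ρ)`. -/
theorem mainTheorem6 (Q : Circle → ℝ) (hQ : FreeCircle.IsCn 1 Q) (ρ : ℝ) (hρ : 0 < ρ)
    (hLSI : FreeCircle.LSI Q ρ) : FreeCircle.TransportationInequality Q ρ := by
  intro μ hμ
  have hmin := FreeCircle.isEnergyMinimizer_equilibriumMeasure hQ.continuous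
  have := hmin.1
  rw [FreeCircle.energy_eq_realEnergy Q hmin.logEnergy_lt_top]
  by_cases h : FreeCircle.logEnergy μ < ⊤
  · rw [FreeCircle.energy_eq_realEnergy Q h, ← EReal.coe_sub]
    have hF := sub_nonneg.2 (FreeCircle.realEnergy_equilibriumMeasure_le hQ.continuous h)
    have hW := pow_le_pow_left₀ zero_le (hLSI.modifiedWasserstein_le hQ hρ h) 2
    set F := FreeCircle.realEnergy Q μ -
      FreeCircle.realEnergy Q (FreeCircle.equilibriumMeasure Q) with hFdef
    rw [← ENNReal.ofReal_pow (by positivity), div_pow, Real.sq_sqrt hF, Real.sq_sqrt hρ.le] at hW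
    calc _ ≤ (ρ : EReal) * ((ENNReal.ofReal (F / ρ) : ℝ≥0∞) : EReal) :=
          mul_le_mul_of_nonneg_left (EReal.coe_ennreal_le_coe_ennreal_iff.2 hW)
            (EReal.coe_nonneg.2 hρ.le)
      _ = (F : EReal) := by
          rw [EReal.coe_ennreal_ofReal, max_eq_left (by positivity), ← EReal.coe_mul,
            mul_div_cancel₀ _ hρ.ne']
  · rw [FreeCircle.energy_eq_top Q h, EReal.top_sub_coe]
    exact le_top
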